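/- Let $\mathbb K$ be an algebraically closed field, $k\ge 3$, $d=2k$, and let $u_0,u_1,u_2\in\mathbb K[T_0,T_1]$ be homogeneous of degree $d$ without common factor. Let $I=\langle u_0,u_1,u_2\rangle$, and let $\mathcal K$ be the kernel of the $\mathbb K[T_0,T_1]$-algebra map $\mathbb K[T_0,T_1][X_0,X_1,X_2]\to \mathrm{Rees}(I)=\bigoplus_{n\ge0} I^nZ^n$, $X_i\mapsto u_iZ$. Suppose that $\phi=(u_0:u_1:u_2):\mathbb P^1\to\mathbb P^2$ is proper (birational onto its image $\mathcal C$), that $\mu=2$, where $\mu$ is the lowest degree of a nonzero homogeneous syzygy of $(u_0,u_1,u_2)$, and that $\mathcal C$ has a very singular point ${\bf p}$, that is, a point of multiplicity greater than $\mu$. Let $\mathcal E_d\in\mathbb K[X_0,X_1,X_2]$ be the irreducible polynomial defining $\mathcal C$ (unique up to a nonzero constant), and let $\ell_0,\ell_1$ be any two linearly independent linear forms in $X_0,X_1,X_2$ vanishing at ${\bf p}$ (if ${\bf p}=(0:0:1)$ one may take $\ell_0=X_0$, $\ell_1=X_1$). Identify a syzygy $(s_0,s_1,s_2)$ with $s_0X_0+s_1X_1+s_2X_2$.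 Consider polynomials chosen as follows; the index of $F_{i,j}$ is its bidegree in $(T,X)$. 1. $F_{2,1}=p^1\ell_0-p^0\ell_1$, with $p^0,p^1\in\mathbb K[T_0,T_1]$ homogeneous of degree $2$, and $F_{2(k-1),1}$ form a homogeneous basis, in $T$-degrees $2$ and $d-2$, of the $\mathbb K[T_0,T_1]$-module of syzygies of $(u_0,u_1,u_2)$. 2. For $1\le j<k-1$, write $F_{2(k-j),j}=p^0G^0+p^1G^1$ with $G^0,G^1$ bihomogeneous of bidegree $(2(k-j-1),j)$, and put $F_{2(k-j-1),j+1}=\ell_0G^0+\ell_1G^1$. 3. Write $F_{2,1}=T_0^2f_0+T_1^2f_1+T_0T_1f_*$ and $F_{2,k-1}=T_0^2m_0+T_1^2m_1+T_0T_1m_*$ with $f_0,f_1,f_*,m_0,m_1,m_*\in\mathbb K[X_0,X_1,X_2]$, and define the $T$-linear forms $F^0_{1,k},F^1_{1,k}$ by $$m_0F_{2,1}-f_0F_{2,k-1}=T_1F^0_{1,k},\qquad m_1F_{2,1}-f_1F_{2,k-1}=T_0F^1_{1,k}.$$ Such choices exist, and for every such choice the set $$\{\mathcal E_d,\;F^0_{1,k},\;F^1_{1,k},\;F_{2,1},\;F_{2,k-1},\;F_{4,k-2},\;\ldots,\;F_{2(k-1),1}\}$$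 has exactly $k+3=\frac{d+6}2$ elements and is a minimal generating set of $\mathcal K$: it generates $\mathcal K$, and no proper subset of it does. -/

import Mathlib

namespace ReesCurve

open MvPolynomial

/-- `𝕂[T₀, T₁]`. -/
abbrev PolyT (K : Type*) [Field K] := MvPolynomial (Fin 2) K

/-- `𝕂[X₀, X₁, X₂]`. -/
abbrev PolyX (K : Type*) [Field K] := MvPolynomial (Fin 3) K

/-- `𝕂[T₀, T₁][X₀, X₁, X₂]`. -/
abbrev PolyTX (K : Type*) [Field K] := MvPolynomial (Fin 3) (MvPolynomial (Fin 2) K)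

/-- The inclusion `𝕂[X] ⊆ 𝕂[T][X]`. -/
noncomputable def ofX {K : Type*} [Field K] : PolyX K →+* PolyTX K :=
  MvPolynomial.map MvPolynomial.C

/-- The linear form `a₀ X₀ + a₁ X₁ + a₂ X₂` in `𝕂[T][X]`, with coefficients in `𝕂[T]`. -/
noncomputable def linForm {K : Type*} [Field K] (a : Fin 3 → PolyT K) : PolyTX K :=
  ∑ i, C (a i) * X i

/-- `G` is bihomogeneous of bidegree `(i, j)`: `T`-degree `i` and `X`-degree `j`. -/
def IsBihomogeneous {K : Type*} [Field K] (G : PolyTX K) (i j : ℕ) : Prop :=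
  G.IsHomogeneous j ∧ ∀ m, (G.coeff m).IsHomogeneous i

/-! ### The Rees algebra and its defining ideal -/

/-- The ideal `I = ⟨u₀, u₁, u₂⟩` of `𝕂[T]`. -/
noncomputable def paramIdeal {K : Type*} [Field K] (u : Fin 3 → PolyT K) : Ideal (PolyT K) :=
  Ideal.span (Set.range u)

/-- The epimorphism `Φ : 𝕂[T][X] → Rees(I) = ⨁ Iⁿ Zⁿ`, `Xᵢ ↦ uᵢ Z`. -/
noncomputable def reesMap {K : Type*} [Field K] (u : Fin 3 → PolyT K) :
    PolyTX K →ₐ[PolyT K] reesAlgebra (paramIdeal u) :=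
  MvPolynomial.aeval fun i =>
    ⟨Polynomial.monomial 1 (u i), reesAlgebra.monomial_mem.2
      ((pow_one (paramIdeal u)).symm ▸ Ideal.subset_span (Set.mem_range_self i))⟩

/-- The defining ideal `𝒦 = ker Φ` of the Rees algebra of `I`. -/
noncomputable def definingIdeal {K : Type*} [Field K] (u : Fin 3 → PolyT K) : Ideal (PolyTX K) :=
  RingHom.ker (reesMap u)

/-! ### The parametrization, its image, syzygies -/

/-- The `uᵢ` have no common factor. -/
def NoCommonFactor {K : Type*} [Field K] (u : Fin 3 → PolyT K) : Prop :=
  ∀ g : PolyT K, (∀ i, g ∣ u i) → IsUnit g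

/-- The map `φ : ℙ¹ → ℙ²`, `(t₀ : t₁) ↦ (u₀(t) : u₁(t) : u₂(t))` is birational onto its image `𝒞`:
there is a rational map `(A : B) : 𝒞 ⇢ ℙ¹`, given by two forms of the same degree that do not both
vanish identically on `𝒞`, such that `(A(u(T)) : B(u(T))) = (T₀ : T₁)`. (That `φ ∘ (A : B)` is the
identity of `𝒞` is a formal consequence, as `φ` is onto `𝒞`.) -/
def IsProperParametrization {K : Type*} [Field K] (u : Fin 3 → PolyT K) : Prop :=
  ∃ (l : ℕ) (A B : PolyX K), A.IsHomogeneous l ∧ B.IsHomogeneous l ∧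
    (aeval u A ≠ 0 ∨ aeval u B ≠ 0) ∧ X 1 * aeval u A = X 0 * aeval u B

/-- The affine cone in `𝕂³` over the image of `φ`. -/
def curveCone {K : Type*} [Field K] (u : Fin 3 → PolyT K) : Set (Fin 3 → K) :=
  {x | ∃ (c : K) (t : Fin 2 → K), x = fun i => c * eval t (u i)}

/-- `E` is the irreducible polynomial (unique up to a nonzero constant) whose zero set is the
image of `φ`. -/
def IsImplicitEquation {K : Type*} [Field K] (u : Fin 3 → PolyT K) (E : PolyX K) : Prop :=
  Irreducible E ∧ ∀ x : Fin 3 → K, eval x E = 0 ↔ x ∈ curveCone u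

/-- The multiplicity at `p` of the plane curve `E = 0`: the lowest degree of a nonzero term in the
Taylor expansion `E(p + X)` of `E` at `p`. For `E` homogeneous and `p ≠ 0` this does not depend on
the representative `p` of the point of `ℙ²`, and it is the multiplicity in any affine chart, as the
cone over the curve is, near `p`, the product of the curve and a line. -/
noncomputable def curveMult {K : Type*} [Field K] (E : PolyX K) (p : Fin 3 → K) : ℕ :=
  sInf {n | homogeneousComponent n (aeval (fun i => (X i + C (p i) : PolyX K)) E) ≠ 0}

/-- `Syz(I)`, the module of syzygies `(s₀, s₁, s₂)` of `(u₀, u₁, u₂)`. -/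
noncomputable def syz {K : Type*} [Field K] (u : Fin 3 → PolyT K) : Submodule (PolyT K) (Fin 3 → PolyT K) :=
  LinearMap.ker (Fintype.linearCombination (PolyT K) u)

/-- `μ`, the lowest degree of a nonzero homogeneous syzygy of `(u₀, u₁, u₂)`. -/
noncomputable def mu {K : Type*} [Field K] (u : Fin 3 → PolyT K) : ℕ :=
  sInf {n | ∃ s ∈ syz u, s ≠ 0 ∧ ∀ i, (s i).IsHomogeneous n}

/-- `P` and `Q` form a `μ`-basis of `I`: through `(s₀, s₁, s₂) ↦ s₀ X₀ + s₁ X₁ + s₂ X₂` they are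
a basis of `Syz(I)` over `𝕂[T]`, homogeneous of `T`-degrees `m` and `n`. -/
def IsMuBasis {K : Type*} [Field K] (u : Fin 3 → PolyT K) (m n : ℕ) (P Q : PolyTX K) : Prop :=
  ∃ s t : Fin 3 → PolyT K, P = linForm s ∧ Q = linForm t ∧
    (∀ i, (s i).IsHomogeneous m) ∧ (∀ i, (t i).IsHomogeneous n) ∧
    LinearIndependent (PolyT K) ![s, t] ∧ Submodule.span (PolyT K) {s, t} = syz u

/-- With `E` the equation of the curve, the point `p` of the curve is very singular: its
multiplicity is greater than `μ`. -/
def IsVerySingular {K : Type*} [Field K] (u : Fin 3 → PolyT K) (E : PolyX K) (p : Fin 3 → K) :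
    Prop :=
  p ≠ 0 ∧ eval p E = 0 ∧ mu u < curveMult E p

/-! ### The special elements of `𝒦` -/

/-- `D` is a value of the operator `𝒟_T` on `G`: for some decomposition `G = p⁰ G⁰ + p¹ G¹` with
`G⁰`, `G¹` bihomogeneous of bidegree `(i, j)`, one has `D = ℓ₀ G⁰ + ℓ₁ G¹`. -/
def IsDT {K : Type*} [Field K] (p₀ p₁ : PolyT K) (l₀ l₁ : PolyTX K) (i j : ℕ)
    (G D : PolyTX K) : Prop :=
  ∃ G₀ G₁ : PolyTX K, IsBihomogeneous G₀ i j ∧ IsBihomogeneous G₁ i j ∧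
    G = C p₀ * G₀ + C p₁ * G₁ ∧ D = l₀ * G₀ + l₁ * G₁

/-- The form `T₀² c₀ + T₁² c₁ + T₀ T₁ c₂` with `c₀, c₁, c₂ ∈ 𝕂[X]`. -/
noncomputable def quadT {K : Type*} [Field K] (c₀ c₁ c₂ : PolyX K) : PolyTX K :=
  C (X 0 ^ 2) * ofX c₀ + C (X 1 ^ 2) * ofX c₁ + C (X 0 * X 1) * ofX c₂

/-- `L₀` and `L₁` are the two `T`-linear forms derived from the `T`-quadratic forms `P` and `M`:
if `f₀, m₀` are the coefficients of `T₀²` and `f₁, m₁` those of `T₁²` in `P` and `M`, then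
`m₀ P - f₀ M = T₁ L₀` and `m₁ P - f₁ M = T₀ L₁`. -/
def IsLinearPair {K : Type*} [Field K] (P M L₀ L₁ : PolyTX K) : Prop :=
  ∃ f₀ f₁ f₂ m₀ m₁ m₂ : PolyX K, P = quadT f₀ f₁ f₂ ∧ M = quadT m₀ m₁ m₂ ∧
    ofX m₀ * P - ofX f₀ * M = C (X 1) * L₀ ∧ ofX m₁ * P - ofX f₁ * M = C (X 0) * L₁

/-- The elements attached to a parametrization of degree `2k` with `μ = 2`, in coordinates whose
first two are the linear forms `ℓ₀ = Σ aᵢ Xᵢ` and `ℓ₁ = Σ bᵢ Xᵢ` (for `ℓ₀ = X₀`, `ℓ₁ = X₁` the very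
singular point is `(0 : 0 : 1)`):
* `P = F_{2,1} = p¹ ℓ₀ - p⁰ ℓ₁` with `p⁰`, `p¹` of degree `2`, and `P`, `F 1 = F_{2(k-1),1}` are a
  `μ`-basis;
* `F (j + 1) = F_{2(k-j-1),j+1}` is a value of `𝒟_T` on `F j = F_{2(k-j),j}`, for `1 ≤ j < k - 1`;
* `L₀ = F⁰_{1,k}` and `L₁ = F¹_{1,k}` are the linear forms derived from `F_{2,1}` and
  `F (k - 1) = F_{2,k-1}`. -/
def IsSpecialFamily {K : Type*} [Field K] (u : Fin 3 → PolyT K) (k : ℕ) (a b : Fin 3 → K)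
    (P : PolyTX K) (F : ℕ → PolyTX K) (L₀ L₁ : PolyTX K) : Prop :=
  ∃ p₀ p₁ : PolyT K, p₀.IsHomogeneous 2 ∧ p₁.IsHomogeneous 2 ∧
    P = C p₁ * linForm (fun i => C (a i)) - C p₀ * linForm (fun i => C (b i)) ∧
    IsMuBasis u 2 (2 * (k - 1)) P (F 1) ∧
    (∀ j, 1 ≤ j → j < k - 1 →
      IsDT p₀ p₁ (linForm fun i => C (a i)) (linForm fun i => C (b i)) (2 * (k - j - 1)) j
        (F j) (F (j + 1))) ∧
    IsLinearPair P (F (k - 1)) L₀ L₁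

/-- The set `{𝓔_d, F⁰_{1,k}, F¹_{1,k}, F_{2,1}, F_{2,k-1}, …, F_{2(k-1),1}}`. -/
def specialSet {K : Type*} [Field K] (k : ℕ) (E : PolyX K)
    (P : PolyTX K) (F : ℕ → PolyTX K) (L₀ L₁ : PolyTX K) : Set (PolyTX K) :=
  {ofX E, L₀, L₁, P} ∪ F '' Set.Icc 1 (k - 1)

/-- `S` is a minimal generating set of the ideal `J`: it generates `J`, and no proper subset of
`S` does. -/
def IsMinimalGeneratingSet {R : Type*} [CommRing R] (J : Ideal R) (S : Set R) : Prop :=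
  Ideal.span S = J ∧ ∀ S' : Set R, S' ⊂ S → Ideal.span S' ≠ J

end ReesCurve

/-! Complete `ℓ₀`, `ℓ₁` to coordinates by a third linear form `c`. The syzygy `P = p₁ ℓ₀ - p₀ ℓ₁` of
degree `2` gives `ℓ₀(u) = g p₀`, `ℓ₁(u) = g p₁`, `c(u) = w`, with `p₀, p₁` coprime quadrics, `g` of
degree `2(k-1)` and `w` of degree `2k` coprime to `g` (`IsFrame`). Everything then happens in
`𝕂[T][Z]`, through the substitution `psi`: `ℓ₀ ↦ p₀ Z`, `ℓ₁ ↦ p₁ Z`, `c ↦ 1`. An `X`-form is killed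
by `psi` iff `P` divides it. An `X`-form vanishes at `u` iff its image has the root `Z = g/w`, that
is, iff `W = w Z - g` divides the image (Gauss). In `T`-degree `i ≥ 1` and `X`-degree `j`, `psi`
reaches every polynomial of `Z`-degree at most `j` whose coefficient of `Zⁿ` has degree `i + 2n`,
because forms of degree at least `3` lie in `(p₀, p₁)`.

The operator `𝒟_T` becomes multiplication by `Z`, so `F j ↦ c Z^(j-1) W` with a nonzero constant
`c`, and `L₀, L₁ ↦ l₀ Z^(k-1) W, l₁ Z^(k-1) W` with independent linear forms `l₀, l₁` in `T`.

Generation: in positive `T`-degree divide `psi G` by `W` and treat each term `q Zⁿ` of the quotient: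
for `n ≤ k - 2` it comes from `F (n + 1)`, for larger `n` from `L₀, L₁`, which serve as `T₀, T₁`. In
`T`-degree `0` only multiples of `E` occur.

Minimality: after division by `W`, low-degree parts of single coefficients in `Z` show that no
generator is a combination of the others. This needs `deg E > k` (`lt_degree_implicitEquation`):
otherwise `u` would factor through `(p₀ : p₁)`, against properness.

Existence: let `r` be the degree of the projection of the parametrization from the very singular
point. Properness bounds `r` by the degree of `E` in the third coordinate, which is at most `deg E -
3 ≤ 2k - 3`. So the common factor `g` of `ℓ₀(u), ℓ₁(u)` has degree at least `3`. A syzygy of degree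
`2` then cannot involve `c`, which forces `r = 2`. -/

namespace ReesCurve

open MvPolynomial

/-! ### Homogeneous components, and factors of forms. -/

section Graded

variable {σ R S : Type*}

/-- The extra variable records the degree. This serves both to extract homogeneous components and to
read off the grading of the Rees algebra. -/
theorem coeff_aeval_monomial_one [CommSemiring R] [CommSemiring S] [Algebra R S] (v : σ → S)
    (G : MvPolynomial σ R) (j : ℕ) :
    (aeval (fun i => Polynomial.monomial 1 (v i)) G : Polynomial S).coeff j =
      aeval v (homogeneousComponent j G) := by
  classical
  induction G using MvPolynomial.induction_on' with
  | monomial m r =>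
    have h : (m.prod fun i e => (Polynomial.monomial 1 (v i)) ^ e) =
        Polynomial.monomial m.degree (m.prod fun i e => v i ^ e) := by
      simp only [Finsupp.prod, Polynomial.monomial_pow, one_mul, Finsupp.degree_apply]
      induction m.support using Finset.induction_on with
      | empty => simp
      | insert a s ha ih =>
        rw [Finset.prod_insert ha, ih, Polynomial.monomial_mul_monomial, Finset.sum_insert ha,
          Finset.prod_insert ha]
    rw [aeval_monomial, h, Polynomial.algebraMap_apply, Polynomial.C_mul_monomial,
      Polynomial.coeff_monomial]
    split_ifs with hj
    · rw [homogeneousComponent_eq_self (isHomogeneous_monomial r hj), aeval_monomial]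
    · rw [homogeneousComponent_of_mem (isHomogeneous_monomial r rfl), if_neg (Ne.symm hj), map_zero]
  | add p q hp hq => rw [map_add, Polynomial.coeff_add, hp, hq, map_add, map_add]

/-- The homogeneous components of `G`, as the coefficients of a polynomial. -/
noncomputable def gradingHom [CommSemiring R] :
    MvPolynomial σ R →ₐ[R] Polynomial (MvPolynomial σ R) :=
  aeval fun i => Polynomial.monomial 1 (X i)

theorem coeff_gradingHom [CommSemiring R] (G : MvPolynomial σ R) (j : ℕ) :
    (gradingHom G).coeff j = homogeneousComponent j G := by
  rw [gradingHom, coeff_aeval_monomial_one, aeval_X_left_apply]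

theorem gradingHom_of_isHomogeneous [CommSemiring R] {G : MvPolynomial σ R} {n : ℕ}
    (hG : G.IsHomogeneous n) : gradingHom G = Polynomial.monomial n G := by
  ext1 j
  rw [coeff_gradingHom, homogeneousComponent_of_mem hG, Polynomial.coeff_monomial]
  simp [eq_comm]

theorem homogeneousComponent_mul_of_isHomogeneous [CommSemiring R] {f : MvPolynomial σ R} {n : ℕ}
    (hf : f.IsHomogeneous n) (q : MvPolynomial σ R) (k : ℕ) :
    homogeneousComponent (k + n) (q * f) = homogeneousComponent k q * f := by
  rw [← coeff_gradingHom, map_mul, gradingHom_of_isHomogeneous hf, Polynomial.coeff_mul_monomial,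
    coeff_gradingHom]

theorem homogeneousComponent_mul_of_isHomogeneous_of_lt [CommSemiring R] {f : MvPolynomial σ R}
    {n : ℕ} (hf : f.IsHomogeneous n) (q : MvPolynomial σ R) {k : ℕ} (hk : k < n) :
    homogeneousComponent k (q * f) = 0 := by
  rw [← coeff_gradingHom, map_mul, gradingHom_of_isHomogeneous hf,
    ← Polynomial.C_mul_X_pow_eq_monomial, ← mul_assoc, Polynomial.coeff_mul_X_pow', if_neg (by omega)]

theorem eq_of_homogeneousComponent_eq [CommSemiring R] {f g : MvPolynomial σ R}
    (h : ∀ j, homogeneousComponent j f = homogeneousComponent j g) : f = g := by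
  ext m
  have := congrArg (coeff m) (h m.degree)
  simpa [coeff_homogeneousComponent] using this

theorem gradingHom_injective [CommSemiring R] :
    Function.Injective (gradingHom (σ := σ) (R := R)) := fun f g h =>
  eq_of_homogeneousComponent_eq fun j => by rw [← coeff_gradingHom, h, coeff_gradingHom]

theorem isHomogeneous_of_homogeneousComponent_eq_zero [CommSemiring R] {f : MvPolynomial σ R} {n : ℕ}
    (h : ∀ j, j ≠ n → homogeneousComponent j f = 0) : f.IsHomogeneous n := by
  have : f = homogeneousComponent n f := eq_of_homogeneousComponent_eq fun j => by
    rw [homogeneousComponent_of_mem (homogeneousComponent_isHomogeneous n f)]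
    split_ifs with hj
    · rw [hj]
    · exact h j hj
  rw [this]
  exact homogeneousComponent_isHomogeneous n f

/-- Factors of a nonzero form are forms. -/
theorem exists_isHomogeneous_of_mul [CommRing R] [IsDomain R] {f g : MvPolynomial σ R} {n : ℕ}
    (h : (f * g).IsHomogeneous n) (h0 : f * g ≠ 0) :
    ∃ i j, i + j = n ∧ f.IsHomogeneous i ∧ g.IsHomogeneous j := by
  have hf : gradingHom f ≠ 0 := fun hz => left_ne_zero_of_mul h0
    (gradingHom_injective (hz.trans (map_zero _).symm))
  have hg : gradingHom g ≠ 0 := fun hz => right_ne_zero_of_mul h0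
    (gradingHom_injective (hz.trans (map_zero _).symm))
  have hm : gradingHom f * gradingHom g = Polynomial.monomial n (f * g) := by
    rw [← map_mul, gradingHom_of_isHomogeneous h]
  -- Degree and trailing degree both add up, and they agree on the product, a monomial; hence they
  -- agree on each factor.
  have h1 := Polynomial.natDegree_mul hf hg
  have h2 := Polynomial.natTrailingDegree_mul hf hg
  rw [hm, Polynomial.natDegree_monomial_eq _ h0] at h1
  rw [hm, Polynomial.natTrailingDegree_monomial h0] at h2
  have h3 := Polynomial.natTrailingDegree_le_natDegree (gradingHom f)
  have h4 := Polynomial.natTrailingDegree_le_natDegree (gradingHom g)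
  have key : ∀ q : MvPolynomial σ R, (gradingHom q).natTrailingDegree = (gradingHom q).natDegree →
      q.IsHomogeneous (gradingHom q).natDegree := by
    intro q hq
    refine isHomogeneous_of_homogeneousComponent_eq_zero fun j hj => ?_
    rw [← coeff_gradingHom]
    rcases lt_or_gt_of_ne hj with hlt | hlt
    · exact Polynomial.coeff_eq_zero_of_lt_natTrailingDegree (hq ▸ hlt)
    · exact Polynomial.coeff_eq_zero_of_natDegree_lt hlt
  exact ⟨_, _, h1.symm, key f (by omega), key g (by omega)⟩

/-- Specialize the grading variable to `c`. -/
theorem aeval_smul_of_isHomogeneous [CommSemiring R] [CommSemiring S] [Algebra R S]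
    {G : MvPolynomial σ R} {n : ℕ} (hG : G.IsHomogeneous n) (v : σ → S) (c : S) :
    aeval (fun i => c * v i) G = c ^ n * aeval v G := by
  have h : (aeval (fun i => Polynomial.monomial 1 (v i)) G : Polynomial S) =
      Polynomial.monomial n (aeval v G) := by
    ext j
    rw [coeff_aeval_monomial_one, homogeneousComponent_of_mem hG, Polynomial.coeff_monomial]
    simp only [eq_comm]
    split_ifs <;> simp
  have h2 := congrArg (Polynomial.evalRingHom c) h
  have h3 : (Polynomial.evalRingHom c) (aeval (fun i => Polynomial.monomial 1 (v i)) G) =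
      aeval (fun i => c * v i) G := by
    rw [aeval_def, ← MvPolynomial.coe_eval₂Hom, ← RingHom.comp_apply]
    rw [aeval_def, ← MvPolynomial.coe_eval₂Hom]
    congr 1
    ext i <;> simp [mul_comm]
  rw [← h3, h2]
  simp [mul_comm]

/-- The quotient of two forms is a form, of the expected degree. -/
theorem isHomogeneous_of_mul_left [CommRing R] [IsDomain R] {f g : MvPolynomial σ R} {n e : ℕ}
    (hg : g.IsHomogeneous e) (hg0 : g ≠ 0) (h : (g * f).IsHomogeneous n) (hf0 : f ≠ 0) :
    ∃ j, e + j = n ∧ f.IsHomogeneous j := by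
  obtain ⟨i, j, hij, hi, hj⟩ := exists_isHomogeneous_of_mul h (mul_ne_zero hg0 hf0)
  exact ⟨j, by rw [hg.inj_right hi hg0, hij], hj⟩

theorem eq_zero_of_dvd_of_isHomogeneous_of_lt [CommRing R] [IsDomain R] {f g : MvPolynomial σ R}
    {n e : ℕ} (hg : g.IsHomogeneous e) (hf : f.IsHomogeneous n) (h : g ∣ f) (hlt : n < e) :
    f = 0 := by
  obtain ⟨q, rfl⟩ := h
  by_contra h0
  obtain ⟨j, hj, -⟩ := isHomogeneous_of_mul_left hg (left_ne_zero_of_mul h0) hf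
    (right_ne_zero_of_mul h0)
  omega

end Graded

/-! ### Binary forms, and dimensions of spaces of forms. -/

section TwoVariables

variable {K : Type*} [Field K]

/-- A form of positive degree lies in the irrelevant ideal. -/
theorem exists_eq_X_mul_add {R : Type*} [CommRing R] {f : MvPolynomial (Fin 2) R} {n : ℕ}
    (hf : f.IsHomogeneous (n + 1)) :
    ∃ f₀ f₁ : MvPolynomial (Fin 2) R, f₀.IsHomogeneous n ∧ f₁.IsHomogeneous n ∧
      f = X 0 * f₀ + X 1 * f₁ := by
  have hmem : f ∈ Ideal.span (X '' (Set.univ : Set (Fin 2)) : Set (MvPolynomial (Fin 2) R)) := by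
    rw [mem_ideal_span_X_image]
    intro m hm
    have h := hf.degree_eq_sum_deg_support hm
    by_contra hc
    push Not at hc
    have : m = 0 := Finsupp.ext fun i => hc i (Set.mem_univ i)
    simp [this] at h
  have hset : (X '' (Set.univ : Set (Fin 2)) : Set (MvPolynomial (Fin 2) R)) = {X 0, X 1} := by
    ext; simp [Fin.exists_fin_two, eq_comm]
  rw [hset, Ideal.mem_span_pair] at hmem
  obtain ⟨q₀, q₁, h⟩ := hmem
  refine ⟨homogeneousComponent n q₀, homogeneousComponent n q₁,
    homogeneousComponent_isHomogeneous _ _, homogeneousComponent_isHomogeneous _ _, ?_⟩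
  rw [← homogeneousComponent_eq_self hf, ← h, map_add,
    homogeneousComponent_mul_of_isHomogeneous (isHomogeneous_X R 0),
    homogeneousComponent_mul_of_isHomogeneous (isHomogeneous_X R 1)]
  ring

theorem finrank_homogeneousSubmodule (σ : Type*) [Fintype σ] [DecidableEq σ] (n : ℕ) :
    Module.finrank K (homogeneousSubmodule σ K n) = (Fintype.card σ + n - 1).choose n := by
  have e : Sym σ n ≃ {d : σ →₀ ℕ // d.degree = n} := Sym.equivNatSum σ n
  let _ : Fintype {d : σ →₀ ℕ // d.degree = n} := Fintype.ofEquiv _ e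
  have hli : LinearIndependent K
      (fun d : {d : σ →₀ ℕ // d.degree = n} => (monomial d.1 1 : MvPolynomial σ K)) := by
    have := (basisMonomials σ K).linearIndependent.comp
      (fun d : {d : σ →₀ ℕ // d.degree = n} => d.1) Subtype.val_injective
    simpa [Function.comp_def] using this
  have hspan : Submodule.span K (Set.range
      (fun d : {d : σ →₀ ℕ // d.degree = n} => (monomial d.1 1 : MvPolynomial σ K))) =
      homogeneousSubmodule σ K n := by
    apply le_antisymm
    · rw [Submodule.span_le]
      rintro _ ⟨d, rfl⟩
      exact isHomogeneous_monomial 1 d.2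
    · intro f hf
      rw [f.as_sum]
      refine Submodule.sum_mem _ fun m hm => ?_
      have hd : m.degree = n := by
        by_contra hne
        exact mem_support_iff.1 hm (IsHomogeneous.coeff_eq_zero hf hne)
      rw [show monomial m (coeff m f) = coeff m f • monomial m (1 : K) by
        rw [smul_monomial, smul_eq_mul, mul_one]]
      exact Submodule.smul_mem _ _ (Submodule.subset_span ⟨⟨m, hd⟩, rfl⟩)
  rw [← hspan, finrank_span_eq_card hli, ← Sym.card_sym_eq_choose, Fintype.card_congr e]

instance (σ : Type*) [Finite σ] (n : ℕ) : Module.Finite K (homogeneousSubmodule σ K n) :=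
  Module.Finite.iff_fg.2 (homogeneousSubmodule_fg σ K n)

theorem finrank_homogeneousSubmodule_fin_two (n : ℕ) :
    Module.finrank K (homogeneousSubmodule (Fin 2) K n) = n + 1 := by
  rw [finrank_homogeneousSubmodule, Fintype.card_fin, show 2 + n - 1 = n + 1 by omega,
    Nat.choose_succ_self_right]

theorem finrank_homogeneousSubmodule_fin_three (n : ℕ) :
    2 * Module.finrank K (homogeneousSubmodule (Fin 3) K n) = (n + 1) * (n + 2) := by
  rw [finrank_homogeneousSubmodule, Fintype.card_fin, show 3 + n - 1 = n + 2 by omega,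
    Nat.choose_symm_add, Nat.choose_two_right, Nat.mul_div_cancel' (Nat.even_mul_pred_self _).two_dvd]
  simp [mul_comm]

end TwoVariables

/-! ### Additive maps applied to coefficients. -/

section MapCoeff

variable {σ R S : Type*} [CommSemiring R] [CommSemiring S]

/-- The polynomial obtained by applying an additive map to the coefficients of `G`. -/
noncomputable def mapCoeff (L : R →+ S) (G : MvPolynomial σ R) : MvPolynomial σ S :=
  ∑ m ∈ G.support, monomial m (L (coeff m G))

@[simp]
theorem coeff_mapCoeff (L : R →+ S) (G : MvPolynomial σ R) (m : σ →₀ ℕ) :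
    coeff m (mapCoeff L G) = L (coeff m G) := by
  classical
  simp only [mapCoeff, coeff_sum, coeff_monomial, Finset.sum_ite_eq', mem_support_iff]
  split_ifs with h
  · rfl
  · rw [not_not.1 h, map_zero]

theorem isHomogeneous_mapCoeff (L : R →+ S) {G : MvPolynomial σ R} {n : ℕ} (hG : G.IsHomogeneous n) :
    (mapCoeff L G).IsHomogeneous n := by
  intro m hm
  rw [coeff_mapCoeff] at hm
  exact hG fun h => hm (by rw [h, map_zero])

end MapCoeff

/-! ### Gauss's lemma for a linear factor. -/

section LinearFactor

open Polynomial in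
/-- A polynomial with the root `g / w`, a reduced fraction, is divisible by `w Z - g`. -/
theorem linear_dvd_of_aeval_div_eq_zero {R : Type*} [CommRing R] [IsDomain R]
    [UniqueFactorizationMonoid R] (F : Type*) [Field F] [Algebra R F] [IsFractionRing R F] {g w : R}
    (hgw : IsRelPrime g w) (hw : w ≠ 0) {f : R[X]}
    (hf : Polynomial.aeval (algebraMap R F g / algebraMap R F w) f = 0) :
    Polynomial.C w * Polynomial.X - Polynomial.C g ∣ f := by
  have hw' : algebraMap R F w ≠ 0 := by
    simpa using (IsFractionRing.injective R F).ne hw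
  -- A common divisor of the coefficients divides both `g` and `w`; primitivity brings divisibility
  -- over the fraction field down to `R`.
  have hprim : (Polynomial.C w * Polynomial.X - Polynomial.C g).IsPrimitive := by
    intro r hr
    rw [Polynomial.C_dvd_iff_dvd_coeff] at hr
    have h0 := hr 0
    have h1 := hr 1
    simp at h0 h1
    exact hgw h0 h1
  apply hprim.dvd_of_fraction_map_dvd_fraction_map (K := F)
  have : (Polynomial.C w * Polynomial.X - Polynomial.C g).map (algebraMap R F) =
      Polynomial.C (algebraMap R F w) *
        (Polynomial.X - Polynomial.C (algebraMap R F g / algebraMap R F w)) := by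
    rw [mul_sub, ← Polynomial.C_mul, mul_div_cancel₀ _ hw']
    simp
  rw [this, (Polynomial.isUnit_C.2 (isUnit_iff_ne_zero.2 hw')).mul_left_dvd,
    Polynomial.dvd_iff_isRoot, Polynomial.IsRoot, Polynomial.eval_map_algebraMap, hf]

end LinearFactor

/-! ### Coprime binary quadrics. -/

section Quadrics

variable {K : Type*} [Field K]

theorem exists_eq_C_of_isHomogeneous_zero {σ R : Type*} [CommSemiring R] {f : MvPolynomial σ R}
    (hf : f.IsHomogeneous 0) : ∃ c : R, f = C c :=
  ⟨_, totalDegree_eq_zero_iff_eq_C.1 ((totalDegree_zero_iff_isHomogeneous _).2 hf)⟩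

theorem exists_eq_linear {f : PolyT K} (hf : f.IsHomogeneous 1) :
    ∃ a b : K, f = C a * X 0 + C b * X 1 := by
  obtain ⟨f₀, f₁, h₀, h₁, rfl⟩ := exists_eq_X_mul_add hf
  obtain ⟨a, rfl⟩ := exists_eq_C_of_isHomogeneous_zero h₀
  obtain ⟨b, rfl⟩ := exists_eq_C_of_isHomogeneous_zero h₁
  exact ⟨a, b, by ring⟩

theorem exists_eq_quadratic {f : PolyT K} (hf : f.IsHomogeneous 2) :
    ∃ a b c : K, f = C a * X 0 ^ 2 + C b * X 1 ^ 2 + C c * (X 0 * X 1) := by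
  obtain ⟨f₀, f₁, h₀, h₁, rfl⟩ := exists_eq_X_mul_add hf
  obtain ⟨a, b, rfl⟩ := exists_eq_linear h₀
  obtain ⟨c, d, rfl⟩ := exists_eq_linear h₁
  exact ⟨a, d, b + c, by rw [C_add]; ring⟩

theorem isHomogeneous_linear (a b : K) : (C a * X 0 + C b * X 1 : PolyT K).IsHomogeneous 1 :=
  (isHomogeneous_C_mul_X a 0).add (isHomogeneous_C_mul_X b 1)

theorem isHomogeneous_quadratic (a b c : K) :
    (C a * X 0 ^ 2 + C b * X 1 ^ 2 + C c * (X 0 * X 1) : PolyT K).IsHomogeneous 2 :=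
  ((isHomogeneous_C_mul_X_pow a 0 2).add (isHomogeneous_C_mul_X_pow b 1 2)).add
    (((isHomogeneous_X K 0).mul (isHomogeneous_X K 1)).C_mul c)

theorem eq_zero_of_linear_eq_zero {a b : K} (h : (C a * X 0 + C b * X 1 : PolyT K) = 0) :
    a = 0 ∧ b = 0 := by
  have h1 := congrArg (eval ![1, 0]) h
  have h2 := congrArg (eval ![0, 1]) h
  simp at h1 h2
  exact ⟨h1, h2⟩

theorem not_isUnit_of_isHomogeneous {σ : Type*} {f : MvPolynomial σ K} {n : ℕ} (hn : n ≠ 0)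
    (hf : f.IsHomogeneous n) : ¬ IsUnit f := by
  intro h
  have h0 := hf.totalDegree h.ne_zero
  rw [MvPolynomial.isUnit_iff_totalDegree_of_isReduced] at h
  omega

theorem ne_zero_of_isRelPrime {f g : PolyT K} {n : ℕ} (hn : n ≠ 0) (hf : f.IsHomogeneous n)
    (h : IsRelPrime f g) : g ≠ 0 := by
  rintro rfl
  exact not_isUnit_of_isHomogeneous hn hf (h dvd_rfl (dvd_zero f))

/-- Coprimality makes `p₁` divide `x`, whose degree is too small. -/
theorem eq_zero_of_mul_add_mul_eq_zero {p₀ p₁ x y : PolyT K} {n d : ℕ} (hd : d ≠ 0)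
    (h₀ : p₀.IsHomogeneous d) (h₁ : p₁.IsHomogeneous d) (h : IsRelPrime p₀ p₁)
    (hx : x.IsHomogeneous n) (hn : n < d) (he : p₀ * x + p₁ * y = 0) : x = 0 ∧ y = 0 := by
  have hp₁ := ne_zero_of_isRelPrime hd h₀ h
  have hx0 : x = 0 := by
    refine eq_zero_of_dvd_of_isHomogeneous_of_lt h₁ hx (h.symm.dvd_of_dvd_mul_left ?_) hn
    exact ⟨-y, by linear_combination he⟩
  subst hx0
  refine ⟨rfl, ?_⟩
  simpa [hp₁] using he

/-- The forms of degree at least `3` lie in the ideal of two coprime quadrics. -/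
theorem exists_eq_quadrics_mul_add {p₀ p₁ : PolyT K} (h₀ : p₀.IsHomogeneous 2)
    (h₁ : p₁.IsHomogeneous 2) (h : IsRelPrime p₀ p₁) {n : ℕ} (hn : n ≠ 0) {f : PolyT K}
    (hf : f.IsHomogeneous (n + 2)) :
    ∃ f₀ f₁ : PolyT K, f₀.IsHomogeneous n ∧ f₁.IsHomogeneous n ∧ f = p₀ * f₀ + p₁ * f₁ := by
  obtain ⟨n, rfl⟩ := Nat.exists_eq_succ_of_ne_zero hn
  clear hn
  induction n generalizing f with
  | zero =>
    -- Cubics: `(x, y) ↦ p₀ x + p₁ y` on pairs of linear forms is injective between spaces of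
    -- dimension `4`, hence onto.
    let φ : (homogeneousSubmodule (Fin 2) K 1 × homogeneousSubmodule (Fin 2) K 1) →ₗ[K]
        homogeneousSubmodule (Fin 2) K 3 :=
      { toFun := fun x => ⟨p₀ * x.1.1 + p₁ * x.2.1,
          (h₀.mul x.1.2).add (h₁.mul x.2.2)⟩
        map_add' := fun x y => by ext1; simp; ring
        map_smul' := fun c x => by ext1; simp [smul_add] }
    have hinj : Function.Injective φ := by
      rw [← LinearMap.ker_eq_bot, LinearMap.ker_eq_bot']
      rintro ⟨x, y⟩ hxy
      have := eq_zero_of_mul_add_mul_eq_zero two_ne_zero h₀ h₁ h x.2 (by norm_num)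
        (congrArg Subtype.val hxy)
      exact Prod.ext (Subtype.ext this.1) (Subtype.ext this.2)
    have hsurj : Function.Surjective φ := by
      rw [← LinearMap.injective_iff_surjective_of_finrank_eq_finrank]
      · exact hinj
      · simp [finrank_homogeneousSubmodule_fin_two]
    obtain ⟨⟨x, y⟩, hxy⟩ := hsurj ⟨f, hf⟩
    exact ⟨x, y, x.2, y.2, (congrArg Subtype.val hxy).symm⟩
  | succ n ih =>
    obtain ⟨g₀, g₁, hg₀, hg₁, rfl⟩ := exists_eq_X_mul_add (n := n + 1 + 2) hf
    obtain ⟨x₀, y₀, hx₀, hy₀, rfl⟩ := ih hg₀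
    obtain ⟨x₁, y₁, hx₁, hy₁, rfl⟩ := ih hg₁
    have hX := fun (i : Fin 2) (q : PolyT K) (hq : q.IsHomogeneous (n + 1)) =>
      show (X i * q).IsHomogeneous (n + 1 + 1) by
        rw [add_comm (n + 1) 1]; exact (isHomogeneous_X K i).mul hq
    exact ⟨X 0 * x₀ + X 1 * x₁, X 0 * y₀ + X 1 * y₁, (hX 0 _ hx₀).add (hX 1 _ hx₁),
      (hX 0 _ hy₀).add (hX 1 _ hy₁), by ring⟩

/-- The linear forms `(b₀ p₀ - a₀ p₁) / T₁` and `(b₁ p₀ - a₁ p₁) / T₀` attached to coprime quadrics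
`p₀`, `p₁`, with `a₀`, `b₀` their coefficients of `T₀²` and `a₁`, `b₁` those of `T₁²`, are linearly
independent. -/
theorem linear_forms_independent {p₀ p₁ l₀ l₁ : PolyT K} {a₀ a₁ a₂ b₀ b₁ b₂ : K}
    (h₀ : p₀ = C a₀ * X 0 ^ 2 + C a₁ * X 1 ^ 2 + C a₂ * (X 0 * X 1))
    (h₁ : p₁ = C b₀ * X 0 ^ 2 + C b₁ * X 1 ^ 2 + C b₂ * (X 0 * X 1)) (h : IsRelPrime p₀ p₁)
    (hl₀ : X 1 * l₀ = C b₀ * p₀ - C a₀ * p₁) (hl₁ : X 0 * l₁ = C b₁ * p₀ - C a₁ * p₁) (x y : K)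
    (hxy : C x * l₀ + C y * l₁ = 0) : x = 0 ∧ y = 0 := by
  have hp₀ : p₀.IsHomogeneous 2 := h₀ ▸ isHomogeneous_quadratic _ _ _
  have hp₁ : p₁.IsHomogeneous 2 := h₁ ▸ isHomogeneous_quadratic _ _ _
  have hX : ¬ IsUnit (X 0 : PolyT K) := not_isUnit_of_isHomogeneous one_ne_zero (isHomogeneous_X K 0)
  have hX' : ¬ IsUnit (X 1 : PolyT K) := not_isUnit_of_isHomogeneous one_ne_zero (isHomogeneous_X K 1)
  -- Multiplied by `T₀ T₁`, the relation becomes a syzygy of `p₀, p₁` with linear coefficients, so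
  -- these vanish. If `x ≠ 0`, then `a₀ = b₀ = 0` and `T₁` divides both quadrics; if `y ≠ 0`, then
  -- `T₀` does.
  have key := eq_zero_of_mul_add_mul_eq_zero two_ne_zero hp₀ hp₁ h
    (isHomogeneous_linear (x * b₀) (y * b₁)) (by norm_num)
    (y := -(C (x * a₀) * X 0 + C (y * a₁) * X 1)) (by
      simp only [C_mul]
      linear_combination X 0 * X 1 * hxy - C x * X 0 * hl₀ - C y * X 1 * hl₁)
  obtain ⟨hb₀, hb₁⟩ := eq_zero_of_linear_eq_zero key.1
  obtain ⟨ha₀, ha₁⟩ := eq_zero_of_linear_eq_zero (neg_eq_zero.1 key.2)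
  constructor
  · by_contra hx
    simp only [mul_eq_zero, hx, false_or] at hb₀ ha₀
    subst hb₀ ha₀
    exact hX' (h ⟨C a₁ * X 1 + C a₂ * X 0, by rw [h₀, C_0]; ring⟩
      ⟨C b₁ * X 1 + C b₂ * X 0, by rw [h₁, C_0]; ring⟩)
  · by_contra hy
    simp only [mul_eq_zero, hy, false_or] at hb₁ ha₁
    subst hb₁ ha₁
    exact hX (h ⟨C a₀ * X 0 + C a₂ * X 1, by rw [h₀, C_0]; ring⟩
      ⟨C b₀ * X 0 + C b₂ * X 1, by rw [h₁, C_0]; ring⟩)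

theorem X_mem_span_of_independent {l₀ l₁ : PolyT K} (h₀ : l₀.IsHomogeneous 1)
    (h₁ : l₁.IsHomogeneous 1) (h : ∀ x y : K, C x * l₀ + C y * l₁ = 0 → x = 0 ∧ y = 0) (i : Fin 2) :
    ∃ x y : K, X i = C x * l₀ + C y * l₁ := by
  obtain ⟨a, b, rfl⟩ := exists_eq_linear h₀
  obtain ⟨c, d, rfl⟩ := exists_eq_linear h₁
  -- With zero determinant, the pairs `(d, -b)` and `(-c, a)` would be relations, so all entries
  -- would vanish. Cramer's rule gives the rest.
  have hdet : a * d - b * c ≠ 0 := by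
    intro h0
    have e0 := (C_eq_zero (σ := Fin 2)).2 h0
    simp only [C_sub, C_mul] at e0
    obtain ⟨hd, hb⟩ := h d (-b) (by rw [C_neg]; linear_combination X 0 * e0)
    obtain ⟨hc, ha⟩ := h (-c) a (by rw [C_neg]; linear_combination X 1 * e0)
    rw [neg_eq_zero] at hb hc
    subst hd hb hc ha
    simpa using (h 1 0 (by simp)).1
  have hC : C (a * d - b * c)⁻¹ * (C a * C d - C b * C c) = (1 : PolyT K) := by
    rw [← C_mul, ← C_mul, ← C_sub, ← C_mul, inv_mul_cancel₀ hdet, C_1]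
  fin_cases i
  · refine ⟨(a * d - b * c)⁻¹ * d, (a * d - b * c)⁻¹ * (-b), ?_⟩
    simp only [C_mul, C_neg, Fin.zero_eta]
    linear_combination -X 0 * hC
  · refine ⟨(a * d - b * c)⁻¹ * (-c), (a * d - b * c)⁻¹ * a, ?_⟩
    simp only [C_mul, C_neg, Fin.mk_one]
    linear_combination -X 1 * hC

end Quadrics

/-! ### Independence of monomials over the algebra generated by two coprime forms. -/

section Independence

variable {K : Type*} [Field K]

theorem eq_zero_of_sum_monomials_eq_zero {r : ℕ} {γ : Fin r → K}
    (h : ∑ a : Fin r, C (γ a) * (X 0 ^ (a : ℕ) * X 1 ^ (r - 1 - a) : PolyT K) = 0) (a : Fin r) :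
    γ a = 0 := by
  have h1 := congrArg (eval₂Hom (Polynomial.C : K →+* _) ![Polynomial.X, 1]) h
  have h2 := congrArg (fun f => Polynomial.coeff f a) h1
  simp only [map_sum, map_mul, map_pow, coe_eval₂Hom, eval₂_C, eval₂_X, map_zero,
    Matrix.cons_val_zero, Matrix.cons_val_one, one_pow, mul_one, Polynomial.finsetSum_coeff,
    Polynomial.coeff_C_mul_X_pow, Polynomial.coeff_zero, Fin.val_inj, Finset.sum_ite_eq,
    Finset.mem_univ, if_true] at h2
  exact h2

/-- For `n = 0` the subtraction `n - 1` truncates, so the vanishing of `c'` is stated separately; it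
ends the induction of the next result. -/
theorem exists_eq_C_mul_X_pow_add {c : PolyT K} {n : ℕ} (hc : c.IsHomogeneous n) :
    ∃ (γ : K) (c' : PolyT K), c'.IsHomogeneous (n - 1) ∧ (n = 0 → c' = 0) ∧
      c = C γ * X 0 ^ n + X 1 * c' := by
  induction n generalizing c with
  | zero =>
    obtain ⟨γ, rfl⟩ := exists_eq_C_of_isHomogeneous_zero hc
    exact ⟨γ, 0, isHomogeneous_zero _ _ _, fun _ => rfl, by simp⟩
  | succ n ih =>
    obtain ⟨c₀, c₁, h₀, h₁, rfl⟩ := exists_eq_X_mul_add hc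
    obtain ⟨γ, c', h', hz, rfl⟩ := ih h₀
    refine ⟨γ, X 0 * c' + c₁, ?_, by simp, by ring⟩
    refine IsHomogeneous.add ?_ h₁
    rcases n with _ | n
    · simpa [hz rfl] using isHomogeneous_zero (Fin 2) K 0
    · rw [show n + 1 + 1 - 1 = 1 + (n + 1 - 1) by omega]
      exact (isHomogeneous_X K 0).mul h'

/-- The monomials of degree `r - 1` are linearly independent over `𝕂[q₀, q₁]`, for coprime forms
`q₀`, `q₁` of degree `r`. -/
theorem eq_zero_of_sum_aeval_mul_monomials_eq_zero {q₀ q₁ : PolyT K} {r : ℕ} (hr : r ≠ 0)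
    (h₀ : q₀.IsHomogeneous r) (h₁ : q₁.IsHomogeneous r) (h : IsRelPrime q₀ q₁) {n : ℕ}
    {c : Fin r → PolyT K} (hc : ∀ a, (c a).IsHomogeneous n)
    (hs : ∑ a : Fin r, aeval ![q₀, q₁] (c a) * (X 0 ^ (a : ℕ) * X 1 ^ (r - 1 - a)) = 0)
    (a : Fin r) : c a = 0 := by
  have hq₁ := ne_zero_of_isRelPrime hr h₀ h
  induction n using Nat.strong_induction_on generalizing c a with
  | _ n ih =>
    choose γ c' hc' hz hcc using fun a => exists_eq_C_mul_X_pow_add (hc a)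
    -- Separate the pure powers of `q₀` from the part divisible by `q₁`. The first sum has degree `r
    -- - 1 < r` and is divisible by `q₁`, hence zero; then cancel `q₁` and descend.
    have hs' : q₀ ^ n * ∑ a : Fin r, C (γ a) * (X 0 ^ (a : ℕ) * X 1 ^ (r - 1 - a)) +
        q₁ * ∑ a : Fin r, aeval ![q₀, q₁] (c' a) * (X 0 ^ (a : ℕ) * X 1 ^ (r - 1 - a)) = 0 := by
      rw [← hs, Finset.mul_sum, Finset.mul_sum, ← Finset.sum_add_distrib]
      refine Finset.sum_congr rfl fun a _ => ?_
      rw [hcc a]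
      simp
      ring
    have hhom : (∑ a : Fin r, C (γ a) * (X 0 ^ (a : ℕ) * X 1 ^ (r - 1 - a) : PolyT K)).IsHomogeneous
        (r - 1) := by
      refine IsHomogeneous.sum _ _ _ fun a _ => IsHomogeneous.C_mul ?_ _
      have := (isHomogeneous_X_pow (R := K) (0 : Fin 2) (a : ℕ)).mul
        (isHomogeneous_X_pow (R := K) (1 : Fin 2) (r - 1 - a))
      rwa [show (a : ℕ) + (r - 1 - a) = r - 1 by omega] at this
    have hzero := eq_zero_of_dvd_of_isHomogeneous_of_lt h₁ hhom
      ((IsRelPrime.pow_right (n := n) h.symm).dvd_of_dvd_mul_left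
        ⟨-_, by rw [mul_neg]; exact eq_neg_of_add_eq_zero_left hs'⟩) (by omega)
    have hγ := eq_zero_of_sum_monomials_eq_zero hzero
    rw [hzero, mul_zero, zero_add, mul_eq_zero, or_iff_right hq₁] at hs'
    have hc'0 : c' a = 0 := by
      rcases n with _ | n
      · exact hz a rfl
      · exact ih n (by omega) hc' hs' a
    rw [hcc a, hγ a, hc'0]
    simp

end Independence

variable {K : Type*} [Field K]

/-! ### Bihomogeneous elements. -/

namespace IsBihomogeneous

variable {G H : PolyTX K} {i j i' j' : ℕ}

theorem zero (i j : ℕ) : IsBihomogeneous (0 : PolyTX K) i j :=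
  ⟨isHomogeneous_zero _ _ _, fun m => by rw [coeff_zero]; exact isHomogeneous_zero _ _ _⟩

theorem add (hG : IsBihomogeneous G i j) (hH : IsBihomogeneous H i j) :
    IsBihomogeneous (G + H) i j :=
  ⟨hG.1.add hH.1, fun m => by rw [coeff_add]; exact (hG.2 m).add (hH.2 m)⟩

theorem sub (hG : IsBihomogeneous G i j) (hH : IsBihomogeneous H i j) :
    IsBihomogeneous (G - H) i j :=
  ⟨hG.1.sub hH.1, fun m => by rw [coeff_sub]; exact (hG.2 m).sub (hH.2 m)⟩

theorem mul (hG : IsBihomogeneous G i j) (hH : IsBihomogeneous H i' j') :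
    IsBihomogeneous (G * H) (i + i') (j + j') := by
  classical
  refine ⟨hG.1.mul hH.1, fun m => ?_⟩
  rw [coeff_mul]
  exact IsHomogeneous.sum _ _ _ fun x _ => (hG.2 _).mul (hH.2 _)

theorem sum {ι : Type*} {s : Finset ι} {f : ι → PolyTX K} (h : ∀ a ∈ s, IsBihomogeneous (f a) i j) :
    IsBihomogeneous (∑ a ∈ s, f a) i j :=
  Finset.sum_induction f (fun G => IsBihomogeneous G i j) (fun _ _ => add) (zero i j) h

theorem C {c : PolyT K} (hc : c.IsHomogeneous i) : IsBihomogeneous (C c : PolyTX K) i 0 := by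
  classical
  refine ⟨isHomogeneous_C _ _, fun m => ?_⟩
  rw [coeff_C]
  split_ifs
  exacts [hc, isHomogeneous_zero _ _ _]

theorem ofX {f : PolyX K} (hf : f.IsHomogeneous j) : IsBihomogeneous (ofX f) 0 j :=
  ⟨hf.map _, fun m => by rw [ReesCurve.ofX, coeff_map]; exact isHomogeneous_C _ _⟩

theorem linForm {s : Fin 3 → PolyT K} (hs : ∀ l, (s l).IsHomogeneous i) :
    IsBihomogeneous (linForm s) i 1 := by
  refine sum fun l _ => ?_
  have hX : IsBihomogeneous (X l : PolyTX K) 0 1 := by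
    have := ofX (isHomogeneous_X K l)
    rwa [ReesCurve.ofX, map_X] at this
  simpa using (C (hs l)).mul hX

theorem pow (hG : IsBihomogeneous G 0 1) (n : ℕ) : IsBihomogeneous (G ^ n) 0 n := by
  induction n with
  | zero => simpa using C (isHomogeneous_one (Fin 2) K)
  | succ n ih => rw [pow_succ]; exact ih.mul hG

theorem of_C_mul {c : PolyT K} {e : ℕ} (hc : c.IsHomogeneous e) (hc0 : c ≠ 0)
    (h : IsBihomogeneous (MvPolynomial.C c * G) (e + i) j) : IsBihomogeneous G i j := by
  constructor
  · intro m hm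
    exact h.1 (by rw [coeff_C_mul]; exact mul_ne_zero hc0 hm)
  · intro m
    by_cases hm : coeff m G = 0
    · rw [hm]; exact isHomogeneous_zero _ _ _
    · have := h.2 m
      rw [coeff_C_mul] at this
      obtain ⟨l, hl, h'⟩ := isHomogeneous_of_mul_left hc hc0 this hm
      rwa [show i = l by omega]

end IsBihomogeneous

/-- The linear form with constant coefficients `a`, in `𝕂[T][X]`. -/
noncomputable abbrev constForm (a : Fin 3 → K) : PolyTX K := linForm fun i => C (a i)

theorem isBihomogeneous_constForm (a : Fin 3 → K) : IsBihomogeneous (constForm a) 0 1 :=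
  .linForm fun _ => isHomogeneous_C _ _

/-- A linear form `c` completing `a`, `b` to a coordinate system, with the inverse matrix. -/
structure Coordinates (a b : Fin 3 → K) where
  c : Fin 3 → K
  N : Matrix (Fin 3) (Fin 3) K
  mul_inv : Matrix.of ![a, b, c] * N = 1
  inv_mul : N * Matrix.of ![a, b, c] = 1

theorem exists_coordinates {a b : Fin 3 → K} (hab : LinearIndependent K ![a, b]) :
    Nonempty (Coordinates a b) := by
  obtain ⟨c, hc⟩ := exists_linearIndependent_snoc_of_lt_finrank hab (by simp)
  have he : (Fin.snoc ![a, b] c : Fin 3 → Fin 3 → K) = ![a, b, c] := by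
    funext i; fin_cases i <;> rfl
  rw [he] at hc
  have hu : IsUnit (Matrix.of ![a, b, c]) := Matrix.linearIndependent_rows_iff_isUnit.1 hc
  rw [Matrix.isUnit_iff_isUnit_det] at hu
  exact ⟨⟨c, (Matrix.of ![a, b, c])⁻¹, Matrix.mul_nonsing_inv _ hu, Matrix.nonsing_inv_mul _ hu⟩⟩

/-! ### Adapted coordinates and the substitution `psi`. -/

namespace Coordinates

variable {a b : Fin 3 → K} (x : Coordinates a b)

theorem sum_mul_N (i j : Fin 3) : ∑ l, (![a, b, x.c] i l) * x.N l j = if i = j then 1 else 0 := by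
  have := congrFun (congrFun x.mul_inv i) j
  rwa [Matrix.mul_apply, Matrix.one_apply] at this

theorem sum_N_mul (i j : Fin 3) : ∑ l, x.N i l * (![a, b, x.c] l j) = if i = j then 1 else 0 := by
  have := congrFun (congrFun x.inv_mul i) j
  rwa [Matrix.mul_apply, Matrix.one_apply] at this

/-- The point whose coordinates with respect to `a`, `b`, `c` are `v`. -/
noncomputable def point {S : Type*} [CommRing S] [Algebra K S] (v : Fin 3 → S) (i : Fin 3) : S :=
  ∑ j, algebraMap K S (x.N i j) * v j

theorem sum_point {S : Type*} [CommRing S] [Algebra K S] (v : Fin 3 → S) (r : Fin 3) :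
    ∑ i, algebraMap K S (![a, b, x.c] r i) * x.point v i = v r := by
  simp only [point, Finset.mul_sum]
  rw [Finset.sum_comm]
  simp only [← mul_assoc, ← map_mul, ← Finset.sum_mul, ← map_sum, x.sum_mul_N]
  simp

theorem point_sum {S : Type*} [CommRing S] [Algebra K S] (v : Fin 3 → S) (i : Fin 3) :
    x.point (fun r => ∑ l, algebraMap K S (![a, b, x.c] r l) * v l) i = v i := by
  simp only [point, Finset.mul_sum]
  rw [Finset.sum_comm]
  simp only [← mul_assoc, ← map_mul, ← Finset.sum_mul, ← map_sum, x.sum_N_mul]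
  simp

theorem point_mul {S : Type*} [CommRing S] [Algebra K S] (v : Fin 3 → S) (s : S) (i : Fin 3) :
    x.point (fun r => s * v r) i = s * x.point v i := by
  simp only [point, Finset.mul_sum]
  exact Finset.sum_congr rfl fun _ _ => by ring

theorem map_point {S S' : Type*} [CommRing S] [Algebra K S] [CommRing S'] [Algebra K S']
    (f : S →ₐ[K] S') (v : Fin 3 → S) (i : Fin 3) : f (x.point v i) = x.point (fun r => f (v r)) i := by
  simp [point, map_sum, map_mul]

/-- Substitution of the point with coordinates `p₀ Z`, `p₁ Z`, `1`. -/
noncomputable def psi (p₀ p₁ : PolyT K) : PolyTX K →ₐ[PolyT K] Polynomial (PolyT K) :=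
  aeval (x.point ![Polynomial.C p₀ * Polynomial.X, Polynomial.C p₁ * Polynomial.X, 1])

theorem psi_constForm (p₀ p₁ : PolyT K) (r : Fin 3) :
    x.psi p₀ p₁ (constForm (![a, b, x.c] r)) =
      (![Polynomial.C p₀ * Polynomial.X, Polynomial.C p₁ * Polynomial.X, 1] :
        Fin 3 → Polynomial (PolyT K)) r := by
  rw [← x.sum_point ![Polynomial.C p₀ * Polynomial.X, Polynomial.C p₁ * Polynomial.X, 1] r, psi,
    constForm, linForm, map_sum]
  refine Finset.sum_congr rfl fun i _ => ?_
  rw [map_mul, aeval_X, aeval_C]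
  rfl

@[simp]
theorem psi_a (p₀ p₁ : PolyT K) :
    x.psi p₀ p₁ (constForm a) = Polynomial.C p₀ * Polynomial.X := x.psi_constForm p₀ p₁ 0

@[simp]
theorem psi_b (p₀ p₁ : PolyT K) :
    x.psi p₀ p₁ (constForm b) = Polynomial.C p₁ * Polynomial.X := x.psi_constForm p₀ p₁ 1

@[simp]
theorem psi_c (p₀ p₁ : PolyT K) : x.psi p₀ p₁ (constForm x.c) = 1 := x.psi_constForm p₀ p₁ 2

@[simp]
theorem psi_C (p₀ p₁ f : PolyT K) : x.psi p₀ p₁ (C f) = Polynomial.C f := by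
  rw [psi, aeval_C]; rfl

end Coordinates

/-- `f ∈ 𝕂[T][Z]` has degree at most `j`, and its coefficient of `Zⁿ` is a form of degree
`i + 2 n`. -/
structure IsGraded (f : Polynomial (PolyT K)) (i j : ℕ) : Prop where
  natDegree_le : f.natDegree ≤ j
  coeff : ∀ n, (f.coeff n).IsHomogeneous (i + 2 * n)

/-! ### The grading of the target of `psi`. -/

namespace IsGraded

variable {f h : Polynomial (PolyT K)} {i j i' j' : ℕ}

theorem zero (i j : ℕ) : IsGraded (0 : Polynomial (PolyT K)) i j :=
  ⟨by simp, fun n => by rw [Polynomial.coeff_zero]; exact isHomogeneous_zero _ _ _⟩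

theorem add (hf : IsGraded f i j) (hh : IsGraded h i j) : IsGraded (f + h) i j :=
  ⟨Polynomial.natDegree_add_le_of_degree_le hf.1 hh.1,
    fun n => by rw [Polynomial.coeff_add]; exact (hf.2 n).add (hh.2 n)⟩

theorem mul (hf : IsGraded f i j) (hh : IsGraded h i' j') : IsGraded (f * h) (i + i') (j + j') := by
  refine ⟨Polynomial.natDegree_mul_le_of_le hf.1 hh.1, fun n => ?_⟩
  rw [Polynomial.coeff_mul]
  refine IsHomogeneous.sum _ _ _ fun y hy => ?_
  rw [← Finset.HasAntidiagonal.mem_antidiagonal.1 hy,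
    show i + i' + 2 * (y.1 + y.2) = (i + 2 * y.1) + (i' + 2 * y.2) by ring]
  exact (hf.2 _).mul (hh.2 _)

theorem sum {ι : Type*} {s : Finset ι} {f : ι → Polynomial (PolyT K)}
    (h : ∀ a ∈ s, IsGraded (f a) i j) : IsGraded (∑ a ∈ s, f a) i j :=
  Finset.sum_induction f (fun G => IsGraded G i j) (fun _ _ => add) (zero i j) h

theorem C_mul_X_pow {c : PolyT K} {n : ℕ} (hc : c.IsHomogeneous (i + 2 * n)) :
    IsGraded (Polynomial.C c * Polynomial.X ^ n) i n := by
  refine ⟨Polynomial.natDegree_C_mul_X_pow_le _ _, fun l => ?_⟩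
  rw [Polynomial.coeff_C_mul_X_pow]
  split_ifs with hl
  · rwa [hl]
  · exact isHomogeneous_zero _ _ _

theorem mono {l : ℕ} (hf : IsGraded f i j) (h : j ≤ l) : IsGraded f i l := ⟨hf.1.trans h, hf.2⟩

theorem pow (hf : IsGraded f 0 1) (n : ℕ) : IsGraded (f ^ n) 0 n := by
  induction n with
  | zero => simpa using C_mul_X_pow (i := 0) (n := 0) (isHomogeneous_one (Fin 2) K)
  | succ n ih => rw [pow_succ]; exact ih.mul hf

end IsGraded

/-! ### The image of `psi`. -/

namespace Coordinates

variable {a b : Fin 3 → K} (x : Coordinates a b) {p₀ p₁ : PolyT K}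

theorem isGraded_psi (h₀ : p₀.IsHomogeneous 2) (h₁ : p₁.IsHomogeneous 2) {G : PolyTX K} {i j : ℕ}
    (hG : IsBihomogeneous G i j) : IsGraded (x.psi p₀ p₁ G) i j := by
  have hX : ∀ l, IsGraded
      (x.point ![Polynomial.C p₀ * Polynomial.X, Polynomial.C p₁ * Polynomial.X, 1] l) 0 1 := by
    intro l
    have hc : ∀ e : K, IsGraded (algebraMap K (Polynomial (PolyT K)) e) 0 0 := fun e => by
      have := IsGraded.C_mul_X_pow (i := 0) (n := 0) (isHomogeneous_C (Fin 2) e)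
      rwa [pow_zero, mul_one] at this
    refine IsGraded.sum fun r _ => ?_
    suffices h : IsGraded ((![Polynomial.C p₀ * Polynomial.X, Polynomial.C p₁ * Polynomial.X, 1] :
        Fin 3 → Polynomial (PolyT K)) r) 0 1 by simpa using (hc (x.N l r)).mul h
    fin_cases r
    · simpa using IsGraded.C_mul_X_pow (i := 0) (n := 1) (by simpa using h₀)
    · simpa using IsGraded.C_mul_X_pow (i := 0) (n := 1) (by simpa using h₁)
    · simpa using (IsGraded.C_mul_X_pow (i := 0) (n := 0)
        (isHomogeneous_one (Fin 2) K)).mono zero_le_one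
  rw [psi, aeval_def, eval₂_eq']
  refine IsGraded.sum fun m hm => ?_
  have hdeg := hG.1.degree_eq_sum_deg_support hm
  have hm3 : m 0 + m 1 + m 2 = j := by
    rw [hdeg, ← Finsupp.degree_apply, Finsupp.degree_eq_sum, Fin.sum_univ_three]
  have h1 : IsGraded (algebraMap (PolyT K) (Polynomial (PolyT K)) (coeff m G)) i 0 := by
    have := IsGraded.C_mul_X_pow (i := i) (n := 0) (by simpa using hG.2 m)
    rwa [pow_zero, mul_one] at this
  rw [Fin.prod_univ_three]
  have := h1.mul ((((hX 0).pow (m 0)).mul ((hX 1).pow (m 1))).mul ((hX 2).pow (m 2)))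
  rwa [hm3, zero_add, add_zero, zero_add] at this

/-- For `n ≥ 1` and `i ≥ 1`, a coefficient of degree `i + 2n ≥ 3` lies in `(p₀, p₁)`, so one factor
`Z` can be traded for `ℓ₀` or `ℓ₁`, lowering `n`. The missing `X`-degree is filled with powers of
the third coordinate, which maps to `1`. In `T`-degree `0` the step fails. -/
theorem exists_psi_eq (h₀ : p₀.IsHomogeneous 2) (h₁ : p₁.IsHomogeneous 2) (h : IsRelPrime p₀ p₁)
    {f : Polynomial (PolyT K)} {i j : ℕ} (hi : i ≠ 0) (hf : IsGraded f i j) :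
    ∃ G, IsBihomogeneous G i j ∧ x.psi p₀ p₁ G = f := by
  have key : ∀ (n : ℕ) (j : ℕ) (_ : n ≤ j) (q : PolyT K) (_ : q.IsHomogeneous (i + 2 * n)),
      ∃ G, IsBihomogeneous G i j ∧ x.psi p₀ p₁ G = Polynomial.C q * Polynomial.X ^ n := by
    intro n
    induction n with
    | zero =>
      intro j _ q hq
      refine ⟨C q * constForm x.c ^ j, ?_, by simp⟩
      simpa using (IsBihomogeneous.C hq).mul ((isBihomogeneous_constForm x.c).pow j)
    | succ n ih =>
      intro j hj q hq
      obtain ⟨q₀, q₁, hq₀, hq₁, rfl⟩ := exists_eq_quadrics_mul_add h₀ h₁ h (n := i + 2 * n)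
        (by omega) (by convert hq using 1; ring)
      obtain ⟨j, rfl⟩ : ∃ l, j = 1 + l := ⟨j - 1, by omega⟩
      obtain ⟨G₀, hG₀, e₀⟩ := ih j (by omega) q₀ hq₀
      obtain ⟨G₁, hG₁, e₁⟩ := ih j (by omega) q₁ hq₁
      refine ⟨constForm a * G₀ + constForm b * G₁, ?_, ?_⟩
      · simpa using ((isBihomogeneous_constForm a).mul hG₀).add
          ((isBihomogeneous_constForm b).mul hG₁)
      · rw [map_add, map_mul, map_mul, psi_a, psi_b, e₀, e₁, Polynomial.C_add, Polynomial.C_mul,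
          Polynomial.C_mul]
        ring
  have hcoeff : ∀ n ∈ Finset.range (j + 1), ∃ G, IsBihomogeneous G i j ∧
      x.psi p₀ p₁ G = Polynomial.C (f.coeff n) * Polynomial.X ^ n := fun n hn =>
    key n j (by simpa [Nat.lt_succ_iff] using hn) _ (hf.coeff n)
  choose! G hG he using hcoeff
  refine ⟨∑ n ∈ Finset.range (j + 1), G n, IsBihomogeneous.sum hG, ?_⟩
  rw [map_sum, Finset.sum_congr rfl he]
  conv_rhs => rw [f.as_sum_range' (j + 1) (Nat.lt_succ_of_le hf.natDegree_le)]
  simp [Polynomial.C_mul_X_pow_eq_monomial]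

end Coordinates

/-! ### The kernel of `psi` on forms. -/

namespace Coordinates

variable {a b : Fin 3 → K} (x : Coordinates a b) {p₀ p₁ : PolyT K}

theorem psi_relation (p₀ p₁ : PolyT K) :
    x.psi p₀ p₁ (C p₁ * constForm a - C p₀ * constForm b) = 0 := by
  simp only [map_sub, map_mul, psi_C, psi_a, psi_b]
  ring

/-- Expression of a polynomial in the coordinates `a`, `b`, `c`. -/
noncomputable def change : PolyTX K →ₐ[PolyT K] PolyTX K := aeval (x.point X)

theorem isHomogeneous_point (i : Fin 3) : (x.point (X : Fin 3 → PolyTX K) i).IsHomogeneous 1 :=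
  IsHomogeneous.sum _ _ _ fun j _ => (isHomogeneous_X _ j).C_mul _

theorem aeval_constForm_change (G : PolyTX K) :
    aeval (fun r => constForm (![a, b, x.c] r)) (x.change G) = G := by
  rw [change, ← AlgHom.comp_apply]
  suffices h : (aeval (fun r => constForm (![a, b, x.c] r))).comp (aeval (x.point X)) =
      AlgHom.id (PolyT K) (PolyTX K) by rw [h]; rfl
  ext1 i
  rw [AlgHom.comp_apply, aeval_X, AlgHom.id_apply, ← AlgHom.coe_restrictScalars' K, map_point]
  simp only [AlgHom.coe_restrictScalars', aeval_X]
  exact x.point_sum X i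

theorem aeval_change (p₀ p₁ : PolyT K) (G : PolyTX K) :
    aeval ![Polynomial.C p₀ * Polynomial.X, Polynomial.C p₁ * Polynomial.X, 1] (x.change G) =
      x.psi p₀ p₁ G := by
  rw [change, psi, ← AlgHom.comp_apply]
  congr 1
  ext1 i
  rw [AlgHom.comp_apply, aeval_X, aeval_X, ← AlgHom.coe_restrictScalars' K, map_point]
  simp only [AlgHom.coe_restrictScalars', aeval_X]

end Coordinates

theorem isRelPrime_C_mul_X_C {p₀ p₁ : PolyT K} (h : IsRelPrime p₀ p₁) (hp₁ : p₁ ≠ 0) :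
    IsRelPrime (C p₀ * X 0 : MvPolynomial (Fin 2) (PolyT K)) (C p₁) := by
  intro d hd₀ hd₁
  obtain ⟨e, he, rfl⟩ := (dvd_C_iff_exists hp₁).1 hd₁
  rw [C_dvd_iff_dvd_coeff] at hd₀ hd₁
  have h0 := hd₀ (Finsupp.single 0 1)
  have h1 := hd₁ 0
  rw [coeff_C_mul, coeff_X, if_pos rfl, mul_one] at h0
  rw [coeff_zero_C] at h1
  exact (h h0 h1).map C

theorem aeval_finSuccEquiv {R F : Type*} [CommRing R] [CommRing F] [Algebra R F]
    [Algebra (MvPolynomial (Fin 2) R) F] [IsScalarTower R (MvPolynomial (Fin 2) R) F] (t : F)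
    (G : MvPolynomial (Fin 3) R) :
    Polynomial.aeval t (finSuccEquiv R 2 G) =
      aeval (![t, algebraMap (MvPolynomial (Fin 2) R) F (X 0),
        algebraMap (MvPolynomial (Fin 2) R) F (X 1)] : Fin 3 → F) G := by
  have : ((Polynomial.aeval t).restrictScalars R).comp
      (finSuccEquiv R 2 : MvPolynomial (Fin 3) R →ₐ[R] Polynomial (MvPolynomial (Fin 2) R)) =
      aeval (![t, algebraMap (MvPolynomial (Fin 2) R) F (X 0),
        algebraMap (MvPolynomial (Fin 2) R) F (X 1)] : Fin 3 → F) := by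
    ext1 i
    rw [aeval_X]
    change Polynomial.aeval t (finSuccEquiv R 2 (X i)) = _
    refine Fin.cases ?_ (fun i => ?_) i
    · rw [finSuccEquiv_X_zero, Polynomial.aeval_X]
      rfl
    · rw [finSuccEquiv_X_succ, Polynomial.aeval_C]
      fin_cases i <;> rfl
  exact DFunLike.congr_fun this G

theorem div_eq_mul_mul_div {F : Type*} [Field F] {p q x y : F} (hy : y ≠ 0) :
    p * x / q = y * (p * (x / (q * y))) := by
  rcases eq_or_ne q 0 with rfl | hq
  · simp
  · field_simp

theorem eq_mul_mul_div {F : Type*} [Field F] {q x y : F} (hq : q ≠ 0) (hy : y ≠ 0) :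
    x = y * (q * (x / (q * y))) := by
  field_simp

/-- As a polynomial in the first variable, `G` has the root `p₀ X₁ / p₁`, a reduced fraction by
`isRelPrime_C_mul_X_C`, so Gauss's lemma applies. -/
theorem dvd_of_aeval_eq_zero {p₀ p₁ : PolyT K} (h : IsRelPrime p₀ p₁) (hp₁ : p₁ ≠ 0) {G : PolyTX K}
    {j : ℕ} (hG : G.IsHomogeneous j)
    (h0 : aeval (![Polynomial.C p₀ * Polynomial.X, Polynomial.C p₁ * Polynomial.X, 1] :
      Fin 3 → Polynomial (PolyT K)) G = 0) :
    C p₁ * X 0 - C p₀ * X 1 ∣ G := by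
  let R' := MvPolynomial (Fin 2) (PolyT K)
  let F := FractionRing R'
  let ι := algebraMap R' F
  have hι : Function.Injective ι := IsFractionRing.injective R' F
  have hw : (C p₁ : R') ≠ 0 := by simpa using hp₁
  have hw' : ι (C p₁) ≠ 0 := by simpa using hι.ne hw
  have hX' : ι (X 0) ≠ 0 := by simpa using hι.ne (X_ne_zero (0 : Fin 2))
  have hroot : Polynomial.aeval (ι (C p₀ * X 0) / ι (C p₁)) (finSuccEquiv (PolyT K) 2 G) = 0 := by
    let t := ι (C p₀ * X 0) / ι (C p₁)
    -- Chosen so that `(p₀ X₁ / p₁, X₁, X₂) = X₂ · (p₀ z, p₁ z, 1)`. After `finSuccEquiv` the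
    -- variables `X₁, X₂` are indexed `0, 1`.
    let z : F := ι (X 0) / (ι (C p₁) * ι (X 1))
    have hX1 : ι (X 1) ≠ 0 := by simpa using hι.ne (X_ne_zero (1 : Fin 2))
    have e1 := aeval_finSuccEquiv t G
    have e2 : (![t, ι (X 0), ι (X 1)] : Fin 3 → F) = fun i => ι (X 1) *
        Polynomial.aeval z ((![Polynomial.C p₀ * Polynomial.X, Polynomial.C p₁ * Polynomial.X, 1] :
          Fin 3 → Polynomial (PolyT K)) i) := by
      have hC : ∀ q : PolyT K, algebraMap (PolyT K) F q = ι (C q) := fun q => rfl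
      funext i
      fin_cases i
      · simpa [hC, t, z] using div_eq_mul_mul_div hX1
      · simpa [hC, z] using eq_mul_mul_div hw' hX1
      · simp
    change Polynomial.aeval t _ = 0
    rw [e1, e2, aeval_smul_of_isHomogeneous hG]
    have e3 : aeval (fun i => Polynomial.aeval z ((![Polynomial.C p₀ * Polynomial.X,
        Polynomial.C p₁ * Polynomial.X, 1] : Fin 3 → Polynomial (PolyT K)) i)) G =
        Polynomial.aeval z (aeval (![Polynomial.C p₀ * Polynomial.X,
          Polynomial.C p₁ * Polynomial.X, 1] : Fin 3 → Polynomial (PolyT K)) G) := by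
      rw [← AlgHom.comp_apply, comp_aeval]
    rw [e3, h0, map_zero, mul_zero]
  have hdvd := linear_dvd_of_aeval_div_eq_zero F (isRelPrime_C_mul_X_C h hp₁) hw hroot
  have he : finSuccEquiv (PolyT K) 2 (C p₁ * X 0 - C p₀ * X 1) =
      Polynomial.C (C p₁) * Polynomial.X - Polynomial.C (C p₀ * X 0) := by
    rw [map_sub, map_mul, map_mul, finSuccEquiv_X_zero, show (1 : Fin 3) = Fin.succ 0 from rfl,
      finSuccEquiv_X_succ]
    simp [finSuccEquiv_apply]
  rw [← he] at hdvd
  exact (map_dvd_iff (finSuccEquiv (PolyT K) 2)).1 hdvd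

theorem Coordinates.dvd_of_psi_eq_zero {a b : Fin 3 → K} (x : Coordinates a b) {p₀ p₁ : PolyT K}
    (h : IsRelPrime p₀ p₁) (hp₁ : p₁ ≠ 0) {G : PolyTX K} {j : ℕ} (hG : G.IsHomogeneous j)
    (h0 : x.psi p₀ p₁ G = 0) : C p₁ * constForm a - C p₀ * constForm b ∣ G := by
  rw [← x.aeval_change] at h0
  have hG' : (x.change G).IsHomogeneous j := by
    have := hG.aeval _ x.isHomogeneous_point
    rwa [one_mul] at this
  have := map_dvd (aeval (fun r => constForm (![a, b, x.c] r))) (dvd_of_aeval_eq_zero h hp₁ hG' h0)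
  rw [x.aeval_constForm_change] at this
  simpa using this

/-! ### Vanishing at `u` as divisibility by `w Z - g`. -/

section Evaluation

variable {a b : Fin 3 → K} (x : Coordinates a b) {p₀ p₁ g w : PolyT K} {u : Fin 3 → PolyT K}

/-- In adapted coordinates `u = w · (p₀ g/w, p₁ g/w, 1)`, so evaluating at `u` is setting `Z = g/w`
after `psi`, up to a power of `w`. -/
theorem Coordinates.pow_mul_aeval_psi (F : Type*) [Field F] [Algebra (PolyT K) F] [FaithfulSMul (PolyT K) F]
    (hw : w ≠ 0) (hu : ∀ i, u i = x.point ![g * p₀, g * p₁, w] i) {G : PolyTX K} {j : ℕ}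
    (hG : G.IsHomogeneous j) :
    algebraMap (PolyT K) F w ^ j *
        Polynomial.aeval (algebraMap (PolyT K) F g / algebraMap (PolyT K) F w) (x.psi p₀ p₁ G) =
      algebraMap (PolyT K) F (aeval u G) := by
  have hw' : algebraMap (PolyT K) F w ≠ 0 := by
    simpa using (FaithfulSMul.algebraMap_injective (PolyT K) F).ne hw
  rw [psi, ← AlgHom.comp_apply, comp_aeval, ← aeval_smul_of_isHomogeneous hG]
  have : (algebraMap (PolyT K) F) (aeval u G) = aeval (fun i => algebraMap (PolyT K) F (u i)) G := by
    rw [← aeval_algebraMap_apply]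
    rfl
  rw [this]
  congr 2
  funext i
  rw [hu]
  simp only [point, Fin.sum_univ_three, map_add, map_mul]
  have hC : ∀ e : K, Polynomial.aeval (algebraMap (PolyT K) F g / algebraMap (PolyT K) F w)
      (algebraMap K (Polynomial (PolyT K)) e) = algebraMap (PolyT K) F (C e) := fun e => by
    rw [show algebraMap K (Polynomial (PolyT K)) e = Polynomial.C (C e) from rfl,
      Polynomial.aeval_C]
  simp only [hC, MvPolynomial.algebraMap_eq]
  simp
  field_simp

/-- With the converse below, membership of a form in the defining ideal becomes divisibility by one
linear polynomial. -/
theorem Coordinates.dvd_psi_of_aeval_eq_zero (hw : w ≠ 0) (hgw : IsRelPrime g w)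
    (hu : ∀ i, u i = x.point ![g * p₀, g * p₁, w] i) {G : PolyTX K} {j : ℕ}
    (hG : G.IsHomogeneous j) (h0 : aeval u G = 0) :
    Polynomial.C w * Polynomial.X - Polynomial.C g ∣ x.psi p₀ p₁ G := by
  have h := x.pow_mul_aeval_psi (FractionRing (PolyT K)) hw hu hG
  have hw' : algebraMap (PolyT K) (FractionRing (PolyT K)) w ≠ 0 := by
    simpa using (FaithfulSMul.algebraMap_injective (PolyT K) (FractionRing (PolyT K))).ne hw
  rw [h0, map_zero, mul_eq_zero, or_iff_right (pow_ne_zero _ hw')] at h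
  exact linear_dvd_of_aeval_div_eq_zero _ hgw hw h

theorem Coordinates.aeval_eq_zero_of_dvd_psi (hw : w ≠ 0)
    (hu : ∀ i, u i = x.point ![g * p₀, g * p₁, w] i) {G : PolyTX K} {j : ℕ}
    (hG : G.IsHomogeneous j)
    (h0 : Polynomial.C w * Polynomial.X - Polynomial.C g ∣ x.psi p₀ p₁ G) : aeval u G = 0 := by
  have h := x.pow_mul_aeval_psi (FractionRing (PolyT K)) hw hu hG
  have hw' : algebraMap (PolyT K) (FractionRing (PolyT K)) w ≠ 0 := by
    simpa using (FaithfulSMul.algebraMap_injective (PolyT K) (FractionRing (PolyT K))).ne hw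
  obtain ⟨A, hA⟩ := h0
  rw [hA] at h
  apply FaithfulSMul.algebraMap_injective (PolyT K) (FractionRing (PolyT K))
  rw [← h, map_zero, map_mul]
  simp [mul_div_cancel₀ _ hw']

/-- The coefficients of `A` are handled upwards: that of `Z^(n+1)` in the product is `w Aₙ - g
Aₙ₊₁`. The expected degree `i + 2n - e` may be negative, and then `Aₙ = 0`; hence the alternative.
-/
theorem coeff_of_isGraded_linear_mul {e i j : ℕ} (hg : g.IsHomogeneous e) (hg0 : g ≠ 0)
    (hw : w.IsHomogeneous (e + 2)) (hw0 : w ≠ 0) {A : Polynomial (PolyT K)}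
    (h : IsGraded ((Polynomial.C w * Polynomial.X - Polynomial.C g) * A) i j) :
    (A ≠ 0 → A.natDegree + 1 ≤ j) ∧
      ∀ n, A.coeff n = 0 ∨ ∃ l, l + e = i + 2 * n ∧ (A.coeff n).IsHomogeneous l := by
  constructor
  · intro hA
    have hd : (Polynomial.C w * Polynomial.X - Polynomial.C g).natDegree = 1 := by
      rw [Polynomial.natDegree_sub_C, Polynomial.natDegree_C_mul_X _ hw0]
    have := h.natDegree_le
    rwa [Polynomial.natDegree_mul (fun h0 => by simp [h0] at hd) hA, hd, add_comm] at this
  · have key : ∀ n, (g * A.coeff n).IsHomogeneous (i + 2 * n) →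
        (A.coeff n = 0 ∨ ∃ l, l + e = i + 2 * n ∧ (A.coeff n).IsHomogeneous l) := by
      intro n hn
      by_cases h0 : A.coeff n = 0
      · exact Or.inl h0
      · obtain ⟨l, hl, h'⟩ := isHomogeneous_of_mul_left hg hg0 hn h0
        exact Or.inr ⟨l, by omega, h'⟩
    intro n
    induction n with
    | zero =>
      apply key
      have := (h.coeff 0).neg
      simpa [Polynomial.mul_coeff_zero] using this
    | succ n ih =>
      apply key
      have h1 := h.coeff (n + 1)
      rw [sub_mul, mul_assoc, Polynomial.coeff_sub, Polynomial.coeff_C_mul, Polynomial.coeff_X_mul,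
        Polynomial.coeff_C_mul] at h1
      have h2 : (w * A.coeff n).IsHomogeneous (i + 2 * (n + 1)) := by
        rcases ih with h0 | ⟨l, hl, h'⟩
        · rw [h0, mul_zero]; exact isHomogeneous_zero _ _ _
        · have := hw.mul h'
          rwa [show e + 2 + l = i + 2 * (n + 1) by omega] at this
      have := h2.sub h1
      rwa [sub_sub_cancel] at this

end Evaluation

/-! ### The defining ideal and its bihomogeneous elements. -/

section Rees

variable {u : Fin 3 → PolyT K}

theorem mem_definingIdeal_iff {G : PolyTX K} :
    G ∈ definingIdeal u ↔ ∀ j, aeval u (homogeneousComponent j G) = 0 := by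
  have h : ((reesMap u G : reesAlgebra (paramIdeal u)) : Polynomial (PolyT K)) =
      aeval (fun i => Polynomial.monomial 1 (u i)) G := by
    rw [← Subalgebra.coe_val, reesMap, ← AlgHom.comp_apply, comp_aeval]
    rfl
  rw [definingIdeal, RingHom.mem_ker, ← Subtype.coe_inj, h, Polynomial.ext_iff]
  simp only [coeff_aeval_monomial_one]
  simp

theorem mem_definingIdeal_of_isHomogeneous {G : PolyTX K} {j : ℕ} (hG : G.IsHomogeneous j)
    (h : aeval u G = 0) : G ∈ definingIdeal u := by
  rw [mem_definingIdeal_iff]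
  intro l
  rw [homogeneousComponent_of_mem hG]
  split_ifs
  · exact h
  · exact map_zero _

/-- The component of `T`-degree `i`. -/
noncomputable def tComponent (i : ℕ) (G : PolyTX K) : PolyTX K :=
  mapCoeff (homogeneousComponent i : PolyT K →ₗ[K] PolyT K).toAddMonoidHom G

theorem isBihomogeneous_tComponent (i : ℕ) {G : PolyTX K} {j : ℕ} (hG : G.IsHomogeneous j) :
    IsBihomogeneous (tComponent i G) i j :=
  ⟨isHomogeneous_mapCoeff _ hG, fun m => by
    rw [tComponent, coeff_mapCoeff]; exact homogeneousComponent_isHomogeneous _ _⟩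

/-- All `u i` have the same degree, so on `X`-degree `j` evaluation shifts every `T`-degree by `d
j`. -/
theorem aeval_tComponent {d : ℕ} (hu : ∀ i, (u i).IsHomogeneous d) (i : ℕ) {G : PolyTX K} {j : ℕ}
    (hG : G.IsHomogeneous j) :
    aeval u (tComponent i G) = homogeneousComponent (i + d * j) (aeval u G) := by
  conv_rhs => rw [G.as_sum, map_sum, map_sum]
  rw [tComponent, mapCoeff, map_sum]
  refine Finset.sum_congr rfl fun m hm => ?_
  have hprod : (m.prod fun l e => u l ^ e).IsHomogeneous (d * j) := by
    rw [hG.degree_eq_sum_deg_support hm, Finset.mul_sum]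
    exact IsHomogeneous.prod _ _ _ fun l _ => (hu l).pow _
  rw [aeval_monomial, aeval_monomial]
  exact (homogeneousComponent_mul_of_isHomogeneous hprod _ _).symm

theorem sum_tComponent (G : PolyTX K) :
    ∃ N, G = ∑ i ∈ Finset.range N, tComponent i G := by
  let N := G.support.sup (fun m => (coeff m G).totalDegree) + 1
  refine ⟨N, ?_⟩
  ext1 m
  rw [coeff_sum]
  simp only [tComponent, coeff_mapCoeff]
  by_cases hm : m ∈ G.support
  · have hle : (coeff m G).totalDegree + 1 ≤ N :=
      Nat.succ_le_succ (Finset.le_sup (f := fun m => (coeff m G).totalDegree) hm)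
    conv_lhs => rw [← sum_homogeneousComponent (coeff m G)]
    exact Finset.sum_subset (Finset.range_mono hle) fun i _ hi =>
      homogeneousComponent_eq_zero _ _ (by simpa using hi)
  · rw [notMem_support_iff.1 hm]
    simp

/-- The defining ideal is generated by its bihomogeneous elements. -/
theorem definingIdeal_le {d : ℕ} (hu : ∀ i, (u i).IsHomogeneous d) {J : Ideal (PolyTX K)}
    (hJ : ∀ i j G, IsBihomogeneous G i j → aeval u G = 0 → G ∈ J) : definingIdeal u ≤ J := by
  intro G hG
  rw [mem_definingIdeal_iff] at hG
  rw [← sum_homogeneousComponent G]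
  refine J.sum_mem fun j _ => ?_
  obtain ⟨N, hN⟩ := sum_tComponent (homogeneousComponent j G)
  rw [hN]
  refine J.sum_mem fun i _ => hJ i j _
    (isBihomogeneous_tComponent i (homogeneousComponent_isHomogeneous j G)) ?_
  rw [aeval_tComponent hu i (homogeneousComponent_isHomogeneous j G), hG, map_zero]

end Rees

/-! ### Syzygies as linear forms. -/

section LinForm

theorem coeff_single_linForm (s : Fin 3 → PolyT K) (i : Fin 3) :
    coeff (Finsupp.single i 1) (linForm s) = s i := by
  classical
  simp [linForm, coeff_sum, coeff_C_mul, coeff_X, Finsupp.single_left_inj]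

theorem linForm_injective : Function.Injective (linForm (K := K)) := fun s t h =>
  funext fun i => by rw [← coeff_single_linForm s, h, coeff_single_linForm]

theorem linForm_smul (h : PolyT K) (s : Fin 3 → PolyT K) : linForm (h • s) = C h * linForm s := by
  simp [linForm, Finset.mul_sum, mul_assoc]

theorem linForm_add (s t : Fin 3 → PolyT K) : linForm (s + t) = linForm s + linForm t := by
  simp [linForm, Finset.sum_add_distrib, add_mul]

theorem linForm_sub (s t : Fin 3 → PolyT K) : linForm (s - t) = linForm s - linForm t := by
  simp [linForm, Finset.sum_sub_distrib, sub_mul]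

theorem isHomogeneous_linForm (s : Fin 3 → PolyT K) : (linForm s).IsHomogeneous 1 :=
  IsHomogeneous.sum _ _ _ fun i _ => (isHomogeneous_X _ i).C_mul _

theorem exists_eq_single_of_degree_eq_one {σ : Type*} {m : σ →₀ ℕ} (hm : m.degree = 1) :
    ∃ l, m = Finsupp.single l 1 := by
  have hm0 : m ≠ 0 := by rintro rfl; simp at hm
  obtain ⟨l, hl⟩ := Finsupp.ne_iff.1 hm0
  have hle : Finsupp.single l 1 ≤ m := by
    rw [Finsupp.single_le_iff]
    exact Nat.one_le_iff_ne_zero.2 hl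
  refine ⟨l, ?_⟩
  have h := congrArg Finsupp.degree (tsub_add_cancel_of_le hle)
  rw [map_add, Finsupp.degree_single, hm] at h
  have h0 : m - Finsupp.single l 1 = 0 := (Finsupp.degree_eq_zero_iff _).1 (by omega)
  rw [← tsub_add_cancel_of_le hle, h0, zero_add]

theorem exists_eq_linForm {G : PolyTX K} {i : ℕ} (hG : IsBihomogeneous G i 1) :
    ∃ s : Fin 3 → PolyT K, (∀ l, (s l).IsHomogeneous i) ∧ G = linForm s := by
  classical
  refine ⟨fun l => coeff (Finsupp.single l 1) G, fun l => hG.2 _, ?_⟩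
  ext1 m
  by_cases hm : m.degree = 1
  · obtain ⟨l, rfl⟩ := exists_eq_single_of_degree_eq_one hm
    rw [coeff_single_linForm]
  · rw [hG.1.coeff_eq_zero hm, (isHomogeneous_linForm _).coeff_eq_zero hm]

theorem aeval_linForm (u s : Fin 3 → PolyT K) : aeval u (linForm s) = ∑ i, s i * u i := by
  simp [linForm]

theorem mem_syz_iff {u s : Fin 3 → PolyT K} : s ∈ syz u ↔ aeval u (linForm s) = 0 := by
  rw [syz, LinearMap.mem_ker, Fintype.linearCombination_apply, aeval_linForm]
  simp

/-- Proportional linear forms: a multiple of `linForm s` that is a linear form is a scalar multiple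
of it. -/
theorem eq_smul_of_linForm_dvd {s t : Fin 3 → PolyT K} (h : linForm s ∣ linForm t) :
    ∃ q : PolyT K, t = q • s := by
  obtain ⟨H, hH⟩ := h
  refine ⟨coeff 0 H, linForm_injective ?_⟩
  have := homogeneousComponent_mul_of_isHomogeneous (isHomogeneous_linForm s) H 0
  rw [linForm_smul, ← homogeneousComponent_zero, ← this, mul_comm, ← hH, zero_add,
    homogeneousComponent_eq_self (isHomogeneous_linForm t)]

end LinForm

/-! ### Forms of `T`-degree two. -/

section QuadT

theorem ofX_C (e : K) : ofX (C e : PolyX K) = C (C e) := by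
  rw [ofX, map_C]

theorem coeff_ofX (f : PolyX K) (m : Fin 3 →₀ ℕ) : coeff m (ofX f) = C (coeff m f) := by
  rw [ofX, coeff_map]

theorem aeval_ofX (u : Fin 3 → PolyT K) (f : PolyX K) : aeval u (ofX f) = aeval u f := by
  exact aeval_map_algebraMap (PolyT K) u f

theorem quadratic_injective {a b c a' b' c' : K}
    (h : (C a * X 0 ^ 2 + C b * X 1 ^ 2 + C c * (X 0 * X 1) : PolyT K) =
      C a' * X 0 ^ 2 + C b' * X 1 ^ 2 + C c' * (X 0 * X 1)) : a = a' ∧ b = b' ∧ c = c' := by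
  have h1 := congrArg (eval ![1, 0]) h
  have h2 := congrArg (eval ![0, 1]) h
  have h3 := congrArg (eval ![1, 1]) h
  simp at h1 h2 h3
  refine ⟨h1, h2, ?_⟩
  rw [h1, h2] at h3
  exact add_left_cancel h3

theorem coeff_quadT (c₀ c₁ c₂ : PolyX K) (m : Fin 3 →₀ ℕ) :
    coeff m (quadT c₀ c₁ c₂) = C (coeff m c₀) * X 0 ^ 2 + C (coeff m c₁) * X 1 ^ 2 +
      C (coeff m c₂) * (X 0 * X 1) := by
  simp only [quadT, coeff_add, coeff_C_mul, coeff_ofX]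
  ring

theorem quadT_injective {c₀ c₁ c₂ d₀ d₁ d₂ : PolyX K} (h : quadT c₀ c₁ c₂ = quadT d₀ d₁ d₂) :
    c₀ = d₀ ∧ c₁ = d₁ ∧ c₂ = d₂ := by
  have key : ∀ m : Fin 3 →₀ ℕ,
      coeff m c₀ = coeff m d₀ ∧ coeff m c₁ = coeff m d₁ ∧ coeff m c₂ = coeff m d₂ := fun m =>
    quadratic_injective (by rw [← coeff_quadT, h, coeff_quadT])
  exact ⟨MvPolynomial.ext _ _ fun m => (key m).1, MvPolynomial.ext _ _ fun m => (key m).2.1,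
    MvPolynomial.ext _ _ fun m => (key m).2.2⟩

theorem isHomogeneous_of_quadT {c₀ c₁ c₂ : PolyX K} {j : ℕ} (h : (quadT c₀ c₁ c₂).IsHomogeneous j) :
    c₀.IsHomogeneous j ∧ c₁.IsHomogeneous j ∧ c₂.IsHomogeneous j := by
  have key : ∀ m : Fin 3 →₀ ℕ, m.degree ≠ j →
      coeff m c₀ = 0 ∧ coeff m c₁ = 0 ∧ coeff m c₂ = 0 := fun m hm =>
    quadratic_injective (by rw [← coeff_quadT, h.coeff_eq_zero hm]; simp)
  have hom : ∀ c : PolyX K, (∀ m : Fin 3 →₀ ℕ, m.degree ≠ j → coeff m c = 0) → c.IsHomogeneous j := by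
    intro c hc m hm
    by_contra hne
    exact hm (hc m (by rwa [Finsupp.degree_eq_weight_one]))
  exact ⟨hom _ fun m hm => (key m hm).1, hom _ fun m hm => (key m hm).2.1,
    hom _ fun m hm => (key m hm).2.2⟩

theorem exists_eq_quadT {G : PolyTX K} {j : ℕ} (hG : IsBihomogeneous G 2 j) :
    ∃ c₀ c₁ c₂ : PolyX K, G = quadT c₀ c₁ c₂ := by
  classical
  choose a b c h using fun m => exists_eq_quadratic (hG.2 m)
  refine ⟨∑ m ∈ G.support, monomial m (a m), ∑ m ∈ G.support, monomial m (b m),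
    ∑ m ∈ G.support, monomial m (c m), ?_⟩
  ext1 m
  rw [coeff_quadT]
  simp only [coeff_sum, coeff_monomial, Finset.sum_ite_eq']
  split_ifs with hm
  · exact h m
  · rw [notMem_support_iff.1 hm]; simp

theorem constForm_eq_ofX (a : Fin 3 → K) : constForm a = ofX (∑ i, C (a i) * X i) := by
  simp [constForm, linForm, ofX]

end QuadT

/-- Applied with `T₀, T₁` to reach `L₀, L₁`, and with `p₀, p₁` to construct values of `𝒟_T`. -/
theorem exists_coeffwise_decomposition {q₀ q₁ : PolyT K} {i i' : ℕ}
    (h : ∀ f : PolyT K, f.IsHomogeneous i → ∃ f₀ f₁ : PolyT K, f₀.IsHomogeneous i' ∧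
      f₁.IsHomogeneous i' ∧ f = q₀ * f₀ + q₁ * f₁) {G : PolyTX K} {j : ℕ}
    (hG : IsBihomogeneous G i j) :
    ∃ G₀ G₁ : PolyTX K, IsBihomogeneous G₀ i' j ∧ IsBihomogeneous G₁ i' j ∧
      G = C q₀ * G₀ + C q₁ * G₁ := by
  classical
  choose f₀ f₁ hf₀ hf₁ he using fun m => h _ (hG.2 m)
  have hb : ∀ f : (Fin 3 →₀ ℕ) → PolyT K, (∀ m, (f m).IsHomogeneous i') →
      IsBihomogeneous (∑ m ∈ G.support, monomial m (f m)) i' j := by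
    intro f hf
    refine IsBihomogeneous.sum fun m hm => ⟨isHomogeneous_monomial _ ?_, fun l => ?_⟩
    · rw [hG.1.degree_eq_sum_deg_support hm, Finsupp.degree_apply]
    · rw [coeff_monomial]
      split_ifs
      exacts [hf m, isHomogeneous_zero _ _ _]
  refine ⟨_, _, hb f₀ hf₀, hb f₁ hf₁, ?_⟩
  ext1 m
  simp only [coeff_add, coeff_C_mul, coeff_sum, coeff_monomial, Finset.sum_ite_eq']
  split_ifs with hm
  · exact he m
  · rw [notMem_support_iff.1 hm]; simp

/-- The parametrization `u` in adapted coordinates: `ℓ₀(u) = g p₀`, `ℓ₁(u) = g p₁`, `ℓ₂(u) = w`. -/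
structure IsFrame {a b : Fin 3 → K} (x : Coordinates a b) (u : Fin 3 → PolyT K) (k : ℕ)
    (p₀ p₁ g w : PolyT K) : Prop where
  two_le : 2 ≤ k
  hp₀ : p₀.IsHomogeneous 2
  hp₁ : p₁.IsHomogeneous 2
  hp : IsRelPrime p₀ p₁
  hg : g.IsHomogeneous (2 * (k - 1))
  hw : w.IsHomogeneous (2 * k)
  hgw : IsRelPrime g w
  hu : ∀ i, u i = x.point ![g * p₀, g * p₁, w] i

namespace IsFrame

variable {a b : Fin 3 → K} {x : Coordinates a b} {u : Fin 3 → PolyT K} {k : ℕ}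
  {p₀ p₁ g w : PolyT K}

theorem p₁_ne_zero (h : IsFrame x u k p₀ p₁ g w) : p₁ ≠ 0 := ne_zero_of_isRelPrime two_ne_zero h.hp₀ h.hp

theorem g_ne_zero (h : IsFrame x u k p₀ p₁ g w) : g ≠ 0 :=
  ne_zero_of_isRelPrime (by have := h.two_le; omega) h.hw h.hgw.symm

theorem w_ne_zero (h : IsFrame x u k p₀ p₁ g w) : w ≠ 0 := ne_zero_of_isRelPrime (by have := h.two_le; omega) h.hg h.hgw

end IsFrame

/-- The special elements and their images under `psi`. -/
structure SpecialValues {a b : Fin 3 → K} (x : Coordinates a b) (k : ℕ)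
    (p₀ p₁ g w : PolyT K) (P : PolyTX K) (F : ℕ → PolyTX K) (L₀ L₁ : PolyTX K) (c : K)
    (l₀ l₁ : PolyT K) : Prop where
  P_eq : P = C p₁ * constForm a - C p₀ * constForm b
  c_ne_zero : c ≠ 0
  bihom_F : ∀ j, 1 ≤ j → j ≤ k - 1 → IsBihomogeneous (F j) (2 * (k - j)) j
  psi_F : ∀ j, 1 ≤ j → j ≤ k - 1 → x.psi p₀ p₁ (F j) = Polynomial.C (C c) *
    Polynomial.X ^ (j - 1) * (Polynomial.C w * Polynomial.X - Polynomial.C g)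
  hl₀ : l₀.IsHomogeneous 1
  hl₁ : l₁.IsHomogeneous 1
  independent : ∀ s t : K, C s * l₀ + C t * l₁ = 0 → s = 0 ∧ t = 0
  bihom_L₀ : IsBihomogeneous L₀ 1 k
  bihom_L₁ : IsBihomogeneous L₁ 1 k
  psi_L₀ : x.psi p₀ p₁ L₀ = Polynomial.C l₀ * Polynomial.X ^ (k - 1) *
    (Polynomial.C w * Polynomial.X - Polynomial.C g)
  psi_L₁ : x.psi p₀ p₁ L₁ = Polynomial.C l₁ * Polynomial.X ^ (k - 1) *
    (Polynomial.C w * Polynomial.X - Polynomial.C g)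

/-! ### Images of the special elements under `psi`. -/

section SpecialFamily

variable {a b : Fin 3 → K} {x : Coordinates a b} {u : Fin 3 → PolyT K} {k : ℕ}
  {p₀ p₁ g w : PolyT K} {P : PolyTX K} {F : ℕ → PolyTX K} {L₀ L₁ : PolyTX K}

/-- A common factor `d` of `p₀, p₁` can be removed from the syzygy, `s = d s'`. Since `s'` is again
a combination `α s + β t`, independence gives `d α = 1`. -/
theorem isRelPrime_of_isMuBasis {m n : ℕ} {Q : PolyTX K}
    (h : IsMuBasis u m n (C p₁ * constForm a - C p₀ * constForm b) Q) : IsRelPrime p₀ p₁ := by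
  obtain ⟨s, t, hs, -, -, -, hli, hspan⟩ := h
  rintro d ⟨q₀, rfl⟩ ⟨q₁, rfl⟩
  have hs' : s = d • (fun i => q₁ * C (a i) - q₀ * C (b i)) := by
    apply linForm_injective
    rw [← hs]
    simp only [constForm, linForm, Pi.smul_apply, smul_eq_mul, C_mul, C_sub, Finset.mul_sum,
      ← Finset.sum_sub_distrib]
    exact Finset.sum_congr rfl fun i _ => by ring
  set s' := fun i => q₁ * C (a i) - q₀ * C (b i)
  have hs0 : s ≠ 0 := hli.ne_zero 0
  have hd0 : d ≠ 0 := by rintro rfl; exact hs0 (by rw [hs', zero_smul])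
  have hmem : s' ∈ syz u := by
    have hsm : s ∈ syz u := hspan ▸ Submodule.subset_span (by simp)
    rw [syz, LinearMap.mem_ker] at hsm ⊢
    rw [hs', map_smul, smul_eq_zero] at hsm
    exact hsm.resolve_left hd0
  rw [← hspan, Submodule.mem_span_pair] at hmem
  obtain ⟨α, β, hαβ⟩ := hmem
  have h2 : (d * α - 1) • s + (d * β) • t = 0 := by
    have h3 : s = d • (α • s + β • t) := by rw [hαβ]; exact hs'
    rw [sub_smul, one_smul, mul_smul, mul_smul]
    rw [smul_add] at h3
    linear_combination (exp := 1) -h3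
  have h3 := (LinearIndependent.pair_iff.1 hli) _ _ h2
  exact IsUnit.of_mul_eq_one α (sub_eq_zero.1 h3.1)

/-- The syzygy reads `p₁ ℓ₀(u) = p₀ ℓ₁(u)`, so coprimality produces `g`. A common factor of `g` and
`w` would divide every `u i`. -/
theorem exists_isFrame (x : Coordinates a b) (hk : 2 ≤ k) (hdeg : ∀ i, (u i).IsHomogeneous (2 * k))
    (hcop : NoCommonFactor u) (h₀ : p₀.IsHomogeneous 2) (h₁ : p₁.IsHomogeneous 2)
    (h : IsRelPrime p₀ p₁)
    (hsyz : aeval u (C p₁ * constForm a - C p₀ * constForm b) = 0) :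
    ∃ g w, IsFrame x u k p₀ p₁ g w := by
  have hv : ∀ y : Fin 3 → K, (∑ i, C (y i) * u i).IsHomogeneous (2 * k) := fun y =>
    IsHomogeneous.sum _ _ _ fun i _ => (hdeg i).C_mul _
  have hp₁ := ne_zero_of_isRelPrime two_ne_zero h₀ h
  have hp₀ := ne_zero_of_isRelPrime two_ne_zero h₁ h.symm
  set v₀ := ∑ i, C (a i) * u i with hv₀
  set v₁ := ∑ i, C (b i) * u i with hv₁
  have he : p₁ * v₀ = p₀ * v₁ := by
    simp only [map_sub, map_mul, aeval_C, constForm, aeval_linForm] at hsyz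
    exact sub_eq_zero.1 hsyz
  obtain ⟨g, hg⟩ : p₀ ∣ v₀ := h.dvd_of_dvd_mul_left ⟨v₁, he⟩
  have hg₁ : v₁ = p₁ * g := by
    apply mul_left_cancel₀ hp₀
    rw [← he, hg]; ring
  have hu : ∀ i, u i = x.point ![g * p₀, g * p₁, ∑ i, C (x.c i) * u i] i := by
    intro i
    rw [← x.point_sum u i]
    congr 1
    funext r
    fin_cases r
    · exact hg.trans (mul_comm _ _)
    · exact hg₁.trans (mul_comm _ _)
    · rfl
  have hgw : IsRelPrime g (∑ i, C (x.c i) * u i) := by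
    intro d hdg hdw
    refine hcop d fun i => ?_
    rw [hu, Coordinates.point]
    refine Finset.dvd_sum fun r _ => Dvd.dvd.mul_left ?_ _
    fin_cases r
    · exact hdg.mul_right _
    · exact hdg.mul_right _
    · exact hdw
  have hg0 : g ≠ 0 := ne_zero_of_isRelPrime (by omega) (hv x.c) hgw.symm
  obtain ⟨l, hl, hgl⟩ := isHomogeneous_of_mul_left h₀ hp₀
    (by rw [← hg]; exact hv a) hg0
  exact ⟨g, _, hk, h₀, h₁, h, by rwa [show 2 * (k - 1) = l by omega], hv x.c, hgw, hu⟩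

/-- The quotient of `psi Q` by `w Z - g` has degree `0` in both `Z` and `T`, so it is a constant. It
is not zero, since otherwise the second basis element would be a multiple of the first. -/
theorem psi_of_isMuBasis (hf : IsFrame x u k p₀ p₁ g w) {Q : PolyTX K}
    (h : IsMuBasis u 2 (2 * (k - 1)) (C p₁ * constForm a - C p₀ * constForm b) Q) :
    IsBihomogeneous Q (2 * (k - 1)) 1 ∧ ∃ c : K, c ≠ 0 ∧ x.psi p₀ p₁ Q =
      Polynomial.C (C c) * (Polynomial.C w * Polynomial.X - Polynomial.C g) := by
  obtain ⟨s, t, hs, rfl, -, ht, hli, hspan⟩ := h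
  have hb : IsBihomogeneous (linForm t) (2 * (k - 1)) 1 := IsBihomogeneous.linForm ht
  refine ⟨hb, ?_⟩
  have htm : t ∈ syz u := hspan ▸ Submodule.subset_span (by simp)
  obtain ⟨A, hA⟩ := x.dvd_psi_of_aeval_eq_zero (p₀ := p₀) (p₁ := p₁) hf.w_ne_zero hf.hgw hf.hu
    hb.1 (mem_syz_iff.1 htm)
  have hw' : w.IsHomogeneous (2 * (k - 1) + 2) := by
    rw [show 2 * (k - 1) + 2 = 2 * k by have := hf.two_le; omega]; exact hf.hw
  have hgr := x.isGraded_psi hf.hp₀ hf.hp₁ hb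
  rw [hA] at hgr
  obtain ⟨hdeg, hco⟩ := coeff_of_isGraded_linear_mul hf.hg hf.g_ne_zero hw' hf.w_ne_zero hgr
  have hA0 : A ≠ 0 := by
    rintro rfl
    rw [mul_zero] at hA
    have hdvd := x.dvd_of_psi_eq_zero hf.hp hf.p₁_ne_zero hb.1 hA
    rw [hs] at hdvd
    obtain ⟨q, hq⟩ := eq_smul_of_linForm_dvd hdvd
    have := (LinearIndependent.pair_iff.1 hli) q (-1) (by rw [hq]; simp)
    simp at this
  obtain ⟨e, rfl⟩ := Polynomial.natDegree_eq_zero.1 (by have := hdeg hA0; omega : A.natDegree = 0)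
  have he : e ≠ 0 := by rintro rfl; simp at hA0
  obtain ⟨l, hl, hel⟩ := (hco 0).resolve_left (by simpa using he)
  rw [Polynomial.coeff_C_zero, show l = 0 by omega] at hel
  obtain ⟨c, rfl⟩ := exists_eq_C_of_isHomogeneous_zero hel
  exact ⟨c, by simpa using he, by rw [hA, mul_comm]⟩

/-- `𝒟_T` becomes multiplication by `Z`, whatever decomposition is chosen. -/
theorem psi_of_isDT (x : Coordinates a b) {i j : ℕ} {G D : PolyTX K}
    (h : IsDT p₀ p₁ (constForm a) (constForm b) i j G D) :
    IsBihomogeneous D i (j + 1) ∧ x.psi p₀ p₁ D = Polynomial.X * x.psi p₀ p₁ G := by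
  obtain ⟨G₀, G₁, h₀, h₁, rfl, rfl⟩ := h
  constructor
  · have := ((isBihomogeneous_constForm a).mul h₀).add ((isBihomogeneous_constForm b).mul h₁)
    rwa [zero_add, add_comm 1 j] at this
  · simp only [map_add, map_mul, Coordinates.psi_a, Coordinates.psi_b, Coordinates.psi_C]
    ring

theorem isHomogeneous_P (a b : Fin 3 → K) (h₀ : p₀.IsHomogeneous 2) (h₁ : p₁.IsHomogeneous 2) :
    IsBihomogeneous (C p₁ * constForm a - C p₀ * constForm b) 2 1 := by
  simpa using ((IsBihomogeneous.C h₁).mul (isBihomogeneous_constForm a)).sub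
    ((IsBihomogeneous.C h₀).mul (isBihomogeneous_constForm b))

/-- `psi` kills `P`, so `y L` has the image of `-f M`; and `f = β ℓ₀ - α ℓ₁` maps to `(β p₀ - α p₁)
Z = y l Z`. -/
theorem psi_of_cross {P M L : PolyTX K} {f m : PolyX K} {c α β : K} {y l : PolyT K} {k : ℕ}
    (hk : 2 ≤ k) (hy : y ≠ 0) (x : Coordinates a b)
    (hP : x.psi p₀ p₁ P = 0) (hM : x.psi p₀ p₁ M = Polynomial.C (C c) *
      Polynomial.X ^ (k - 1 - 1) * (Polynomial.C w * Polynomial.X - Polynomial.C g))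
    (hL : ofX m * P - ofX f * M = C y * L)
    (hf : ofX f = C (C β) * constForm a - C (C α) * constForm b)
    (hl : y * l = C β * p₀ - C α * p₁) :
    x.psi p₀ p₁ L = Polynomial.C (C (-c) * l) * Polynomial.X ^ (k - 1) *
      (Polynomial.C w * Polynomial.X - Polynomial.C g) := by
  have h := congrArg (x.psi p₀ p₁) hL
  have h2 := congrArg (Polynomial.C) hl
  simp only [map_sub, map_mul, hP, hM, hf, Coordinates.psi_a, Coordinates.psi_b,
    Coordinates.psi_C] at h h2
  have hX : (Polynomial.X : Polynomial (PolyT K)) ^ (k - 1) = Polynomial.X ^ (k - 1 - 1) * Polynomial.X := by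
    rw [← pow_succ]; congr 1; omega
  apply mul_left_cancel₀ (Polynomial.C_ne_zero.2 hy)
  rw [← h, hX]
  simp only [Polynomial.C_mul, C_neg, Polynomial.C_neg]
  linear_combination (Polynomial.C (C c) * Polynomial.X ^ (k - 1 - 1) * Polynomial.X *
    (Polynomial.C w * Polynomial.X - Polynomial.C g)) * h2

theorem isBihomogeneous_cross {P M L : PolyTX K} {f m : PolyX K} {y : PolyT K} {k : ℕ} (hk : 2 ≤ k)
    (hy : y.IsHomogeneous 1) (hy0 : y ≠ 0)
    (hP : IsBihomogeneous P 2 1) (hM : IsBihomogeneous M 2 (k - 1)) (hf : f.IsHomogeneous 1)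
    (hm : m.IsHomogeneous (k - 1)) (hL : ofX m * P - ofX f * M = C y * L) :
    IsBihomogeneous L 1 k := by
  refine IsBihomogeneous.of_C_mul hy hy0 ?_
  rw [← hL]
  have h1 := (IsBihomogeneous.ofX hm).mul hP
  have h2 := (IsBihomogeneous.ofX hf).mul hM
  rw [show k - 1 + 1 = k by omega] at h1
  rw [show 1 + (k - 1) = k by omega] at h2
  exact h1.sub h2

theorem exists_specialValues (x : Coordinates a b) (hk : 2 ≤ k)
    (hdeg : ∀ i, (u i).IsHomogeneous (2 * k)) (hcop : NoCommonFactor u)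
    (h : IsSpecialFamily u k a b P F L₀ L₁) :
    ∃ (p₀ p₁ g w : PolyT K) (c : K) (l₀ l₁ : PolyT K), IsFrame x u k p₀ p₁ g w ∧
      SpecialValues x k p₀ p₁ g w P F L₀ L₁ c l₀ l₁ ∧ IsMuBasis u 2 (2 * (k - 1)) P (F 1) := by
  obtain ⟨p₀, p₁, h₀, h₁, hP, hmu, hDT, hlin⟩ := h
  subst hP
  have hrel := isRelPrime_of_isMuBasis hmu
  have hsyz : aeval u (C p₁ * constForm a - C p₀ * constForm b) = 0 := by
    obtain ⟨s, t, hs, -, -, -, -, hspan⟩ := hmu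
    rw [hs, ← mem_syz_iff, ← hspan]
    exact Submodule.subset_span (by simp)
  obtain ⟨g, w, hf⟩ := exists_isFrame x hk hdeg hcop h₀ h₁ hrel hsyz
  obtain ⟨hb₁, c, hc, hpsi₁⟩ := psi_of_isMuBasis hf hmu
  have hF : ∀ j, 1 ≤ j → j ≤ k - 1 → IsBihomogeneous (F j) (2 * (k - j)) j ∧
      x.psi p₀ p₁ (F j) = Polynomial.C (C c) *
        Polynomial.X ^ (j - 1) * (Polynomial.C w * Polynomial.X - Polynomial.C g) := by
    intro j hj
    induction j, hj using Nat.le_induction with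
    | base => exact fun _ => ⟨hb₁, by rw [hpsi₁]; simp⟩
    | succ j hj ih =>
      intro hjk
      obtain ⟨-, h2⟩ := ih (by omega)
      obtain ⟨h3, h4⟩ := psi_of_isDT x (hDT j hj (by omega))
      refine ⟨h3, ?_⟩
      rw [h4, h2]
      obtain ⟨j, rfl⟩ := Nat.exists_eq_succ_of_ne_zero (by omega : j ≠ 0)
      simp only [Nat.succ_eq_add_one, Nat.add_sub_cancel, pow_succ]
      ring
  obtain ⟨f₀, f₁, f₂, m₀, m₁, m₂, hP, hM, hL₀, hL₁⟩ := hlin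
  obtain ⟨hbM, hpsiM⟩ := hF (k - 1) (by omega) le_rfl
  rw [show k - (k - 1) = 1 by omega] at hbM
  obtain ⟨α₀, α₁, α₂, hα⟩ := exists_eq_quadratic h₀
  obtain ⟨β₀, β₁, β₂, hβ⟩ := exists_eq_quadratic h₁
  set A : PolyX K := ∑ i, C (a i) * X i with hA
  set B : PolyX K := ∑ i, C (b i) * X i with hB
  have hP' : C p₁ * constForm a - C p₀ * constForm b = quadT (C β₀ * A - C α₀ * B)
      (C β₁ * A - C α₁ * B) (C β₂ * A - C α₂ * B) := by
    rw [constForm_eq_ofX, constForm_eq_ofX, ← hA, ← hB, hα, hβ, quadT]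
    simp only [map_sub, map_mul, ofX_C, C_add, C_pow]
    ring
  -- The coefficients of `T₀²` and `T₁²` in `P` are unique, so they are read off from `p₀` and `p₁`.
  obtain ⟨e₀, e₁, -⟩ := quadT_injective (hP.symm.trans hP')
  have hof : ∀ β α : K, ofX (C β * A - C α * B) = C (C β) * constForm a - C (C α) * constForm b := by
    intro β α
    rw [constForm_eq_ofX, constForm_eq_ofX, map_sub, map_mul, map_mul, ofX_C, ofX_C]
  have hbP := isHomogeneous_P a b h₀ h₁
  have hfh := isHomogeneous_of_quadT (hP ▸ hbP.1)
  have hmh := isHomogeneous_of_quadT (hM ▸ hbM.1)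
  have hX := fun i : Fin 2 => isHomogeneous_X K i
  have hl₀ : X 1 * (C (β₀ * α₂ - α₀ * β₂) * X 0 + C (β₀ * α₁ - α₀ * β₁) * X 1) =
      C β₀ * p₀ - C α₀ * p₁ := by
    rw [hα, hβ]; simp only [C_sub, C_mul]; ring
  have hl₁ : X 0 * (C (β₁ * α₀ - α₁ * β₀) * X 0 + C (β₁ * α₂ - α₁ * β₂) * X 1) =
      C β₁ * p₀ - C α₁ * p₁ := by
    rw [hα, hβ]; simp only [C_sub, C_mul]; ring
  refine ⟨p₀, p₁, g, w, c, C (-c) * _, C (-c) * _, hf, ⟨rfl, hc, fun j h h' => (hF j h h').1,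
    fun j h h' => (hF j h h').2, (isHomogeneous_linear _ _).C_mul _,
    (isHomogeneous_linear _ _).C_mul _, ?_,
    isBihomogeneous_cross hk (hX 1) (X_ne_zero _) hbP hbM hfh.1 hmh.1 hL₀,
    isBihomogeneous_cross hk (hX 0) (X_ne_zero _) hbP hbM hfh.2.1 hmh.2.1 hL₁,
    psi_of_cross hk (X_ne_zero 1) x (x.psi_relation _ _) hpsiM hL₀ (by rw [e₀, hof]) hl₀,
    psi_of_cross hk (X_ne_zero 0) x (x.psi_relation _ _) hpsiM hL₁ (by rw [e₁, hof]) hl₁⟩, hmu⟩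
  intro s t hst
  have := linear_forms_independent hα hβ hrel hl₀ hl₁ (s * -c) (t * -c)
    (by simp only [C_mul] at hst ⊢; linear_combination hst)
  simpa [hc] using this

end SpecialFamily

/-- For `d ≠ 0`, distinct degrees `j` go to distinct degrees `d j`. -/
theorem homogeneousComponent_aeval {σ τ : Type*} {v : σ → MvPolynomial τ K} {d : ℕ}
    (hv : ∀ i, (v i).IsHomogeneous d) (hd : d ≠ 0) (G : MvPolynomial σ K) (j : ℕ) :
    homogeneousComponent (d * j) (aeval v G) = aeval v (homogeneousComponent j G) := by
  conv_lhs => rw [← sum_homogeneousComponent G, map_sum, map_sum]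
  have hterm : ∀ l, homogeneousComponent (d * j) (aeval v (homogeneousComponent l G)) =
      if j = l then aeval v (homogeneousComponent l G) else 0 := by
    intro l
    rw [homogeneousComponent_of_mem ((homogeneousComponent_isHomogeneous l G).aeval _ hv)]
    simp [hd]
  rw [Finset.sum_congr rfl fun l _ => hterm l, Finset.sum_ite_eq]
  split_ifs with hj
  · rfl
  · rw [homogeneousComponent_eq_zero, map_zero]
    simpa using hj

/-! ### The implicit equation. -/

section ImplicitEquation

variable {u : Fin 3 → PolyT K} {E : PolyX K}

theorem eval_aeval (u : Fin 3 → PolyT K) (G : PolyX K) (t : Fin 2 → K) :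
    eval t (aeval u G) = eval (fun i => eval t (u i)) G := by
  have : (aeval t).comp (aeval u) = (aeval (fun i => eval t (u i)) : PolyX K →ₐ[K] K) := by
    ext1 i; simp [aeval_eq_eval]
  simpa [aeval_eq_eval] using DFunLike.congr_fun this G

theorem IsImplicitEquation.aeval_eq_zero [Infinite K] (hE : IsImplicitEquation u E) :
    aeval u E = 0 := by
  apply MvPolynomial.funext
  intro t
  rw [eval_aeval, map_zero, hE.2]
  exact ⟨1, t, by simp⟩

/-- A form vanishing at `u` vanishes on the whole cone, the zero set of `E`. By the Nullstellensatz
`E`, being prime, divides it. -/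
theorem IsImplicitEquation.dvd [IsAlgClosed K] (hE : IsImplicitEquation u E) {G : PolyX K} {n : ℕ}
    (hG : G.IsHomogeneous n) (h : aeval u G = 0) : E ∣ G := by
  have hrad : G ∈ (Ideal.span {E}).radical := by
    rw [← vanishingIdeal_zeroLocus_eq_radical (K := K), mem_vanishingIdeal_iff]
    intro y hy
    rw [mem_zeroLocus_iff] at hy
    have hy' := hy E (Ideal.subset_span rfl)
    rw [aeval_eq_eval] at hy'
    obtain ⟨c, t, rfl⟩ := (hE.2 y).1 hy'
    rw [aeval_smul_of_isHomogeneous hG, aeval_eq_eval, ← eval_aeval, h]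
    simp
  obtain ⟨n, hn⟩ := hrad
  exact hE.1.prime.dvd_of_dvd_pow (Ideal.mem_span_singleton.1 hn)

/-- `E` divides each of its own homogeneous components, and a factor of a nonzero form is a form. -/
theorem IsImplicitEquation.exists_isHomogeneous [IsAlgClosed K] (hE : IsImplicitEquation u E) {d : ℕ}
    (hu : ∀ i, (u i).IsHomogeneous d) (hd : d ≠ 0) : ∃ D, E.IsHomogeneous D := by
  obtain ⟨n, hn⟩ : ∃ n, homogeneousComponent n E ≠ 0 := by
    by_contra! hc
    exact hE.1.ne_zero (eq_of_homogeneousComponent_eq fun j => by rw [hc, map_zero])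
  have h0 : aeval u (homogeneousComponent n E) = 0 := by
    rw [← homogeneousComponent_aeval hu hd, hE.aeval_eq_zero, map_zero]
  obtain ⟨q, hq⟩ := hE.dvd (homogeneousComponent_isHomogeneous n E) h0
  obtain ⟨i, j, -, hi, -⟩ := exists_isHomogeneous_of_mul
    (hq ▸ homogeneousComponent_isHomogeneous n E) (hq ▸ hn)
  exact ⟨i, hi⟩

end ImplicitEquation

/-! ### The special elements generate the defining ideal. -/

section Generation

variable {a b : Fin 3 → K} {x : Coordinates a b} {u : Fin 3 → PolyT K} {k : ℕ}
  {p₀ p₁ g w : PolyT K} {P : PolyTX K} {F : ℕ → PolyTX K} {L₀ L₁ : PolyTX K} {c : K}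
  {l₀ l₁ : PolyT K} {E : PolyX K}

/-- Lifts one term of a quotient by `w Z - g` into `J`. -/
theorem exists_psi_eq_coeff (hf : IsFrame x u k p₀ p₁ g w)
    (hs : SpecialValues x k p₀ p₁ g w P F L₀ L₁ c l₀ l₁) {J : Ideal (PolyTX K)}
    (hF : ∀ j, 1 ≤ j → j ≤ k - 1 → F j ∈ J) (hL₀ : L₀ ∈ J) (hL₁ : L₁ ∈ J) {i j n l : ℕ} (hi : i ≠ 0)
    (hn : n + 1 ≤ j) {q : PolyT K} (hl : l + 2 * (k - 1) = i + 2 * n) (hq : q.IsHomogeneous l) :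
    ∃ H ∈ J, IsBihomogeneous H i j ∧ x.psi p₀ p₁ H =
      (Polynomial.C w * Polynomial.X - Polynomial.C g) * (Polynomial.C q * Polynomial.X ^ n) := by
  have hk := hf.two_le
  obtain ⟨j, rfl⟩ : ∃ j', j = j' + (n + 1) := ⟨j - (n + 1), by omega⟩
  have hcb := (isBihomogeneous_constForm x.c).pow j
  rcases le_or_gt (n + 1) (k - 1) with hnk | hnk
  · refine ⟨constForm x.c ^ j * (C (C c⁻¹ * q) * F (n + 1)),
      J.mul_mem_left _ (J.mul_mem_left _ (hF _ (by omega) hnk)), ?_, ?_⟩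
    · have := hcb.mul ((IsBihomogeneous.C (hq.C_mul c⁻¹)).mul (hs.bihom_F (n + 1) (by omega) hnk))
      rwa [zero_add, zero_add, show l + 2 * (k - (n + 1)) = i by omega] at this
    · have hcc : Polynomial.C (C c⁻¹) * Polynomial.C (C c) = (1 : Polynomial (PolyT K)) := by
        rw [← Polynomial.C_mul, ← C_mul, inv_mul_cancel₀ hs.c_ne_zero, C_1, Polynomial.C_1]
      simp only [map_mul, map_pow, Coordinates.psi_c, Coordinates.psi_C, one_pow,
        hs.psi_F (n + 1) (by omega) hnk, Nat.add_sub_cancel, one_mul]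
      linear_combination (Polynomial.C q * Polynomial.X ^ n *
        (Polynomial.C w * Polynomial.X - Polynomial.C g)) * hcc
  -- Here `q` has degree `i + 2e` with `i ≥ 1`, so `q Z^e` lifts to some `G` of positive `T`-degree.
  -- Writing `G = T₀ G₀ + T₁ G₁`, the factors `T₀, T₁` are replaced by the combinations of `L₀, L₁`
  -- that correspond to them.
  · obtain ⟨e, rfl⟩ : ∃ e, n = e + (k - 1) := ⟨n - (k - 1), by omega⟩
    obtain ⟨i, rfl⟩ := Nat.exists_eq_succ_of_ne_zero hi
    obtain ⟨G, hG, hGe⟩ := x.exists_psi_eq hf.hp₀ hf.hp₁ hf.hp (i := i + 1) (by omega)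
      (IsGraded.C_mul_X_pow (n := e) (by rwa [show i + 1 + 2 * e = l by omega]) :
        IsGraded (Polynomial.C q * Polynomial.X ^ e) (i + 1) e)
    obtain ⟨G₀, G₁, hG₀, hG₁, rfl⟩ := exists_coeffwise_decomposition (q₀ := X 0) (q₁ := X 1)
      (i' := i) (fun f hf => exists_eq_X_mul_add hf) hG
    obtain ⟨s₀, t₀, h₀⟩ := X_mem_span_of_independent hs.hl₀ hs.hl₁ hs.independent 0
    obtain ⟨s₁, t₁, h₁⟩ := X_mem_span_of_independent hs.hl₀ hs.hl₁ hs.independent 1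
    have hLb : ∀ s t : K, IsBihomogeneous (C (C s) * L₀ + C (C t) * L₁) 1 k := fun s t => by
      simpa using ((IsBihomogeneous.C (isHomogeneous_C _ s)).mul hs.bihom_L₀).add
        ((IsBihomogeneous.C (isHomogeneous_C _ t)).mul hs.bihom_L₁)
    refine ⟨constForm x.c ^ j * (G₀ * (C (C s₀) * L₀ + C (C t₀) * L₁) +
      G₁ * (C (C s₁) * L₀ + C (C t₁) * L₁)), ?_, ?_, ?_⟩
    · exact J.mul_mem_left _ (J.add_mem
        (J.mul_mem_left _ (J.add_mem (J.mul_mem_left _ hL₀) (J.mul_mem_left _ hL₁)))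
        (J.mul_mem_left _ (J.add_mem (J.mul_mem_left _ hL₀) (J.mul_mem_left _ hL₁))))
    · have := hcb.mul ((hG₀.mul (hLb s₀ t₀)).add (hG₁.mul (hLb s₁ t₁)))
      rwa [zero_add, show e + k = e + (k - 1) + 1 by omega] at this
    · have e₀ := congrArg Polynomial.C h₀
      have e₁ := congrArg Polynomial.C h₁
      simp only [map_add, map_mul, Coordinates.psi_C] at hGe e₀ e₁
      simp only [map_add, map_mul, map_pow, Coordinates.psi_c, Coordinates.psi_C, one_pow, one_mul,
        hs.psi_L₀, hs.psi_L₁, pow_add]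
      set W := Polynomial.C w * Polynomial.X - Polynomial.C g
      linear_combination (Polynomial.X ^ (k - 1) * W) * hGe -
        (x.psi p₀ p₁ G₀ * Polynomial.X ^ (k - 1) * W) * e₀ -
        (x.psi p₀ p₁ G₁ * Polynomial.X ^ (k - 1) * W) * e₁

/-- Lift the quotient term by term; what is left of `G` is killed by `psi`, hence a multiple of `P`.
-/
theorem mem_of_isBihomogeneous (hf : IsFrame x u k p₀ p₁ g w)
    (hs : SpecialValues x k p₀ p₁ g w P F L₀ L₁ c l₀ l₁) {J : Ideal (PolyTX K)} (hP : P ∈ J)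
    (hF : ∀ j, 1 ≤ j → j ≤ k - 1 → F j ∈ J) (hL₀ : L₀ ∈ J) (hL₁ : L₁ ∈ J) {i j : ℕ} (hi : i ≠ 0)
    {G : PolyTX K} (hG : IsBihomogeneous G i j) (hG0 : aeval u G = 0) : G ∈ J := by
  obtain ⟨A, hA⟩ := x.dvd_psi_of_aeval_eq_zero (p₀ := p₀) (p₁ := p₁) hf.w_ne_zero hf.hgw hf.hu
    hG.1 hG0
  have hw' : w.IsHomogeneous (2 * (k - 1) + 2) := by
    rw [show 2 * (k - 1) + 2 = 2 * k by have := hf.two_le; omega]; exact hf.hw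
  have hgr := x.isGraded_psi hf.hp₀ hf.hp₁ hG
  rw [hA] at hgr
  obtain ⟨hdeg, hco⟩ := coeff_of_isGraded_linear_mul hf.hg hf.g_ne_zero hw' hf.w_ne_zero hgr
  have hex : ∀ n, ∃ H ∈ J, IsBihomogeneous H i j ∧ x.psi p₀ p₁ H =
      (Polynomial.C w * Polynomial.X - Polynomial.C g) *
        (Polynomial.C (A.coeff n) * Polynomial.X ^ n) := by
    intro n
    rcases hco n with h0 | ⟨l, hl, hq⟩
    · exact ⟨0, J.zero_mem, .zero _ _, by simp [h0]⟩
    · by_cases h0 : A.coeff n = 0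
      · exact ⟨0, J.zero_mem, .zero _ _, by simp [h0]⟩
      · refine exists_psi_eq_coeff hf hs hF hL₀ hL₁ hi ?_ hl hq
        have h1 := hdeg (by rintro rfl; simp at h0)
        have h2 := Polynomial.le_natDegree_of_ne_zero h0
        omega
  choose H hHJ hHb hHe using hex
  have hsum : x.psi p₀ p₁ (G - ∑ n ∈ Finset.range (A.natDegree + 1), H n) = 0 := by
    rw [map_sub, map_sum, hA, Finset.sum_congr rfl fun n _ => hHe n, ← Finset.mul_sum,
      ← A.as_sum_range_C_mul_X_pow, sub_self]
  have hdvd := x.dvd_of_psi_eq_zero hf.hp hf.p₁_ne_zero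
    (hG.sub (IsBihomogeneous.sum fun n _ => hHb n)).1 hsum
  rw [← hs.P_eq] at hdvd
  have hmem := J.add_mem (J.mem_of_dvd hdvd hP)
    (J.sum_mem fun n (_ : n ∈ Finset.range (A.natDegree + 1)) => hHJ n)
  rwa [sub_add_cancel] at hmem

theorem exists_eq_ofX {G : PolyTX K} {j : ℕ} (hG : IsBihomogeneous G 0 j) :
    ∃ f : PolyX K, f.IsHomogeneous j ∧ G = ofX f := by
  refine ⟨mapCoeff (constantCoeff (R := K) (σ := Fin 2)).toAddMonoidHom G,
    isHomogeneous_mapCoeff _ hG.1, ?_⟩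
  ext1 m
  rw [coeff_ofX, coeff_mapCoeff]
  obtain ⟨e, he⟩ := exists_eq_C_of_isHomogeneous_zero (hG.2 m)
  rw [he]
  simp

theorem span_specialSet_eq [IsAlgClosed K] (hf : IsFrame x u k p₀ p₁ g w)
    (hs : SpecialValues x k p₀ p₁ g w P F L₀ L₁ c l₀ l₁) (hdeg : ∀ i, (u i).IsHomogeneous (2 * k))
    (hE : IsImplicitEquation u E) :
    Ideal.span (specialSet k E P F L₀ L₁) = definingIdeal u := by
  have hk := hf.two_le
  set S := specialSet k E P F L₀ L₁ with hS
  apply le_antisymm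
  · rw [Ideal.span_le]
    have key : ∀ (G : PolyTX K) (j : ℕ), G.IsHomogeneous j →
        Polynomial.C w * Polynomial.X - Polynomial.C g ∣ x.psi p₀ p₁ G → G ∈ definingIdeal u :=
      fun G j hG hd => mem_definingIdeal_of_isHomogeneous hG
        (x.aeval_eq_zero_of_dvd_psi hf.w_ne_zero hf.hu hG hd)
    rintro G ((rfl | rfl | rfl | rfl) | ⟨j, ⟨hj, hjk⟩, rfl⟩)
    · obtain ⟨D, hD⟩ := hE.exists_isHomogeneous hdeg (by omega)
      exact mem_definingIdeal_of_isHomogeneous (IsBihomogeneous.ofX hD).1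
        (by rw [aeval_ofX, hE.aeval_eq_zero])
    · exact key _ _ hs.bihom_L₀.1 (hs.psi_L₀ ▸ dvd_mul_left _ _)
    · exact key _ _ hs.bihom_L₁.1 (hs.psi_L₁ ▸ dvd_mul_left _ _)
    · rw [hs.P_eq]
      exact key _ _ (isHomogeneous_P a b hf.hp₀ hf.hp₁).1 (x.psi_relation _ _ ▸ dvd_zero _)
    · exact key _ _ (hs.bihom_F j hj hjk).1 (hs.psi_F j hj hjk ▸ dvd_mul_left _ _)
  · have hE' : ofX E ∈ Ideal.span S := Ideal.subset_span (by simp [hS, specialSet])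
    refine definingIdeal_le hdeg fun i j G hG hG0 => ?_
    rcases eq_or_ne i 0 with rfl | hi
    · obtain ⟨f, hfh, rfl⟩ := exists_eq_ofX hG
      rw [aeval_ofX] at hG0
      exact Ideal.mem_of_dvd _ (map_dvd ofX (hE.dvd hfh hG0)) hE'
    · exact mem_of_isBihomogeneous hf hs (Ideal.subset_span (by simp [hS, specialSet]))
        (fun j h h' => Ideal.subset_span (Or.inr ⟨j, ⟨h, h'⟩, rfl⟩))
        (Ideal.subset_span (by simp [hS, specialSet])) (Ideal.subset_span (by simp [hS, specialSet]))
        hi hG hG0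

end Generation

theorem isMinimalGeneratingSet_range {R ι : Type*} [CommRing R] [Finite ι] {J : Ideal R} (f : ι → R)
    (hspan : Ideal.span (Set.range f) = J)
    (h : ∀ i, f i ∉ Ideal.span (f '' {i}ᶜ)) :
    IsMinimalGeneratingSet J (Set.range f) ∧ (Set.range f).ncard = Nat.card ι := by
  refine ⟨⟨hspan, fun S hS hSJ => ?_⟩, ?_⟩
  · obtain ⟨hsub, hne⟩ := Set.ssubset_iff_subset_ne.1 hS
    obtain ⟨_, ⟨i, rfl⟩, hi⟩ := Set.exists_of_ssubset hS
    refine h i (Ideal.span_mono (s := S) ?_ ?_)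
    · intro s hs
      obtain ⟨l, rfl⟩ := hsub hs
      exact ⟨l, fun hl => hi (by rwa [← (Set.mem_singleton_iff.1 hl)]), rfl⟩
    · rw [hSJ, ← hspan]
      exact Ideal.subset_span ⟨i, rfl⟩
  · have hinj : Function.Injective f := by
      intro i l hil
      by_contra hne
      exact h i (Ideal.subset_span ⟨l, fun hl => hne hl.symm, hil.symm⟩)
    rw [← Set.image_univ, Set.ncard_image_of_injective _ hinj, Set.ncard_univ]

theorem exists_sum_eq_of_mem_span_image_compl {R ι : Type*} [CommRing R] [Fintype ι] {f : ι → R} {i : ι}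
    {G : R} (h : G ∈ Ideal.span (f '' {i}ᶜ)) : ∃ q : ι → R, q i = 0 ∧ ∑ l, q l * f l = G := by
  classical
  have hsub : f '' {i}ᶜ ⊆ Set.range (fun l => if l = i then 0 else f l) := by
    rintro _ ⟨l, hl, rfl⟩
    exact ⟨l, if_neg hl⟩
  obtain ⟨q, hq⟩ := Ideal.mem_span_range_iff_exists_fun.1 (Ideal.span_mono hsub h)
  refine ⟨fun l => if l = i then 0 else q l, if_pos rfl, ?_⟩
  rw [← hq]
  exact Finset.sum_congr rfl fun l _ => by by_cases hl : l = i <;> simp [hl]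

/-! ### Coefficients of `psi G` modulo `(p₀, p₁)`, and of `psi` on `𝕂[X]`. -/

namespace Coordinates

variable {a b : Fin 3 → K} (x : Coordinates a b) {p₀ p₁ : PolyT K}

/-- Modulo `(p₀, p₁)` the substituted point no longer involves `Z`. -/
theorem coeff_psi_mem (p₀ p₁ : PolyT K) (G : PolyTX K) {n : ℕ} (hn : n ≠ 0) :
    (x.psi p₀ p₁ G).coeff n ∈ Ideal.span {p₀, p₁} := by
  set I := Ideal.span {p₀, p₁}
  have h₀ : Ideal.Quotient.mk I p₀ = 0 :=
    Ideal.Quotient.eq_zero_iff_mem.2 (Ideal.subset_span (by simp))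
  have h₁ : Ideal.Quotient.mk I p₁ = 0 :=
    Ideal.Quotient.eq_zero_iff_mem.2 (Ideal.subset_span (by simp))
  have key : (Polynomial.mapRingHom (Ideal.Quotient.mk I)).comp (x.psi p₀ p₁).toRingHom =
      Polynomial.C.comp ((Ideal.Quotient.mk I).comp (eval fun i => C (x.N i 2))) := by
    apply MvPolynomial.ringHom_ext
    · intro r
      simp
    · intro i
      have hC : ∀ e : K, algebraMap K (Polynomial (PolyT K)) e = Polynomial.C (C e) := fun _ => rfl
      simp [psi, point, Fin.sum_univ_three, h₀, h₁, hC]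
  have h2 := congrArg (fun f => Polynomial.coeff f n) (DFunLike.congr_fun key G)
  simp [Polynomial.coeff_C, hn] at h2
  exact Ideal.Quotient.eq_zero_iff_mem.1 h2

theorem homogeneousComponent_coeff_psi (h₀ : p₀.IsHomogeneous 2) (h₁ : p₁.IsHomogeneous 2)
    (G : PolyTX K) {n l : ℕ} (hn : n ≠ 0) (hl : l < 2) :
    homogeneousComponent l ((x.psi p₀ p₁ G).coeff n) = 0 := by
  obtain ⟨y, z, h⟩ := Ideal.mem_span_pair.1 (x.coeff_psi_mem p₀ p₁ G hn)
  rw [← h, map_add, homogeneousComponent_mul_of_isHomogeneous_of_lt h₀ y hl,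
    homogeneousComponent_mul_of_isHomogeneous_of_lt h₁ z hl, add_zero]

/-- Each factor `Z` arrives with one of `p₀, p₁`, and elements of `𝕂[X]` bring no other `T`. -/
theorem exists_coeff_psi_ofX (p₀ p₁ : PolyT K) (f : PolyX K) (n : ℕ) :
    ∃ q : PolyT K, q.IsHomogeneous n ∧ (x.psi p₀ p₁ (ofX f)).coeff n = aeval ![p₀, p₁] q := by
  induction f using MvPolynomial.induction_on generalizing n with
  | C e =>
    rw [ofX_C, psi_C, Polynomial.coeff_C]
    split_ifs with hn
    · exact ⟨C e, hn ▸ isHomogeneous_C _ _, by simp⟩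
    · exact ⟨0, isHomogeneous_zero _ _ _, by simp⟩
  | add f f' hf hf' =>
    obtain ⟨q, hq, e⟩ := hf n
    obtain ⟨q', hq', e'⟩ := hf' n
    exact ⟨q + q', hq.add hq', by rw [map_add, map_add, Polynomial.coeff_add, e, e', map_add]⟩
  | mul_X f i hf =>
    choose q hq e using hf
    have hX : x.psi p₀ p₁ (ofX (X i)) =
        Polynomial.C (C (x.N i 0) * p₀ + C (x.N i 1) * p₁) * Polynomial.X +
          Polynomial.C (C (x.N i 2)) := by
      have hC : ∀ e : K, algebraMap K (Polynomial (PolyT K)) e = Polynomial.C (C e) := fun _ => rfl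
      simp [ofX, psi, point, Fin.sum_univ_three, hC]
      ring
    rw [map_mul, map_mul, hX, mul_add, Polynomial.coeff_add, Polynomial.coeff_mul_C, ← mul_assoc]
    rcases n with _ | n
    · exact ⟨q 0 * C (x.N i 2), by simpa using (hq 0).mul (isHomogeneous_C _ _), by simp [e]⟩
    · refine ⟨q n * (C (x.N i 0) * X 0 + C (x.N i 1) * X 1) + q (n + 1) * C (x.N i 2), ?_, ?_⟩
      · exact ((hq n).mul (isHomogeneous_linear _ _)).add
          (by simpa using (hq (n + 1)).mul (isHomogeneous_C _ (x.N i 2)))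
      · rw [Polynomial.coeff_mul_X, Polynomial.coeff_mul_C, e, e]
        simp

end Coordinates

/-! ### The degree of the curve exceeds `k`. -/

section Minimality

variable {a b : Fin 3 → K} {x : Coordinates a b} {u : Fin 3 → PolyT K} {k : ℕ}
  {p₀ p₁ g w : PolyT K} {P : PolyTX K} {F : ℕ → PolyTX K} {L₀ L₁ : PolyTX K} {c : K}
  {l₀ l₁ : PolyT K} {E : PolyX K}

/-- Setting `T = 0`. -/
theorem map_constantCoeff_ofX (f : PolyX K) : map (constantCoeff (σ := Fin 2)) (ofX f) = f := by
  rw [ofX, map_map]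
  have : (constantCoeff (σ := Fin 2)).comp C = RingHom.id K := by ext; simp
  rw [this, map_id]

theorem constantCoeff_eq_zero_of_isHomogeneous {σ R : Type*} [CommSemiring R] {f : MvPolynomial σ R}
    {n : ℕ} (hf : f.IsHomogeneous n) (hn : n ≠ 0) : constantCoeff f = 0 := by
  rw [constantCoeff_eq]
  exact hf.coeff_eq_zero (by simpa using hn.symm)

theorem map_constantCoeff_eq_zero {G : PolyTX K} {i j : ℕ} (hG : IsBihomogeneous G i j) (hi : i ≠ 0) :
    map (constantCoeff (σ := Fin 2)) G = 0 := by
  ext1 m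
  rw [coeff_map, constantCoeff_eq_zero_of_isHomogeneous (hG.2 m) hi, coeff_zero]

/-- A properly parametrizing triple does not factor through a pair of quadrics. -/
theorem not_forall_eq_aeval (hproper : IsProperParametrization u) (h₀ : p₀.IsHomogeneous 2)
    (h₁ : p₁.IsHomogeneous 2) (h : IsRelPrime p₀ p₁) {U : Fin 3 → PolyT K}
    (hU : ∀ i, (U i).IsHomogeneous k) (he : ∀ i, u i = aeval ![p₀, p₁] (U i)) : False := by
  obtain ⟨l, A, B, hA, hB, hne, hAB⟩ := hproper
  have hcomp : ∀ f : PolyX K, aeval u f = aeval ![p₀, p₁] (aeval U f) := by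
    intro f
    rw [← AlgHom.comp_apply, comp_aeval, show u = fun i => aeval ![p₀, p₁] (U i) from funext he]
  -- The inversion identity `T₁ A(u) - T₀ B(u) = 0` is a relation between `T₁` and `T₀` over `𝕂[p₀,
  -- p₁]`.
  have key := eq_zero_of_sum_aeval_mul_monomials_eq_zero two_ne_zero h₀ h₁ h (n := k * l)
    (c := ![aeval U A, -aeval U B])
    (by intro i; fin_cases i; exacts [hA.aeval _ hU, (hB.aeval _ hU).neg])
    (by
      rw [Fin.sum_univ_two]
      simp only [Matrix.cons_val_zero, Matrix.cons_val_one, map_neg, ← hcomp, Fin.val_zero,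
        Fin.val_one, pow_zero, pow_one, Nat.add_one_sub_one, Nat.sub_self]
      linear_combination hAB)
  have k0 : aeval U A = 0 := key 0
  have k1 : -aeval U B = 0 := key 1
  rw [neg_eq_zero] at k1
  rw [hcomp, hcomp, k0, k1] at hne
  simp at hne

/-- If `A` were zero, `P` would divide `E`; but `P` vanishes at `T = 0`, where `E` is unchanged. -/
theorem psi_implicitEquation (hf : IsFrame x u k p₀ p₁ g w) {D : ℕ} (hD : E.IsHomogeneous D)
    (hE0 : E ≠ 0) (hE : aeval u E = 0) :
    ∃ A : Polynomial (PolyT K), A ≠ 0 ∧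
      x.psi p₀ p₁ (ofX E) = (Polynomial.C w * Polynomial.X - Polynomial.C g) * A ∧
      A.natDegree + 1 ≤ D ∧
      ∀ n, A.coeff n = 0 ∨ ∃ l, l + 2 * (k - 1) = 0 + 2 * n ∧ (A.coeff n).IsHomogeneous l := by
  have hb := IsBihomogeneous.ofX hD
  obtain ⟨A, hA⟩ := x.dvd_psi_of_aeval_eq_zero (p₀ := p₀) (p₁ := p₁) hf.w_ne_zero hf.hgw hf.hu
    hb.1 (by rw [aeval_ofX, hE])
  have hw' : w.IsHomogeneous (2 * (k - 1) + 2) := by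
    rw [show 2 * (k - 1) + 2 = 2 * k by have := hf.two_le; omega]; exact hf.hw
  have hgr := x.isGraded_psi hf.hp₀ hf.hp₁ hb
  rw [hA] at hgr
  obtain ⟨hdeg, hco⟩ := coeff_of_isGraded_linear_mul hf.hg hf.g_ne_zero hw' hf.w_ne_zero hgr
  have hA0 : A ≠ 0 := by
    rintro rfl
    rw [mul_zero] at hA
    obtain ⟨H, hH⟩ := x.dvd_of_psi_eq_zero hf.hp hf.p₁_ne_zero hb.1 hA
    apply hE0
    rw [← map_constantCoeff_ofX E, hH, map_mul,
      map_constantCoeff_eq_zero (isHomogeneous_P a b hf.hp₀ hf.hp₁) two_ne_zero, zero_mul]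
  exact ⟨A, hA0, hA, hdeg hA0, hco⟩

/-- A nonzero coefficient of `Zⁿ` in the quotient has degree `2n - 2(k-1)`, so `n ≥ k - 1` and `D ≥
k`. If `D = k`, the quotient is `α Z^(k-1)` with `α` constant, so `-α g` and `α w` are coefficients
of `psi E` and lie in `𝕂[p₀, p₁]`; then `u` factors through `(p₀, p₁)`. -/
theorem lt_degree_implicitEquation (hf : IsFrame x u k p₀ p₁ g w)
    (hproper : IsProperParametrization u) {D : ℕ} (hD : E.IsHomogeneous D)
    (hE0 : E ≠ 0) (hE : aeval u E = 0) : k < D := by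
  obtain ⟨A, hA0, hA, hdeg, hco⟩ := psi_implicitEquation hf hD hE0 hE
  have hk := hf.two_le
  obtain ⟨l, hl, -⟩ := (hco A.natDegree).resolve_left (by simpa using hA0)
  by_contra hlt
  have hnat : A.natDegree = k - 1 := by omega
  have hAm : A = Polynomial.C (A.coeff (k - 1)) * Polynomial.X ^ (k - 1) := by
    ext1 n
    rw [Polynomial.coeff_C_mul_X_pow]
    split_ifs with hn
    · rw [hn]
    · rcases lt_or_gt_of_ne hn with hn | hn
      · exact (hco n).resolve_right (by rintro ⟨l, hl, -⟩; omega)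
      · exact Polynomial.coeff_eq_zero_of_natDegree_lt (by omega)
  have hα0 : A.coeff (k - 1) ≠ 0 := by
    rw [← hnat]; simpa using hA0
  obtain ⟨l, hl, hαl⟩ := (hco (k - 1)).resolve_left hα0
  rw [show l = 0 by omega] at hαl
  obtain ⟨α, hα⟩ := exists_eq_C_of_isHomogeneous_zero hαl
  have hα' : α ≠ 0 := by rintro rfl; exact hα0 (by rw [hα, C_0])
  have hCα : C α⁻¹ * C α = (1 : PolyT K) := by rw [← C_mul, inv_mul_cancel₀ hα', C_1]
  have hpsi : x.psi p₀ p₁ (ofX E) = Polynomial.C (w * C α) * Polynomial.X ^ (k - 1 + 1) -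
      Polynomial.C (g * C α) * Polynomial.X ^ (k - 1) := by
    rw [hA, hAm, hα, Polynomial.C_mul, Polynomial.C_mul]; ring
  obtain ⟨q, hq, hqe⟩ := x.exists_coeff_psi_ofX p₀ p₁ E (k - 1)
  obtain ⟨r, hr, hre⟩ := x.exists_coeff_psi_ofX p₀ p₁ E k
  rw [hpsi] at hqe hre
  simp only [Polynomial.coeff_sub, Polynomial.coeff_C_mul_X_pow] at hqe hre
  rw [if_neg (by omega), if_true] at hqe
  rw [if_pos (by omega), if_neg (by omega)] at hre
  refine not_forall_eq_aeval hproper hf.hp₀ hf.hp₁ hf.hp (k := k)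
    (U := fun i => x.point ![-(C α⁻¹ * q) * X 0, -(C α⁻¹ * q) * X 1, C α⁻¹ * r] i) ?_ ?_
  · intro i
    refine IsHomogeneous.sum _ _ _ fun j _ => IsHomogeneous.C_mul ?_ _
    have h1 : ∀ i : Fin 2, (-(C α⁻¹ * q) * X i).IsHomogeneous k := fun i => by
      have := (hq.C_mul α⁻¹).neg.mul (isHomogeneous_X K i)
      rwa [show k - 1 + 1 = k by omega] at this
    fin_cases j
    · exact h1 0
    · exact h1 1
    · exact hr.C_mul _
  · intro i
    rw [hf.hu, x.map_point]
    congr 1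
    funext j
    fin_cases j
    · change g * p₀ = aeval ![p₀, p₁] (-(C α⁻¹ * q) * X 0)
      rw [map_mul, map_neg, map_mul, ← hqe, aeval_X, aeval_C, algebraMap_eq]
      change g * p₀ = -(C α⁻¹ * (0 - g * C α)) * p₀
      linear_combination (-g * p₀) * hCα
    · change g * p₁ = aeval ![p₀, p₁] (-(C α⁻¹ * q) * X 1)
      rw [map_mul, map_neg, map_mul, ← hqe, aeval_X, aeval_C, algebraMap_eq]
      change g * p₁ = -(C α⁻¹ * (0 - g * C α)) * p₁
      linear_combination (-g * p₁) * hCα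
    · change w = aeval ![p₀, p₁] (C α⁻¹ * r)
      rw [map_mul, ← hre, aeval_C, algebraMap_eq]
      linear_combination (-w) * hCα

end Minimality

/-! ### No special element is a combination of the others. -/

section Minimality

variable {a b : Fin 3 → K} {x : Coordinates a b} {u : Fin 3 → PolyT K} {k : ℕ}
  {p₀ p₁ g w : PolyT K} {P : PolyTX K} {F : ℕ → PolyTX K} {L₀ L₁ : PolyTX K} {c : K}
  {l₀ l₁ : PolyT K} {E : PolyX K}

theorem SpecialValues.swap (hs : SpecialValues x k p₀ p₁ g w P F L₀ L₁ c l₀ l₁) :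
    SpecialValues x k p₀ p₁ g w P F L₁ L₀ c l₁ l₀ :=
  { hs with
    hl₀ := hs.hl₁
    hl₁ := hs.hl₀
    independent := fun s t h => (hs.independent t s (by rw [add_comm]; exact h)).symm
    bihom_L₀ := hs.bihom_L₁
    bihom_L₁ := hs.bihom_L₀
    psi_L₀ := hs.psi_L₁
    psi_L₁ := hs.psi_L₀ }

theorem SpecialValues.bihom_P (hf : IsFrame x u k p₀ p₁ g w)
    (hs : SpecialValues x k p₀ p₁ g w P F L₀ L₁ c l₀ l₁) : IsBihomogeneous P 2 1 :=
  hs.P_eq ▸ isHomogeneous_P a b hf.hp₀ hf.hp₁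

theorem SpecialValues.psi_P (hs : SpecialValues x k p₀ p₁ g w P F L₀ L₁ c l₀ l₁) :
    x.psi p₀ p₁ P = 0 := hs.P_eq ▸ x.psi_relation p₀ p₁

/-- Setting `T = 0` kills every generator except `E`. -/
theorem implicitEquation_ne_combination (hf : IsFrame x u k p₀ p₁ g w)
    (hs : SpecialValues x k p₀ p₁ g w P F L₀ L₁ c l₀ l₁) (hE0 : E ≠ 0) (s₀ s₁ t : PolyTX K)
    (r : Fin (k - 1) → PolyTX K) :
    s₀ * L₀ + s₁ * L₁ + t * P + ∑ j : Fin (k - 1), r j * F (j + 1) ≠ ofX E := by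
  intro h
  have h1 := congrArg (map (constantCoeff (σ := Fin 2))) h
  rw [map_constantCoeff_ofX] at h1
  apply hE0
  rw [← h1]
  simp only [map_add, map_mul, map_sum, map_constantCoeff_eq_zero hs.bihom_L₀ one_ne_zero,
    map_constantCoeff_eq_zero hs.bihom_L₁ one_ne_zero,
    map_constantCoeff_eq_zero (hs.bihom_P hf) two_ne_zero, mul_zero, add_zero, zero_add]
  refine Finset.sum_eq_zero fun j _ => ?_
  rw [map_constantCoeff_eq_zero (hs.bihom_F _ (by omega) (by omega)) (by omega), mul_zero]

theorem mul_linear_injective (hf : IsFrame x u k p₀ p₁ g w) :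
    Function.Injective (fun A : Polynomial (PolyT K) =>
      A * (Polynomial.C w * Polynomial.X - Polynomial.C g)) := by
  have hW : Polynomial.C w * Polynomial.X - Polynomial.C g ≠ 0 := by
    intro h0
    have := congrArg (fun f => Polynomial.coeff f 0) h0
    simp at this
    exact hf.g_ne_zero this
  exact mul_left_injective₀ hW

/-- Divide images by `w Z - g`, set `T = 0` and compare coefficients of `Zⁱ`. The multipliers become
constants in `Z`, the linear forms `l₀, l₁` vanish, and so does the coefficient from `E`, since `i <
k - 1`. Only `r i = 0` could produce `c Zⁱ`. -/
theorem F_ne_combination (hf : IsFrame x u k p₀ p₁ g w)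
    (hs : SpecialValues x k p₀ p₁ g w P F L₀ L₁ c l₀ l₁) {D : ℕ} (hD : E.IsHomogeneous D)
    (hE0 : E ≠ 0) (hE : aeval u E = 0) (e s₀ s₁ t : PolyTX K)
    (r : Fin (k - 1) → PolyTX K) (i : Fin (k - 1)) (hi : r i = 0) :
    e * ofX E + s₀ * L₀ + s₁ * L₁ + t * P + ∑ j : Fin (k - 1), r j * F (j + 1) ≠ F (i + 1) := by
  intro h
  obtain ⟨A, hA0, hA, -, hco⟩ := psi_implicitEquation hf hD hE0 hE
  have h1 := congrArg (x.psi p₀ p₁) h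
  have hpsiF : ∀ j : Fin (k - 1), x.psi p₀ p₁ (F (j + 1)) = (Polynomial.C (C c) *
      Polynomial.X ^ (j : ℕ)) * (Polynomial.C w * Polynomial.X - Polynomial.C g) := fun j => by
    rw [hs.psi_F _ (by omega) (by omega), Nat.add_sub_cancel]
  simp only [map_add, map_mul, map_sum, hA, hs.psi_L₀, hs.psi_L₁, hs.psi_P, hpsiF] at h1
  have h2 : x.psi p₀ p₁ e * A + x.psi p₀ p₁ s₀ * (Polynomial.C l₀ * Polynomial.X ^ (k - 1)) +
      x.psi p₀ p₁ s₁ * (Polynomial.C l₁ * Polynomial.X ^ (k - 1)) +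
      ∑ j : Fin (k - 1), x.psi p₀ p₁ (r j) * (Polynomial.C (C c) * Polynomial.X ^ (j : ℕ)) =
      Polynomial.C (C c) * Polynomial.X ^ (i : ℕ) := by
    apply mul_linear_injective hf
    simp only [add_mul, Finset.sum_mul]
    rw [← h1]
    simp only [mul_assoc, mul_zero, add_zero]
    ring
  have h3 := congrArg (fun f => (Polynomial.map (constantCoeff (σ := Fin 2) (R := K)) f).coeff i) h2
  have hconst : ∀ G, ∃ ρ : K, Polynomial.map (constantCoeff (σ := Fin 2) (R := K)) (x.psi p₀ p₁ G) =
      Polynomial.C ρ := fun G => by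
    refine ⟨constantCoeff ((x.psi p₀ p₁ G).coeff 0), ?_⟩
    ext1 n
    rw [Polynomial.coeff_map, Polynomial.coeff_C]
    split_ifs with hn
    · rw [hn]
    · have := x.homogeneousComponent_coeff_psi hf.hp₀ hf.hp₁ G hn two_pos
      rw [homogeneousComponent_zero, C_eq_zero] at this
      exact this
  choose ρ hρ using hconst
  have hAi : constantCoeff (A.coeff i) = 0 := by
    rcases hco i with h0 | ⟨l, hl, -⟩
    · rw [h0, map_zero]
    · omega
  simp only [Polynomial.map_add, Polynomial.map_mul, Polynomial.map_sum, Polynomial.map_pow,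
    Polynomial.map_C, Polynomial.map_X, hρ, constantCoeff_C, Polynomial.coeff_add,
    Polynomial.finsetSum_coeff, Polynomial.coeff_C_mul, Polynomial.coeff_X_pow,
    Polynomial.coeff_map, hAi, constantCoeff_eq_zero_of_isHomogeneous hs.hl₀ one_ne_zero,
    constantCoeff_eq_zero_of_isHomogeneous hs.hl₁ one_ne_zero, if_true] at h3
  rw [Finset.sum_eq_zero] at h3
  · simp at h3
    exact hs.c_ne_zero h3.symm
  · intro j _
    rcases eq_or_ne j i with rfl | hj
    · have h0 := hρ (r j)
      rw [hi, map_zero, Polynomial.map_zero] at h0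
      rw [hi, Polynomial.C_eq_zero.1 h0.symm, zero_mul]
    · rw [if_neg (fun h => hj (Fin.ext h.symm)), mul_zero, mul_zero]

theorem homogeneousComponent_combination {n : ℕ} {ι : Type*} [Fintype ι] {f : ι → PolyTX K}
    {d : ι → ℕ} (hfd : ∀ i, (f i).IsHomogeneous (d i)) (q : ι → PolyTX K) :
    homogeneousComponent n (∑ i, q i * f i) =
      ∑ i, (if d i ≤ n then homogeneousComponent (n - d i) (q i) else 0) * f i := by
  rw [map_sum]
  refine Finset.sum_congr rfl fun i _ => ?_
  split_ifs with h
  · rw [← homogeneousComponent_mul_of_isHomogeneous (hfd i), Nat.sub_add_cancel h]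
  · rw [homogeneousComponent_mul_of_isHomogeneous_of_lt (hfd i) _ (not_le.1 h), zero_mul]

/-- In `X`-degree `k` the equation `E` does not contribute, as `D > k`. After division by `w Z - g`,
take the `T`-linear part of the coefficient of `Z^(k-1)`: the multiplier of each `F` enters through
a positive power of `Z`, whose coefficient lies in `(p₀, p₁)` and has no part of degree below `2`.
So `l₀` would be a scalar multiple of `l₁`. -/
theorem L_ne_combination (hf : IsFrame x u k p₀ p₁ g w)
    (hs : SpecialValues x k p₀ p₁ g w P F L₀ L₁ c l₀ l₁) {D : ℕ} (hD : E.IsHomogeneous D)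
    (hkD : k < D) (e s₁ t : PolyTX K) (r : Fin (k - 1) → PolyTX K) :
    e * ofX E + s₁ * L₁ + t * P + ∑ j : Fin (k - 1), r j * F (j + 1) ≠ L₀ := by
  intro h
  have hk := hf.two_le
  have h0 := congrArg (homogeneousComponent k) h
  have hFh : ∀ j : Fin (k - 1), (F (j + 1)).IsHomogeneous ((j : ℕ) + 1) := fun j =>
    (hs.bihom_F _ (by omega) (by omega)).1
  rw [map_add, map_add, map_add, homogeneousComponent_eq_self hs.bihom_L₀.1,
    homogeneousComponent_mul_of_isHomogeneous_of_lt (IsBihomogeneous.ofX hD).1 _ hkD,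
    homogeneousComponent_combination hFh] at h0
  nth_rewrite 1 [← zero_add k] at h0
  rw [homogeneousComponent_mul_of_isHomogeneous hs.bihom_L₁.1] at h0
  obtain ⟨k', rfl⟩ : ∃ k', k = k' + 1 := ⟨k - 1, by omega⟩
  rw [homogeneousComponent_mul_of_isHomogeneous (hs.bihom_P hf).1] at h0
  set s := homogeneousComponent 0 s₁
  have h1 := congrArg (x.psi p₀ p₁) h0
  have hpsiF : ∀ j : Fin k', x.psi p₀ p₁ (F (j + 1)) = (Polynomial.C (C c) *
      Polynomial.X ^ (j : ℕ)) * (Polynomial.C w * Polynomial.X - Polynomial.C g) := fun j => by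
    rw [hs.psi_F _ (by omega) (by omega), Nat.add_sub_cancel]
  simp only [map_add, map_mul, map_sum, hs.psi_L₀, hs.psi_L₁, hs.psi_P, hpsiF] at h1
  set r' : Fin k' → PolyTX K := fun j =>
    if (j : ℕ) + 1 ≤ k' + 1 then homogeneousComponent (k' + 1 - ((j : ℕ) + 1)) (r j) else 0
  have h2 : x.psi p₀ p₁ s * (Polynomial.C l₁ * Polynomial.X ^ k') +
      ∑ j : Fin k', x.psi p₀ p₁ (r' j) * (Polynomial.C (C c) * Polynomial.X ^ (j : ℕ)) =
      Polynomial.C l₀ * Polynomial.X ^ k' := by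
    apply mul_linear_injective hf
    simp only [add_mul, Finset.sum_mul]
    simp only [mul_zero, add_zero, map_zero, zero_add, Nat.add_sub_cancel] at h1
    rw [← h1]
    simp only [mul_assoc]
    rfl
  have h3 := congrArg (fun f => homogeneousComponent 1 (Polynomial.coeff f k')) h2
  simp only [Polynomial.coeff_add, ← mul_assoc, Polynomial.coeff_mul_X_pow', le_refl, if_true,
    Nat.sub_self, Polynomial.coeff_mul_C, Polynomial.finsetSum_coeff, map_add, map_sum,
    Polynomial.coeff_C_zero] at h3
  rw [Finset.sum_eq_zero, add_zero, homogeneousComponent_eq_self hs.hl₀,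
    homogeneousComponent_mul_of_isHomogeneous (k := 0) hs.hl₁, homogeneousComponent_zero] at h3
  · have := (hs.independent 1 (-coeff 0 ((x.psi p₀ p₁ s).coeff 0)) (by
      rw [C_1, C_neg]; linear_combination -h3)).1
    exact one_ne_zero this
  · intro j _
    have hj := j.2
    rw [if_pos (by omega), homogeneousComponent_mul_of_isHomogeneous (k := 1) (n := 0)
      (isHomogeneous_C _ _),
      x.homogeneousComponent_coeff_psi hf.hp₀ hf.hp₁ _ (by omega) one_lt_two, zero_mul]

/-- In `X`-degree `1` only `F 1` survives, and it is independent of `P`. -/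
theorem P_ne_combination (hk : 3 ≤ k) (hf : IsFrame x u k p₀ p₁ g w)
    (hs : SpecialValues x k p₀ p₁ g w P F L₀ L₁ c l₀ l₁) {D : ℕ} (hD : E.IsHomogeneous D)
    (hkD : k < D) (hmu : IsMuBasis u 2 (2 * (k - 1)) P (F 1)) (e s₀ s₁ : PolyTX K)
    (r : Fin (k - 1) → PolyTX K) :
    e * ofX E + s₀ * L₀ + s₁ * L₁ + ∑ j : Fin (k - 1), r j * F (j + 1) ≠ P := by
  intro h
  have h0 := congrArg (homogeneousComponent 1) h
  have hFh : ∀ j : Fin (k - 1), (F (j + 1)).IsHomogeneous ((j : ℕ) + 1) := fun j =>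
    (hs.bihom_F _ (by omega) (by omega)).1
  rw [map_add, map_add, map_add, homogeneousComponent_eq_self (hs.bihom_P hf).1,
    homogeneousComponent_mul_of_isHomogeneous_of_lt (IsBihomogeneous.ofX hD).1 _ (by omega),
    homogeneousComponent_mul_of_isHomogeneous_of_lt hs.bihom_L₀.1 _ (by omega),
    homogeneousComponent_mul_of_isHomogeneous_of_lt hs.bihom_L₁.1 _ (by omega),
    homogeneousComponent_combination hFh,
    Finset.sum_eq_single (⟨0, by omega⟩ : Fin (k - 1))] at h0
  · obtain ⟨s, t, hPs, hFt, -, -, hli, -⟩ := hmu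
    simp only [zero_add, le_refl, if_true] at h0
    rw [hFt, hPs] at h0
    obtain ⟨q, hq⟩ := eq_smul_of_linForm_dvd ⟨_, h0.symm.trans (mul_comm _ _)⟩
    have := (LinearIndependent.pair_iff.1 hli) 1 (-q) (by rw [hq]; simp)
    simp at this
  · intro j _ hj
    have : (j : ℕ) ≠ 0 := fun h => hj (Fin.ext h)
    rw [if_neg (by omega), zero_mul]
  · simp

theorem specialSet_isMinimalGeneratingSet [IsAlgClosed K] (hk : 3 ≤ k)
    (hdeg : ∀ i, (u i).IsHomogeneous (2 * k)) (hproper : IsProperParametrization u)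
    (hE : IsImplicitEquation u E) (hf : IsFrame x u k p₀ p₁ g w)
    (hs : SpecialValues x k p₀ p₁ g w P F L₀ L₁ c l₀ l₁)
    (hmu : IsMuBasis u 2 (2 * (k - 1)) P (F 1)) :
    IsMinimalGeneratingSet (definingIdeal u) (specialSet k E P F L₀ L₁) ∧
      (specialSet k E P F L₀ L₁).ncard = k + 3 := by
  obtain ⟨D, hD⟩ := hE.exists_isHomogeneous hdeg (by omega)
  have hE0 := hE.1.ne_zero
  have hEu := hE.aeval_eq_zero
  have hkD := lt_degree_implicitEquation hf hproper hD hE0 hEu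
  let f : Fin 4 ⊕ Fin (k - 1) → PolyTX K :=
    Sum.elim ![ofX E, L₀, L₁, P] (fun j => F (j + 1))
  have hrange : Set.range f = specialSet k E P F L₀ L₁ := by
    rw [specialSet, Set.Sum.elim_range]
    congr 1
    · ext G
      simp [eq_comm]
      tauto
    · ext G
      constructor
      · rintro ⟨j, rfl⟩
        exact ⟨j + 1, ⟨by omega, by omega⟩, rfl⟩
      · rintro ⟨j, ⟨h1, h2⟩, rfl⟩
        refine ⟨⟨j - 1, by omega⟩, ?_⟩
        simp only
        congr 1
        omega
  have key := isMinimalGeneratingSet_range (J := definingIdeal u) f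
    (hrange ▸ span_specialSet_eq hf hs hdeg hE) ?_
  · rw [hrange] at key
    refine ⟨key.1, key.2.trans ?_⟩
    simp
    omega
  · intro i hi
    obtain ⟨q, hqi, hq⟩ := exists_sum_eq_of_mem_span_image_compl hi
    rw [Fintype.sum_sum_type, Fin.sum_univ_four] at hq
    rcases i with i | i
    · fin_cases i
      · refine implicitEquation_ne_combination hf hs hE0 (q (.inl 1)) (q (.inl 2)) (q (.inl 3))
          (fun j => q (.inr j)) (Eq.trans ?_ hq)
        have h0 : q (.inl 0) = 0 := hqi
        rw [h0, zero_mul, zero_add]; rfl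
      · refine L_ne_combination hf hs hD hkD (q (.inl 0)) (q (.inl 2)) (q (.inl 3))
          (fun j => q (.inr j)) (Eq.trans ?_ hq)
        have h0 : q (.inl 1) = 0 := hqi
        rw [h0, zero_mul, add_zero]; rfl
      · refine L_ne_combination hf hs.swap hD hkD (q (.inl 0)) (q (.inl 1)) (q (.inl 3))
          (fun j => q (.inr j)) (Eq.trans ?_ hq)
        have h0 : q (.inl 2) = 0 := hqi
        rw [h0, zero_mul, add_zero]; rfl
      · refine P_ne_combination hk hf hs hD hkD hmu (q (.inl 0)) (q (.inl 1)) (q (.inl 2))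
          (fun j => q (.inr j)) (Eq.trans ?_ hq)
        have h0 : q (.inl 3) = 0 := hqi
        rw [h0, zero_mul, add_zero]; rfl
    · exact F_ne_combination hf hs hD hE0 hEu (q (.inl 0)) (q (.inl 1)) (q (.inl 2)) (q (.inl 3))
        (fun j => q (.inr j)) i hqi hq

end Minimality

/-! ### Construction of a special family from a frame. -/

section Existence

variable {a b : Fin 3 → K} {x : Coordinates a b} {u : Fin 3 → PolyT K} {k : ℕ}
  {p₀ p₁ g w : PolyT K}

theorem Coordinates.relation_ne_zero (x : Coordinates a b) (h : p₁ ≠ 0) :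
    C p₁ * constForm a - C p₀ * constForm b ≠ 0 := by
  intro h0
  -- With `1, 0` in place of the quadrics, the relation maps to `p₁ Z`.
  have h1 := congrArg (x.psi 1 0) h0
  simp only [map_sub, map_mul, Coordinates.psi_C, Coordinates.psi_a, Coordinates.psi_b,
    map_zero, map_one, zero_mul, mul_zero, sub_zero, one_mul, mul_eq_zero, Polynomial.C_eq_zero,
    Polynomial.X_ne_zero, or_false] at h1
  exact h h1

theorem natDegree_psi_linForm_le (hf : IsFrame x u k p₀ p₁ g w) (y : Fin 3 → PolyT K) :
    (x.psi p₀ p₁ (linForm y)).natDegree ≤ 1 := by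
  rw [linForm, map_sum]
  refine Polynomial.natDegree_sum_le_of_forall_le _ _ fun i _ => ?_
  have hX : IsBihomogeneous (X i : PolyTX K) 0 1 := by
    simpa [ofX] using IsBihomogeneous.ofX (isHomogeneous_X K i)
  rw [map_mul, Coordinates.psi_C]
  exact (Polynomial.natDegree_C_mul_le _ _).trans (x.isGraded_psi hf.hp₀ hf.hp₁ hX).natDegree_le

/-- A linear form has image of `Z`-degree at most `1`, so for a syzygy the quotient by `w Z - g` is
some `h ∈ 𝕂[T]`. Subtracting `h Q` leaves a multiple of `P`. -/
theorem isMuBasis_of_psi_eq (hf : IsFrame x u k p₀ p₁ g w) {Q : PolyTX K}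
    (hQ : IsBihomogeneous Q (2 * (k - 1)) 1)
    (hpsi : x.psi p₀ p₁ Q = Polynomial.C w * Polynomial.X - Polynomial.C g) :
    IsMuBasis u 2 (2 * (k - 1)) (C p₁ * constForm a - C p₀ * constForm b) Q := by
  have hP := isHomogeneous_P a b hf.hp₀ hf.hp₁
  obtain ⟨s, hs, hPs⟩ := exists_eq_linForm hP
  obtain ⟨t, ht, rfl⟩ := exists_eq_linForm hQ
  have hs0 : s ≠ 0 := by
    rintro rfl
    exact x.relation_ne_zero hf.p₁_ne_zero (hPs.trans (by simp [linForm]))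
  have hpsis : x.psi p₀ p₁ (linForm s) = 0 := hPs ▸ x.psi_relation p₀ p₁
  refine ⟨s, t, hPs, rfl, hs, ht, ?_, le_antisymm ?_ ?_⟩
  · rw [LinearIndependent.pair_iff]
    intro α β h
    have h1 := congrArg (fun y => x.psi p₀ p₁ (linForm y)) h
    simp only [linForm_add, linForm_smul, map_add, map_mul, hpsis, hpsi, Coordinates.psi_C,
      mul_zero, zero_add] at h1
    have hβ : β = 0 := by
      have h2 : Polynomial.C β * (Polynomial.C w * Polynomial.X - Polynomial.C g) =
          0 * (Polynomial.C w * Polynomial.X - Polynomial.C g) := by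
        rw [h1, zero_mul]; simp [linForm]
      simpa using mul_linear_injective hf h2
    subst hβ
    rw [zero_smul, add_zero, smul_eq_zero] at h
    exact ⟨h.resolve_right hs0, rfl⟩
  · rw [Submodule.span_le]
    rintro y (rfl | rfl)
    · exact mem_syz_iff.2 (x.aeval_eq_zero_of_dvd_psi hf.w_ne_zero hf.hu
        (isHomogeneous_linForm _) (hpsis ▸ dvd_zero _))
    · exact mem_syz_iff.2 (x.aeval_eq_zero_of_dvd_psi hf.w_ne_zero hf.hu
        (isHomogeneous_linForm _) (hpsi ▸ dvd_rfl))
  · intro y hy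
    obtain ⟨A, hA⟩ := x.dvd_psi_of_aeval_eq_zero (p₀ := p₀) (p₁ := p₁) hf.w_ne_zero hf.hgw hf.hu
      (isHomogeneous_linForm _) (mem_syz_iff.1 hy)
    have hconst : ∃ h, A = Polynomial.C h := by
      by_cases hA0 : A = 0
      · exact ⟨0, by simp [hA0]⟩
      · have hd : (Polynomial.C w * Polynomial.X - Polynomial.C g).natDegree = 1 := by
          rw [Polynomial.natDegree_sub_C, Polynomial.natDegree_C_mul_X _ hf.w_ne_zero]
        have h1 := natDegree_psi_linForm_le hf y
        rw [hA, Polynomial.natDegree_mul (fun h0 => by simp [h0] at hd) hA0, hd] at h1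
        obtain ⟨h, hh⟩ := Polynomial.natDegree_eq_zero.1 (by omega : A.natDegree = 0)
        exact ⟨h, hh.symm⟩
    obtain ⟨h, rfl⟩ := hconst
    have hdvd := x.dvd_of_psi_eq_zero hf.hp hf.p₁_ne_zero (isHomogeneous_linForm (y - h • t))
      (by rw [linForm_sub, linForm_smul, map_sub, map_mul, hA, hpsi, Coordinates.psi_C]; ring)
    rw [hPs] at hdvd
    obtain ⟨q, hq⟩ := eq_smul_of_linForm_dvd hdvd
    rw [Submodule.mem_span_pair]
    exact ⟨q, h, by rw [← hq]; simp⟩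

theorem exists_isLinearPair {P M : PolyTX K} {i j : ℕ} (hP : IsBihomogeneous P 2 i)
    (hM : IsBihomogeneous M 2 j) : ∃ L₀ L₁, IsLinearPair P M L₀ L₁ := by
  obtain ⟨f₀, f₁, f₂, rfl⟩ := exists_eq_quadT hP
  obtain ⟨m₀, m₁, m₂, rfl⟩ := exists_eq_quadT hM
  refine ⟨C (X 1) * (ofX m₀ * ofX f₁ - ofX f₀ * ofX m₁) +
      C (X 0) * (ofX m₀ * ofX f₂ - ofX f₀ * ofX m₂),
    C (X 0) * (ofX m₁ * ofX f₀ - ofX f₁ * ofX m₀) +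
      C (X 1) * (ofX m₁ * ofX f₂ - ofX f₁ * ofX m₂), f₀, f₁, f₂, m₀, m₁, m₂, rfl, rfl, ?_, ?_⟩
  all_goals
    simp only [quadT, C_mul, C_pow]
    ring

theorem exists_isDT (hf : IsFrame x u k p₀ p₁ g w) {j : ℕ} (hj : j < k - 1) {G : PolyTX K}
    (hG : IsBihomogeneous G (2 * (k - j)) j) :
    ∃ D, IsDT p₀ p₁ (constForm a) (constForm b) (2 * (k - j - 1)) j G D ∧
      IsBihomogeneous D (2 * (k - (j + 1))) (j + 1) := by
  obtain ⟨G₀, G₁, h₀, h₁, rfl⟩ := exists_coeffwise_decomposition (i' := 2 * (k - j - 1))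
    (fun f hfh => exists_eq_quadrics_mul_add hf.hp₀ hf.hp₁ hf.hp (by omega)
      (by rwa [show 2 * (k - j - 1) + 2 = 2 * (k - j) by omega])) hG
  have hDT : IsDT p₀ p₁ (constForm a) (constForm b) (2 * (k - j - 1)) j (C p₀ * G₀ + C p₁ * G₁) _ :=
    ⟨G₀, G₁, h₀, h₁, rfl, rfl⟩
  exact ⟨_, hDT, (psi_of_isDT x hDT).1⟩

theorem exists_isSpecialFamily (hf : IsFrame x u k p₀ p₁ g w) :
    ∃ (P : PolyTX K) (F : ℕ → PolyTX K) (L₀ L₁ : PolyTX K), IsSpecialFamily u k a b P F L₀ L₁ := by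
  have hk := hf.two_le
  have hW : IsGraded (Polynomial.C w * Polynomial.X - Polynomial.C g) (2 * (k - 1)) 1 := by
    have h1 := IsGraded.C_mul_X_pow (i := 2 * (k - 1)) (n := 1) (c := w)
      (by rw [show 2 * (k - 1) + 2 * 1 = 2 * k by omega]; exact hf.hw)
    have h2 := IsGraded.C_mul_X_pow (i := 2 * (k - 1)) (n := 0) (c := -g) hf.hg.neg
    simpa [sub_eq_add_neg] using h1.add (h2.mono zero_le_one)
  obtain ⟨Q, hQ, hpsi⟩ := x.exists_psi_eq hf.hp₀ hf.hp₁ hf.hp (by omega) hW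
  have hstep : ∀ (j : ℕ) (G : PolyTX K), ∃ D : PolyTX K, j < k - 1 →
      IsBihomogeneous G (2 * (k - j)) j →
      IsDT p₀ p₁ (constForm a) (constForm b) (2 * (k - j - 1)) j G D ∧
        IsBihomogeneous D (2 * (k - (j + 1))) (j + 1) := by
    intro j G
    by_cases h : j < k - 1 ∧ IsBihomogeneous G (2 * (k - j)) j
    · obtain ⟨D, hD⟩ := exists_isDT hf h.1 h.2
      exact ⟨D, fun _ _ => hD⟩
    · exact ⟨0, fun h₁ h₂ => absurd ⟨h₁, h₂⟩ h⟩
  choose step hstep using hstep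
  -- The family starts at index `1`; `F 0` is a junk value equal to `F 1`.
  let F : ℕ → PolyTX K := fun j => Nat.rec Q (fun n G => step (n + 1) G) (j - 1)
  have hF : ∀ j, 1 ≤ j → F (j + 1) = step j (F j) := by
    intro j hj
    obtain ⟨j, rfl⟩ := Nat.exists_eq_succ_of_ne_zero (by omega : j ≠ 0)
    rfl
  have hb : ∀ j, 1 ≤ j → j ≤ k - 1 → IsBihomogeneous (F j) (2 * (k - j)) j := by
    intro j hj
    induction j, hj using Nat.le_induction with
    | base => exact fun _ => hQ
    | succ j hj ih =>
      intro hjk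
      rw [hF j hj]
      exact (hstep j (F j) (by omega) (ih (by omega))).2
  have hM := hb (k - 1) (by omega) le_rfl
  rw [show 2 * (k - (k - 1)) = 2 by omega] at hM
  obtain ⟨L₀, L₁, hL⟩ := exists_isLinearPair (isHomogeneous_P a b hf.hp₀ hf.hp₁) hM
  refine ⟨_, F, L₀, L₁, p₀, p₁, hf.hp₀, hf.hp₁, rfl, isMuBasis_of_psi_eq hf hQ hpsi, ?_, hL⟩
  intro j hj hjk
  rw [hF j hj]
  exact (hstep j (F j) hjk (hb j hj (by omega))).1

end Existence

/-! ### A Hilbert function bound for the degree of the curve. -/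

section Degree

variable {u : Fin 3 → PolyT K} {E : PolyX K}

/-- The degree of the image curve is at most the degree of the parametrization. -/
theorem IsImplicitEquation.degree_le [IsAlgClosed K] (hE : IsImplicitEquation u E) {d D : ℕ}
    (hu : ∀ i, (u i).IsHomogeneous d) (hD : E.IsHomogeneous D) : D ≤ d := by
  by_contra! hlt
  -- Forms of degree `n + D` modulo multiples of `E` embed into binary forms of degree `d (n + D)`.
  -- The dimensions grow like `D n` and `d n`, and this `n` is large enough to contradict `D > d`.
  let n := d * D + 1
  let φ : homogeneousSubmodule (Fin 3) K (n + D) →ₗ[K] homogeneousSubmodule (Fin 2) K (d * (n + D)) :=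
    ((aeval u).toLinearMap.comp (Submodule.subtype _)).codRestrict _ fun G => G.2.aeval _ hu
  let ψ : homogeneousSubmodule (Fin 3) K n →ₗ[K] homogeneousSubmodule (Fin 3) K (n + D) :=
    ((LinearMap.mulRight K E).comp (Submodule.subtype _)).codRestrict _ fun G => G.2.mul hD
  have hker : LinearMap.ker φ ≤ LinearMap.range ψ := by
    intro G hG
    have hG0 : aeval u G.1 = 0 := congrArg Subtype.val (LinearMap.mem_ker.1 hG)
    obtain ⟨q, hq⟩ := hE.dvd G.2 hG0
    have hqh : (homogeneousComponent n q) * E = G.1 := by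
      rw [← homogeneousComponent_mul_of_isHomogeneous hD, mul_comm, ← hq,
        homogeneousComponent_eq_self G.2]
    exact ⟨⟨homogeneousComponent n q, homogeneousComponent_isHomogeneous _ _⟩, Subtype.ext hqh⟩
  have h1 := LinearMap.finrank_range_add_finrank_ker φ
  have h2 := Submodule.finrank_mono hker
  have h3 := LinearMap.finrank_range_le ψ
  have h4 := Submodule.finrank_le (LinearMap.range φ)
  rw [finrank_homogeneousSubmodule_fin_two] at h4
  have h5 := finrank_homogeneousSubmodule_fin_three (K := K) (n + D)
  have h6 := finrank_homogeneousSubmodule_fin_three (K := K) n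
  have h7 : (n + D + 1) * (n + D + 2) ≤ 2 * (d * (n + D) + 1) + (n + 1) * (n + 2) := by
    rw [← h5, ← h6]; omega
  obtain ⟨f, rfl⟩ : ∃ f, D = d + 1 + f := ⟨D - (d + 1), by omega⟩
  have hn : n = d * (d + 1 + f) + 1 := rfl
  nlinarith [Nat.zero_le f, Nat.zero_le d, Nat.zero_le (n * f)]

end Degree

/-! ### Expansion of the equation in the third adapted coordinate. -/

section Expansion

/-- More than `natDegree ε` polynomials are linearly dependent modulo `ε`. -/
theorem exists_sum_C_mul_eq_mul {R : Type*} [CommRing R] [IsDomain R] {ε : Polynomial R}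
    (hε : ε ≠ 0) {r : ℕ} (hr : ε.natDegree < r) (ω : Fin r → Polynomial R) :
    ∃ c : Fin r → R, c ≠ 0 ∧ ∃ h : Polynomial R, ∑ a, Polynomial.C (c a) * ω a = h * ε := by
  let M := (Finset.univ.sup fun a => (ω a).natDegree) + 1
  let f : (Fin r → R) × Polynomial.degreeLT R M →ₗ[R] Polynomial R :=
    (Fintype.linearCombination R ω).coprod ((LinearMap.mulRight R ε).comp (Submodule.subtype _))
  have hfapply : ∀ c h, f (c, h) = ∑ a, Polynomial.C (c a) * ω a + h.1 * ε := fun c h => by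
    simp [f, Fintype.linearCombination_apply, Polynomial.smul_eq_C_mul]
  have hf : ∀ y, f y ∈ Polynomial.degreeLT R (M + ε.natDegree) := by
    rintro ⟨c, h⟩
    rw [hfapply]
    refine add_mem (sum_mem fun a _ => ?_) ?_
    · rw [← Polynomial.smul_eq_C_mul]
      refine Submodule.smul_mem _ _ (Polynomial.mem_degreeLT.2 ?_)
      refine Polynomial.degree_le_natDegree.trans_lt (Nat.cast_lt.2 ?_)
      have := Finset.le_sup (f := fun a => (ω a).natDegree) (Finset.mem_univ a)
      omega
    · have := Polynomial.mem_degreeLT.1 h.2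
      rw [Polynomial.mem_degreeLT, Polynomial.degree_mul, Polynomial.degree_eq_natDegree hε,
        Nat.cast_add]
      exact WithBot.add_lt_add_right (WithBot.coe_ne_bot) this
  -- The source has rank `r + M`, the target only `M + natDegree ε`.
  have hnot : ¬ Function.Injective (f.codRestrict _ hf) := by
    intro hinj
    have h1 := card_le_of_injective R
      ((Polynomial.degreeLTEquiv R (M + ε.natDegree)).toLinearMap ∘ₗ f.codRestrict _ hf ∘ₗ
        (LinearMap.prodMap LinearMap.id (Polynomial.degreeLTEquiv R M).symm.toLinearMap) ∘ₗ
        (LinearEquiv.sumArrowLequivProdArrow (Fin r) (Fin M) R R).toLinearMap) (by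
        simp only [LinearMap.coe_comp, LinearEquiv.coe_coe, LinearMap.coe_prodMap]
        exact (LinearEquiv.injective _).comp (hinj.comp
          ((Function.injective_id.prodMap (LinearEquiv.injective _)).comp
            (LinearEquiv.injective _))))
    simp only [Fintype.card_sum, Fintype.card_fin] at h1
    omega
  rw [← LinearMap.ker_eq_bot, Submodule.eq_bot_iff] at hnot
  push Not at hnot
  obtain ⟨⟨c, h⟩, hker, hne⟩ := hnot
  have h0 : ∑ a, Polynomial.C (c a) * ω a + h.1 * ε = 0 := by
    rw [← hfapply]; exact congrArg Subtype.val (LinearMap.mem_ker.1 hker)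
  refine ⟨c, ?_, -h.1, by linear_combination h0⟩
  rintro rfl
  have : h.1 = 0 := by simpa [hε] using h0
  exact hne (Prod.ext rfl (Subtype.ext this))

variable {a b : Fin 3 → K} (x : Coordinates a b)

/-- The expansion of `E` in adapted coordinates, as a polynomial in the third one. -/
noncomputable def Coordinates.expand : PolyX K →ₐ[K] Polynomial (PolyT K) :=
  aeval (x.point ![Polynomial.C (X 0), Polynomial.C (X 1), Polynomial.X])

theorem Coordinates.aevalTower_expand {S : Type*} [CommRing S] [Algebra K S] (q₀ q₁ y : S)
    (G : PolyX K) :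
    Polynomial.aevalTower (aeval ![q₀, q₁] : PolyT K →ₐ[K] S) y (x.expand G) =
      aeval (x.point ![q₀, q₁, y]) G := by
  rw [expand, ← AlgHom.comp_apply, comp_aeval]
  congr 2
  funext i
  rw [map_point]
  congr 1
  funext r
  fin_cases r <;> simp

/-- All monomials of `f ∈ 𝕂[X₀, X₁][X₂]` have total degree `D`. -/
def IsForm (f : Polynomial (PolyT K)) (D : ℕ) : Prop :=
  ∀ n m, coeff m (f.coeff n) ≠ 0 → m.degree + n = D

namespace IsForm

variable {f h : Polynomial (PolyT K)} {D D' : ℕ}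

theorem add (hf : IsForm f D) (hh : IsForm h D) : IsForm (f + h) D := by
  intro n m hm
  rw [Polynomial.coeff_add, coeff_add] at hm
  by_cases h0 : coeff m (f.coeff n) = 0
  · exact hh n m (by simpa [h0] using hm)
  · exact hf n m h0

theorem sum {ι : Type*} {s : Finset ι} {f : ι → Polynomial (PolyT K)}
    (hf : ∀ a ∈ s, IsForm (f a) D) : IsForm (∑ a ∈ s, f a) D :=
  Finset.sum_induction f (fun G => IsForm G D) (fun _ _ => add) (fun _ _ hm => by simp at hm) hf

theorem mul (hf : IsForm f D) (hh : IsForm h D') : IsForm (f * h) (D + D') := by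
  intro n m hm
  rw [Polynomial.coeff_mul, coeff_sum] at hm
  obtain ⟨y, hy, hm⟩ := Finset.exists_ne_zero_of_sum_ne_zero hm
  rw [coeff_mul] at hm
  obtain ⟨z, hz, hm⟩ := Finset.exists_ne_zero_of_sum_ne_zero hm
  have h1 := hf _ _ (left_ne_zero_of_mul hm)
  have h2 := hh _ _ (right_ne_zero_of_mul hm)
  rw [← Finset.HasAntidiagonal.mem_antidiagonal.1 hy,
    ← Finset.HasAntidiagonal.mem_antidiagonal.1 hz, map_add]
  omega

theorem C {c : PolyT K} (hc : c.IsHomogeneous D) : IsForm (Polynomial.C c) D := by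
  intro n m hm
  rw [Polynomial.coeff_C] at hm
  split_ifs at hm with hn
  · rw [hn, add_zero, Finsupp.degree_eq_weight_one]; exact hc hm
  · simp at hm

theorem X : IsForm (Polynomial.X : Polynomial (PolyT K)) 1 := by
  intro n m hm
  rw [Polynomial.coeff_X] at hm
  split_ifs at hm with hn
  · rw [← hn, (by simpa [coeff_one, eq_comm] using hm : m = 0)]; simp
  · simp at hm

theorem pow (hf : IsForm f 1) (n : ℕ) : IsForm (f ^ n) n := by
  induction n with
  | zero => simpa using C (isHomogeneous_one (Fin 2) K)
  | succ n ih => rw [pow_succ]; exact ih.mul hf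

theorem isHomogeneous_coeff (hf : IsForm f D) {n l : ℕ} (hl : l + n = D) :
    (f.coeff n).IsHomogeneous l := by
  intro m hm
  have := hf n m hm
  rw [show (1 : Fin 2 → ℕ) = fun _ => 1 from rfl, ← Finsupp.degree_eq_weight_one]
  omega

theorem natDegree_le (hf : IsForm f D) : f.natDegree ≤ D := by
  refine Polynomial.natDegree_le_iff_coeff_eq_zero.2 fun n hn => ?_
  ext m
  by_contra hm
  have := hf n m (by simpa using hm)
  omega

end IsForm

theorem Coordinates.isForm_expand {G : PolyX K} {D : ℕ} (hG : G.IsHomogeneous D) :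
    IsForm (x.expand G) D := by
  have hX : ∀ l, IsForm (x.point ![Polynomial.C (X 0), Polynomial.C (X 1), Polynomial.X] l :
      Polynomial (PolyT K)) 1 := by
    intro l
    refine IsForm.sum fun r _ => ?_
    suffices h : IsForm ((![Polynomial.C (X 0), Polynomial.C (X 1), Polynomial.X] :
        Fin 3 → Polynomial (PolyT K)) r) 1 by
      simpa using (IsForm.C (isHomogeneous_C (Fin 2) (x.N l r))).mul h
    fin_cases r
    · exact IsForm.C (isHomogeneous_X K 0)
    · exact IsForm.C (isHomogeneous_X K 1)
    · exact IsForm.X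
  rw [expand, aeval_def, eval₂_eq']
  refine IsForm.sum fun m hm => ?_
  have hdeg := hG.degree_eq_sum_deg_support hm
  have hm3 : m 0 + m 1 + m 2 = D := by
    rw [hdeg, ← Finsupp.degree_apply, Finsupp.degree_eq_sum, Fin.sum_univ_three]
  have h1 : IsForm (algebraMap K (Polynomial (PolyT K)) (coeff m G)) 0 :=
    IsForm.C (isHomogeneous_C (Fin 2) (coeff m G))
  rw [Fin.prod_univ_three]
  have := h1.mul ((((hX 0).pow (m 0)).mul ((hX 1).pow (m 1))).mul ((hX 2).pow (m 2)))
  rwa [hm3, zero_add] at this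

/-- The expansion determines the polynomial. -/
theorem Coordinates.expand_injective : Function.Injective x.expand := by
  let back : Polynomial (PolyT K) →ₐ[K] PolyX K := Polynomial.aevalTower
    (aeval ![∑ i, C (a i) * X i, ∑ i, C (b i) * X i]) (∑ i, C (x.c i) * X i)
  refine Function.LeftInverse.injective (g := back) fun G => ?_
  rw [x.aevalTower_expand]
  conv_rhs => rw [← aeval_X_left_apply G]
  congr 2
  funext i
  rw [← x.point_sum (fun i => (X i : PolyX K)) i]
  congr 1
  funext r
  fin_cases r <;> rfl

end Expansion

/-! ### Multiplicity, and the degree of the projection from the point. -/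

section VerySingular

variable {a b : Fin 3 → K} (x : Coordinates a b) {u : Fin 3 → PolyT K} {E : PolyX K}

/-- A form of degree `D` of multiplicity at least `n` at the third coordinate point has degree at
most `D - n` in the third coordinate. -/
theorem Coordinates.natDegree_expand_add_le {D : ℕ} (hD : E.IsHomogeneous D) (hE : E ≠ 0)
    {p : Fin 3 → K} (hp : p ≠ 0) (ha : ∑ i, a i * p i = 0) (hb : ∑ i, b i * p i = 0) :
    (x.expand E).natDegree + curveMult E p ≤ D := by
  have hps : x.point ![0, 0, ∑ i, x.c i * p i] = p := by
    funext i
    rw [← x.point_sum p i]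
    congr 1
    funext r
    fin_cases r
    · simp [ha]
    · simp [hb]
    · simp
  set s := ∑ i, x.c i * p i
  have hs : s ≠ 0 := by
    intro h0
    rw [h0] at hps
    refine hp (hps.symm.trans (funext fun i => ?_))
    simp [point, Fin.sum_univ_three]
  have hform := x.isForm_expand hD
  have hε : x.expand E ≠ 0 := fun h => hE (x.expand_injective (h.trans (map_zero _).symm))
  -- `i` is the degree of the leading coefficient of `E` in the third coordinate. Up to a power of
  -- `s ≠ 0`, that coefficient is the component of degree `i` of `E(p + X)` along the first two
  -- coordinates, so `i` cannot be below the multiplicity.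
  obtain ⟨i, hi⟩ : ∃ i, i + (x.expand E).natDegree = D :=
    ⟨_, Nat.sub_add_cancel hform.natDegree_le⟩
  by_contra! hlt
  have hi0 : i < curveMult E p := by omega
  have h0 : homogeneousComponent i (aeval (fun j => (X j + C (p j) : PolyX K)) E) = 0 := by
    by_contra h
    exact Nat.notMem_of_lt_sInf hi0 h
  have hv : ∀ j, (x.point ![X 0, X 1, 0] j : PolyT K).IsHomogeneous 1 := by
    intro j
    refine IsHomogeneous.sum _ _ _ fun r _ => ?_
    rw [algebraMap_eq]
    refine IsHomogeneous.C_mul ?_ _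
    fin_cases r
    · exact isHomogeneous_X K 0
    · exact isHomogeneous_X K 1
    · exact isHomogeneous_zero _ _ _
  have h1 := congrArg (aeval (x.point ![X 0, X 1, 0] : Fin 3 → PolyT K)) h0
  rw [← homogeneousComponent_aeval hv one_ne_zero, map_zero, ← AlgHom.comp_apply, comp_aeval] at h1
  have h2 : (fun j => aeval (x.point ![X 0, X 1, 0] : Fin 3 → PolyT K) (X j + C (p j) : PolyX K)) =
      x.point ![X 0, X 1, C s] := by
    funext j
    conv_lhs => rw [← hps]
    simp [point, Fin.sum_univ_three, add_assoc]
  rw [h2, ← x.aevalTower_expand] at h1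
  have h3 : Polynomial.aevalTower (aeval ![X 0, X 1] : PolyT K →ₐ[K] PolyT K) (C s) (x.expand E) =
      ∑ n ∈ Finset.range ((x.expand E).natDegree + 1), (x.expand E).coeff n * C s ^ n := by
    have : (aeval ![X 0, X 1] : PolyT K →ₐ[K] PolyT K) = AlgHom.id K _ := by
      ext j; fin_cases j <;> simp
    rw [this]
    exact Polynomial.eval_eq_sum_range _
  rw [h3, map_sum, Finset.sum_eq_single_of_mem (x.expand E).natDegree (by simp)] at h1
  · rw [one_mul, ← C_pow, mul_comm, homogeneousComponent_C_mul,
      homogeneousComponent_eq_self (hform.isHomogeneous_coeff hi)] at h1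
    simp [hs, hε] at h1
  · intro n hn hne
    obtain ⟨l, hl⟩ : ∃ l, l + n = D := ⟨D - n, by
      have := hform.natDegree_le; rw [Finset.mem_range] at hn; omega⟩
    rw [one_mul, ← C_pow, mul_comm, homogeneousComponent_C_mul,
      homogeneousComponent_of_mem (hform.isHomogeneous_coeff hl), if_neg (by omega), mul_zero]

/-- If `(q₀ : q₁)` is the projection of a proper parametrization from the third coordinate point,
then its degree is at most the degree of the equation in the third coordinate. -/
theorem Coordinates.le_natDegree_expand (hproper : IsProperParametrization u)
    {g q₀ q₁ w : PolyT K} {r D : ℕ} (hr : r ≠ 0) (h₀ : q₀.IsHomogeneous r) (h₁ : q₁.IsHomogeneous r)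
    (h : IsRelPrime q₀ q₁) (hg : g ≠ 0) (hu : ∀ i, u i = x.point ![g * q₀, g * q₁, w] i)
    (hD : E.IsHomogeneous D) (hE : E ≠ 0) (hEu : aeval u E = 0) :
    r ≤ (x.expand E).natDegree := by
  by_contra! hlt
  obtain ⟨l, A, B, hA, hB, hne, hAB⟩ := hproper
  -- The inverse map gives `A(u) = T₀ f` and `B(u) = T₁ f`.
  obtain ⟨f, hf⟩ : (X 0 : PolyT K) ∣ aeval u A := by
    have hdvd : (X 0 : PolyT K) ∣ X 1 * aeval u A := ⟨_, hAB⟩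
    refine ((X_prime : Prime (X 0 : PolyT K)).dvd_or_dvd hdvd).resolve_left fun h => ?_
    simpa using X_dvd_X.1 h
  have hf' : aeval u B = X 1 * f := by
    refine mul_left_cancel₀ (X_ne_zero (0 : Fin 2)) ?_
    rw [← hAB, hf]; ring
  have hf0 : f ≠ 0 := by
    rintro rfl
    rw [hf, hf', mul_zero, mul_zero] at hne
    simp at hne
  have hε : x.expand E ≠ 0 := fun h => hE (x.expand_injective (h.trans (map_zero _).symm))
  -- If `E` had degree below `r` in the third coordinate, the `r` products `A^e B^(r-1-e)` would be
  -- dependent modulo `E` over `𝕂[X₀, X₁]`. At `u` they become `f^(r-1)` times the monomials of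
  -- degree `r - 1`, which are independent over `𝕂[q₀, q₁]`.
  obtain ⟨c, hc, q, hq⟩ := exists_sum_C_mul_eq_mul hε hlt
    fun e : Fin r => x.expand (A ^ (e : ℕ) * B ^ (r - 1 - e))
  let φ := algebraMap (PolyT K) (FractionRing (PolyT K))
  have hφ : Function.Injective φ := IsFractionRing.injective _ _
  have hφg : φ g ≠ 0 := (map_ne_zero_iff φ hφ).2 hg
  let Φ := Polynomial.aevalTower (aeval ![φ q₀, φ q₁] : PolyT K →ₐ[K] FractionRing (PolyT K))
    (φ w / φ g)
  have hφa : ∀ (v : Fin 3 → PolyT K) (G : PolyX K), aeval (fun i => φ (v i)) G = φ (aeval v G) :=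
    fun v G => by
      have := aeval_algebraMap_apply (FractionRing (PolyT K)) v G
      exact this
  have hkey : ∀ (G : PolyX K) (n : ℕ), G.IsHomogeneous n →
      φ g ^ n * Φ (x.expand G) = φ (aeval u G) := by
    intro G n hG
    rw [x.aevalTower_expand, ← aeval_smul_of_isHomogeneous hG, ← hφa]
    congr 2
    funext i
    rw [hu, ← x.point_mul]
    have := x.map_point (IsScalarTower.toAlgHom K (PolyT K) (FractionRing (PolyT K)))
      ![g * q₀, g * q₁, w] i
    refine Eq.trans ?_ this.symm
    congr 1
    funext e
    fin_cases e
    · simp [φ]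
    · simp [φ]
    · simp [φ, mul_div_cancel₀ _ hφg]
  have hΦE : Φ (x.expand E) = 0 := by
    have := hkey E D hD
    rw [hEu, map_zero] at this
    exact (mul_eq_zero.1 this).resolve_left (pow_ne_zero _ hφg)
  have hΦC : ∀ e : PolyT K, Φ (Polynomial.C e) = φ (aeval ![q₀, q₁] e) := by
    intro e
    rw [Polynomial.aevalTower_C]
    have := aeval_algebraMap_apply (FractionRing (PolyT K)) ![q₀, q₁] e
    refine Eq.trans ?_ this
    congr 2
    funext j
    fin_cases j <;> rfl
  have hsum : ∑ e : Fin r, aeval ![q₀, q₁] (c e) * (X 0 ^ (e : ℕ) * X 1 ^ (r - 1 - e)) = 0 := by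
    have h1 := congrArg (fun z => φ g ^ (l * (r - 1)) * Φ z) hq
    simp only [map_sum, map_mul, hΦE, mul_zero, Finset.mul_sum] at h1
    refine (mul_eq_zero.1 (hφ ?_ : f ^ (r - 1) * _ = 0)).resolve_left (pow_ne_zero _ hf0)
    rw [map_zero, ← h1, Finset.mul_sum, map_sum]
    refine Finset.sum_congr rfl fun e _ => ?_
    have h2 := hkey (A ^ (e : ℕ) * B ^ (r - 1 - e)) (l * (r - 1)) (by
      have := (hA.pow e).mul (hB.pow (r - 1 - e))
      rwa [← mul_add, show (e : ℕ) + (r - 1 - e) = r - 1 by omega] at this)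
    rw [map_mul x.expand, map_mul Φ] at h2
    rw [mul_left_comm (φ g ^ _), h2, hΦC, ← map_mul]
    congr 1
    rw [map_mul, map_pow, map_pow, hf, hf', mul_pow, mul_pow]
    have h3 : f ^ (r - 1) = f ^ (e : ℕ) * f ^ (r - 1 - e) := by
      rw [← pow_add]; congr 1; omega
    rw [h3]; ring
  refine hc (funext fun e => eq_of_homogeneousComponent_eq fun n => ?_)
  rw [Pi.zero_apply, map_zero]
  refine eq_zero_of_sum_aeval_mul_monomials_eq_zero hr h₀ h₁ h (n := n)
    (c := fun e => homogeneousComponent n (c e))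
    (fun e => homogeneousComponent_isHomogeneous _ _) ?_ e
  have h4 := congrArg (homogeneousComponent (r * n + (r - 1))) hsum
  rw [map_sum, map_zero] at h4
  rw [← h4]
  refine Finset.sum_congr rfl fun e _ => ?_
  have h5 : (X 0 ^ (e : ℕ) * X 1 ^ (r - 1 - e) : PolyT K).IsHomogeneous (r - 1) := by
    have := (isHomogeneous_X_pow (R := K) (0 : Fin 2) e).mul
      (isHomogeneous_X_pow (R := K) (1 : Fin 2) (r - 1 - e))
    rwa [show (e : ℕ) + (r - 1 - e) = r - 1 by omega] at this
  rw [homogeneousComponent_mul_of_isHomogeneous h5, homogeneousComponent_aeval _ hr]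
  intro j
  fin_cases j
  · exact h₀
  · exact h₁

end VerySingular

/-! ### From a very singular point to a frame. -/

section Frame

variable {a b : Fin 3 → K} (x : Coordinates a b) {u : Fin 3 → PolyT K} {k : ℕ} {E : PolyX K}

theorem sum_C_mul_ne_zero (hmu : mu u ≠ 0) {y : Fin 3 → K} (hy : y ≠ 0) :
    ∑ i, C (y i) * u i ≠ 0 := by
  intro h
  refine Nat.notMem_of_lt_sInf (Nat.pos_of_ne_zero hmu) ⟨fun i => C (y i), ?_, ?_, fun i => ?_⟩
  · rwa [mem_syz_iff, aeval_linForm]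
  · intro h0
    exact hy (funext fun i => C_injective (Fin 2) K (by simpa using congrFun h0 i))
  · exact isHomogeneous_C _ _

/-- A very singular point yields a frame in coordinates adapted to it. -/
theorem exists_isFrame_of_isVerySingular [IsAlgClosed K] (hk : 2 ≤ k)
    (hdeg : ∀ i, (u i).IsHomogeneous (2 * k)) (hcop : NoCommonFactor u)
    (hproper : IsProperParametrization u) (hmu : mu u = 2) (hE : IsImplicitEquation u E)
    {p : Fin 3 → K} (hp : IsVerySingular u E p) (ha : ∑ i, a i * p i = 0)
    (hb : ∑ i, b i * p i = 0) : ∃ p₀ p₁ g w, IsFrame x u k p₀ p₁ g w := by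
  obtain ⟨hp0, -, hmult⟩ := hp
  rw [hmu] at hmult
  obtain ⟨D, hD⟩ := hE.exists_isHomogeneous hdeg (by omega)
  have hDd := hE.degree_le hdeg hD
  have hND := x.natDegree_expand_add_le hD hE.1.ne_zero hp0 ha hb
  let v : Fin 3 → PolyT K := fun r => ∑ i, C (![a, b, x.c] r i) * u i
  have hrow : ∀ r, ![a, b, x.c] r ≠ 0 := fun r h0 => by
    have := x.sum_mul_N r r
    rw [h0] at this
    simp at this
  have hv0 : ∀ r, v r ≠ 0 := fun r => sum_C_mul_ne_zero (by omega) (hrow r)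
  have hvh : ∀ r, (v r).IsHomogeneous (2 * k) := fun r =>
    IsHomogeneous.sum _ _ _ fun i _ => (hdeg i).C_mul _
  have huv : ∀ i, u i = x.point v i := fun i => (x.point_sum u i).symm
  obtain ⟨q₀, q₁, g, hrel, hgq₀, hgq₁⟩ :=
    UniqueFactorizationMonoid.exists_reduced_factors (v 0) (hv0 0) (v 1)
  have hg0 : g ≠ 0 := by rintro rfl; exact hv0 0 (by rw [← hgq₀, zero_mul])
  have hq₀0 : q₀ ≠ 0 := by rintro rfl; exact hv0 0 (by rw [← hgq₀, mul_zero])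
  have hq₁0 : q₁ ≠ 0 := by rintro rfl; exact hv0 1 (by rw [← hgq₁, mul_zero])
  obtain ⟨e, r, her, hge, hq₀⟩ := exists_isHomogeneous_of_mul (hgq₀ ▸ hvh 0) (hgq₀ ▸ hv0 0)
  obtain ⟨r', her', hq₁⟩ := isHomogeneous_of_mul_left hge hg0 (hgq₁ ▸ hvh 1) hq₁0
  obtain rfl : r = r' := by omega
  have huq : ∀ i, u i = x.point ![g * q₀, g * q₁, v 2] i := fun i => by
    rw [huv i]
    congr 1
    funext j
    fin_cases j
    · exact hgq₀.symm
    · exact hgq₁.symm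
    · rfl
  have hgw : IsRelPrime g (v 2) := by
    intro z hzg hzw
    refine hcop z fun i => ?_
    rw [huq]
    refine Finset.dvd_sum fun j _ => Dvd.dvd.mul_left ?_ _
    fin_cases j
    · exact hzg.mul_right _
    · exact hzg.mul_right _
    · exact hzw
  have hsyz : aeval u (C q₁ * constForm a - C q₀ * constForm b) = 0 := by
    have h1 : aeval u (constForm a) = v 0 := aeval_linForm _ _
    have h2 : aeval u (constForm b) = v 1 := aeval_linForm _ _
    rw [map_sub, map_mul, map_mul, h1, h2, ← hgq₀, ← hgq₁]
    simp only [algHom_C, Algebra.algebraMap_self, RingHom.id_apply]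
    ring
  -- `q₁ ℓ₀ - q₀ ℓ₁` is a nonzero syzygy of degree `r`.
  have hr2 : 2 ≤ r := by
    rw [← hmu]
    refine Nat.sInf_le ⟨fun i => q₁ * C (a i) - q₀ * C (b i), ?_, ?_, fun i => ?_⟩
    · rw [mem_syz_iff, aeval_linForm]
      have h1 : g * ∑ i, (q₁ * C (a i) - q₀ * C (b i)) * u i = 0 := by
        have h2 : ∑ i, (q₁ * C (a i) - q₀ * C (b i)) * u i = q₁ * v 0 - q₀ * v 1 := by
          simp only [v, Finset.mul_sum, ← Finset.sum_sub_distrib]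
          exact Finset.sum_congr rfl fun i _ => by simp; ring
        rw [h2, ← hgq₀, ← hgq₁]; ring
      exact (mul_eq_zero.1 h1).resolve_left hg0
    · intro h0
      refine x.relation_ne_zero (p₀ := q₀) hq₁0 ?_
      have h1 : (linForm fun i => q₁ * C (a i) - q₀ * C (b i)) =
          C q₁ * constForm a - C q₀ * constForm b := by
        simp only [constForm, linForm, C_mul, C_sub, Finset.mul_sum, ← Finset.sum_sub_distrib]
        exact Finset.sum_congr rfl fun i _ => by ring
      rw [← h1, h0]
      simp [linForm]
    · exact (by simpa using hq₁.mul (isHomogeneous_C _ (a i)) :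
        (q₁ * C (a i)).IsHomogeneous r).sub (by simpa using hq₀.mul (isHomogeneous_C _ (b i)))
  -- Together with the multiplicity and degree bounds this gives `r ≤ 2k - 3`, so `g` has degree at
  -- least `3`.
  have hrN := x.le_natDegree_expand hproper (by omega) hq₀ hq₁ hrel hg0 huq hD hE.1.ne_zero
    hE.aeval_eq_zero
  obtain ⟨s, hs, hs0, hsh⟩ : 2 ∈ {n | ∃ s ∈ syz u, s ≠ 0 ∧ ∀ i, (s i).IsHomogeneous n} := by
    -- The infimum of the empty set would be `0`, not `2`.
    have hne : {n | ∃ s ∈ syz u, s ≠ 0 ∧ ∀ i, (s i).IsHomogeneous n}.Nonempty := by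
      by_contra h
      rw [Set.not_nonempty_iff_eq_empty] at h
      rw [mu, h, Nat.sInf_empty] at hmu
      omega
    have := Nat.sInf_mem hne
    rwa [show sInf _ = 2 from hmu] at this
  -- The coefficients of the syzygy of degree `2` in adapted coordinates. As `g` divides `σ 2` and
  -- has larger degree, `σ 2 = 0`; then `q₀ σ₀ + q₁ σ₁ = 0` with `r > 2` would make the syzygy zero.
  let σ : Fin 3 → PolyT K := fun r => ∑ i, s i * C (x.N i r)
  have hσh : ∀ r, (σ r).IsHomogeneous 2 := fun r => IsHomogeneous.sum _ _ _ fun i _ => by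
    simpa using (hsh i).mul (isHomogeneous_C _ (x.N i r))
  have hσ : g * (q₀ * σ 0 + q₁ * σ 1) + v 2 * σ 2 = 0 := by
    rw [mem_syz_iff, aeval_linForm] at hs
    rw [← hs, Finset.sum_congr rfl fun i _ => congrArg (s i * ·) (huq i)]
    simp only [σ, Coordinates.point, Fin.sum_univ_three, algebraMap_eq]
    simp
    ring
  have hσ2 : σ 2 = 0 := by
    refine eq_zero_of_dvd_of_isHomogeneous_of_lt hge (hσh 2) (hgw.dvd_of_dvd_mul_left ?_)
      (by omega)
    exact ⟨-(q₀ * σ 0 + q₁ * σ 1), by linear_combination hσ⟩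
  rw [hσ2, mul_zero, add_zero, mul_eq_zero] at hσ
  have hr : r = 2 := by
    by_contra hne
    obtain ⟨h0, h1⟩ := eq_zero_of_mul_add_mul_eq_zero (by omega) hq₀ hq₁ hrel (hσh 0) (by omega)
      (hσ.resolve_left hg0)
    refine hs0 (funext fun i => ?_)
    have hsσ : ∑ r, σ r * C (![a, b, x.c] r i) = s i := by
      simp only [σ, Finset.sum_mul]
      rw [Finset.sum_comm, Finset.sum_eq_single_of_mem i (Finset.mem_univ _)]
      · simp_rw [mul_assoc, ← Finset.mul_sum, ← C_mul, ← map_sum, x.sum_N_mul]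
        simp
      · intro j _ hj
        simp_rw [mul_assoc, ← Finset.mul_sum, ← C_mul, ← map_sum, x.sum_N_mul, if_neg hj]
        simp
    rw [← hsσ, Fin.sum_univ_three, h0, h1, hσ2]
    simp
  subst hr
  obtain ⟨g', w, hf⟩ := exists_isFrame x hk hdeg hcop hq₀ hq₁ hrel hsyz
  exact ⟨q₀, q₁, g', w, hf⟩

end Frame

end ReesCurve

theorem mainTheorem2 {K : Type*} [Field K] [IsAlgClosed K] (k : ℕ) (hk : 3 ≤ k)
    (u : Fin 3 → ReesCurve.PolyT K)
    (hdeg : ∀ i, (u i).IsHomogeneous (2 * k))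
    (hcop : ReesCurve.NoCommonFactor u)
    (hproper : ReesCurve.IsProperParametrization u)
    (hmu : ReesCurve.mu u = 2)
    (E : ReesCurve.PolyX K) (hE : ReesCurve.IsImplicitEquation u E)
    (p : Fin 3 → K) (hp : ReesCurve.IsVerySingular u E p)
    (a b : Fin 3 → K) (hab : LinearIndependent K ![a, b])
    (ha : ∑ i, a i * p i = 0) (hb : ∑ i, b i * p i = 0) :
    (∃ (P : ReesCurve.PolyTX K) (F : ℕ → ReesCurve.PolyTX K) (L₀ L₁ : ReesCurve.PolyTX K),
      ReesCurve.IsSpecialFamily u k a b P F L₀ L₁) ∧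
    ∀ (P : ReesCurve.PolyTX K) (F : ℕ → ReesCurve.PolyTX K) (L₀ L₁ : ReesCurve.PolyTX K),
      ReesCurve.IsSpecialFamily u k a b P F L₀ L₁ →
        ReesCurve.IsMinimalGeneratingSet (ReesCurve.definingIdeal u)
          (ReesCurve.specialSet k E P F L₀ L₁) ∧
        (ReesCurve.specialSet k E P F L₀ L₁).ncard = k + 3 := by
  obtain ⟨x⟩ := ReesCurve.exists_coordinates hab
  refine ⟨?_, fun P F L₀ L₁ h => ?_⟩
  · obtain ⟨p₀, p₁, g, w, hf⟩ := ReesCurve.exists_isFrame_of_isVerySingular x (by omega) hdeg hcop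
      hproper hmu hE hp ha hb
    exact ReesCurve.exists_isSpecialFamily hf
  · obtain ⟨p₀, p₁, g, w, c, l₀, l₁, hf, hs, hmu⟩ :=
      ReesCurve.exists_specialValues x (by omega) hdeg hcop h
    exact ReesCurve.specialSet_isMinimalGeneratingSet hk hdeg hproper hE hf hs hmu
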